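/- **Geometric regularity criterion.** Let $(M,g)$ be a compact smooth Riemannian manifold without boundary, of dimension $n$, with unit cosphere bundle $S^*M=\{(x,\xi)\in T^*M:\|\xi\|_g=1\}$ and Liouville measure $\mu=|\theta\wedge(d\theta)^{n-1}|$ ($\theta$ the contact form). Let $t_0<T<\infty$, $\alpha\in\mathbb R$, $\nu\ge 0$, $k\ge 0$, and let $u$ be a smooth divergence-free time-dependent vector field on $[t_0,T)\times M$. Put $$S_{ij}=\tfrac12(\nabla_iu_j+\nabla_ju_i),\qquad g'(t)=g+\alpha\int_{t_0}^tS(s)\,ds,$$ and assume that $g'(t)$ is positive definite at every point of $M$ for every $t\in[t_0,T]$. Let $R^u$ be the curvature tensor of the effective connection with Christoffel symbols $\Gamma^j_{ik}+g'_{ik}u^j$, where $\Gamma^j_{ik}$ are those of the Levi-Civita connection of $g$, and let $$X_u=u^iX_i^H-(\nabla_ku^i)\,\xi_i\,\frac{\partial}{\partial\xi_k}$$ be the lift of $u$ to $T^*M$, where $X_i^H$ is the horizontal lift of $\partial/\partial x^i$. A microlocal $k$-form $\tilde\lambda$ assigns to every $(x,\xi)\in S^*M$ a complex-valued alternating $k$-form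 on $T_xM$; it is identified with its extension to $T^*M\setminus 0$ that is homogeneous of degree $0$ in $\xi$, on which $\mathcal L_{X_u}$ acts: in canonical coordinates $$(\mathcal L_{X_u}\tilde\lambda)(v_1,\dots,v_k)=(X_u\tilde\lambda)(v_1,\dots,v_k)+\sum_i\tilde\lambda(v_1,\dots,Du\,v_i,\dots,v_k).$$ Let $\tilde\lambda(t)$, $t\in[t_0,T)$, be a microlocal $k$-form that is $C^1$ in $(t,x,\xi)$ and solves the lifted evolution equation $$\partial_t\tilde\lambda+\mathcal L_{X_u}\tilde\lambda+\nu\|\xi\|_{g'}^2\tilde\lambda=\tilde R[\tilde\lambda]+\tilde C[\tilde\lambda]+\tilde F\qquad\text{on }[t_0,T)\times S^*M .$$ Here $\tilde R[\tilde\lambda]=K(R^u)\tilde\lambda$ is a zeroth-order curvature operator and $\tilde C[\tilde\lambda]=N(\nabla u)\tilde\lambda$ a zeroth-order commutator operator, where $K_{(t,x,\xi)}$ and $N_{(t,x,\xi)}$ are linear maps from the curvature-type tensors, respectively the endomorphisms of $T_xM$, to the endomorphisms of the space of $k$-forms on $T_xM$, depending continuously on $(t,x,\xi)\in[t_0,T]\times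 S^*M$; the forcing $\tilde F$ is a microlocal $k$-form, continuous on $[t_0,T]\times S^*M$. If $u$ stays bounded in $W^{2,\infty}(M)$, that is, $\sup_{t\in[t_0,T)}\|u(t)\|_{W^{2,\infty}(M)}<\infty$, then the lifted energy $$\mathcal E(t)=\frac12\int_{S^*M}\langle\tilde\lambda(t),\tilde\lambda(t)\rangle_{g'(t)}\,d\mu$$ does not blow up at time $T$: the integrand is integrable for every $t\in[t_0,T)$, and $\sup_{t\in[t_0,T)}\mathcal E(t)<\infty$. -/

import Mathlib

open Set MeasureTheory
open scoped Manifold ContDiff ENNReal NNReal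

set_option maxSynthPendingDepth 3

noncomputable section

namespace CosphereLift

/-- The model space `ℝⁿ`. Mathlib *defines* the tangent space `T_xM` as the model space, a vector
being represented by its components in the preferred chart at `x`; tensors at `x` are therefore
written below as multilinear maps on `Eu n`. -/
abbrev Eu (n : ℕ) := EuclideanSpace ℝ (Fin n)

/-- Bilinear forms on a tangent space. -/
abbrev Bil (n : ℕ) := Eu n →L[ℝ] Eu n →L[ℝ] ℝ

/-- Endomorphisms of a tangent space. -/
abbrev Endo (n : ℕ) := Eu n →L[ℝ] Eu n

/-- Tensors of the type of a curvature tensor, `(v, w, z) ↦ R(v, w) z`. -/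
abbrev Curv (n : ℕ) := Eu n →L[ℝ] Eu n →L[ℝ] Eu n →L[ℝ] Eu n

/-- Complex valued alternating `k`-forms on a tangent space. -/
abbrev KForm (n k : ℕ) := Eu n [⋀^Fin k]→L[ℝ] ℂ

/-! ### Linear algebra of a metric on a single tangent space -/

section Pointwise

variable {n : ℕ}

/-- The `i`-th coordinate vector. -/
def basisVec (i : Fin n) : Eu n := EuclideanSpace.single i 1

/-- The matrix `(b^{ij})` inverse to `(b_{ij})`. -/
def invGram (b : Bil n) : Matrix (Fin n) (Fin n) ℝ :=
  (Matrix.of fun i j => b (basisVec i) (basisVec j))⁻¹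

/-- `‖ξ‖²_b = b^{ij} ξ_i ξ_j`. -/
def coSq (b : Bil n) (ξ : Eu n →L[ℝ] ℝ) : ℝ :=
  ∑ i, ∑ j, invGram b i j * ξ (basisVec i) * ξ (basisVec j)

/-- `⟨λ, λ⟩_b = (1 / k!) b^{i₁j₁} ⋯ b^{iₖjₖ} λ_{i₁…iₖ} conj(λ_{j₁…jₖ})`. -/
def formSq {k : ℕ} (b : Bil n) (lam : KForm n k) : ℝ :=
  ((k.factorial : ℝ))⁻¹ * ∑ I : Fin k → Fin n, ∑ J : Fin k → Fin n,
    (∏ a, invGram b (I a) (J a)) *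
      (lam (fun a => basisVec (I a)) *
        (starRingEnd ℂ) (lam (fun a => basisVec (J a)))).re

/-- The length `|v|_b`. -/
def vecNorm (b : Bil n) (v : Eu n) : ℝ := Real.sqrt (b v v)

/-- Christoffel symbols `Γ(v, w)` at the point `y` of the metric `G` given on a coordinate domain:
`G(Γ(v, w), z) = ½ (D_v G (w, z) + D_w G (v, z) - D_z G (v, w))`. -/
def christoffel (G : Eu n → Bil n) (y : Eu n) : Eu n →L[ℝ] Endo n :=
  let DG : Eu n →L[ℝ] Bil n := fderiv ℝ G y
  -- `rot v w z = D_z G (v, w)`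
  let rot : Eu n →L[ℝ] Bil n :=
    (ContinuousLinearMap.flipₗᵢ ℝ (Eu n) (Eu n) ℝ).toContinuousLinearEquiv.toContinuousLinearMap ∘L
      DG.flip
  let C : Eu n →L[ℝ] Bil n := (1 / 2 : ℝ) • (DG + DG.flip - rot)
  (ContinuousLinearMap.compL ℝ (Eu n) (Eu n →L[ℝ] ℝ) (Eu n)
    (ContinuousLinearMap.inverse (G y))) ∘L C

/-- Curvature at `y` of the connection with Christoffel symbols `Γ` on a coordinate domain:
`R(v, w) z = D_vΓ(w, z) - D_wΓ(v, z) + Γ(v, Γ(w, z)) - Γ(w, Γ(v, z))`. -/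
def curvature (Γ : Eu n → (Eu n →L[ℝ] Endo n)) (y : Eu n) : Curv n :=
  let DΓ : Curv n := fderiv ℝ Γ y
  -- `Q v w z = Γ(v, Γ(w, z))`
  let Q : Curv n :=
    ((ContinuousLinearMap.compL ℝ (Eu n) (Endo n) (Endo n)).flip (Γ y)) ∘L
      (ContinuousLinearMap.compL ℝ (Eu n) (Eu n) (Eu n)) ∘L (Γ y)
  DΓ - DΓ.flip + Q - Q.flip

end Pointwise

section Manifold

variable {n : ℕ} {M : Type*} [TopologicalSpace M] [ChartedSpace (Eu n) M]
  [IsManifold (𝓡 n) ∞ M]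

/-! ### Tensor fields in the charts of `M` -/

/-- The coordinate frame of the chart at `x`, at the point with coordinates `y`. -/
def frame (x : M) (y : Eu n) : Endo n :=
  let z := (extChartAt (𝓡 n) x).symm y
  tangentCoordChange (𝓡 n) x z z

/-- The coordinate coframe of the chart at `x`, at the point with coordinates `y`. -/
def coframe (x : M) (y : Eu n) : Endo n :=
  let z := (extChartAt (𝓡 n) x).symm y
  tangentCoordChange (𝓡 n) z x z

/-- A vector field in the coordinates of the chart at `x`. -/
def vecCoord (u : M → Eu n) (x : M) (y : Eu n) : Eu n :=
  coframe x y (u ((extChartAt (𝓡 n) x).symm y))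

/-- A field of bilinear forms in the coordinates of the chart at `x`. -/
def bilCoord (b : M → Bil n) (x : M) (y : Eu n) : Bil n :=
  (b ((extChartAt (𝓡 n) x).symm y)).bilinearComp (frame x y) (frame x y)

/-- An endomorphism given in the coordinates of the chart at `x`, as an endomorphism of the tangent
space at the point with coordinates `y`. -/
def pushEndo (x : M) (y : Eu n) (A : Endo n) : Endo n :=
  frame x y ∘L A ∘L coframe x y

/-- A curvature type tensor given in the coordinates of the chart at `x`, as a tensor on the
tangent space at the point with coordinates `y`. -/
def pushCurv (x : M) (y : Eu n) (R : Curv n) : Curv n :=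
  -- `conj A = frame ∘ A ∘ coframe`
  let conj : Endo n →L[ℝ] Endo n :=
    (ContinuousLinearMap.compL ℝ (Eu n) (Eu n) (Eu n) (frame x y)) ∘L
      ((ContinuousLinearMap.compL ℝ (Eu n) (Eu n) (Eu n)).flip (coframe x y))
  (ContinuousLinearMap.compL ℝ (Eu n) (Endo n) (Endo n) conj) ∘L
    (R.bilinearComp (coframe x y) (coframe x y))

/-! ### The metric, the velocity field and the effective geometry -/

variable (n M) in
/-- Smooth Riemannian metrics on `M`. -/
abbrev Metric :=
  Bundle.ContMDiffRiemannianMetric (𝓡 n) ∞ (Eu n) (fun x : M => TangentSpace (𝓡 n) x)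

/-- The metric at `x`. -/
def metricAt (g : Metric n M) (x : M) : Bil n := g.inner x

/-- Christoffel symbols of the Levi-Civita connection of `g` in the chart at `x`. -/
def leviCivita (g : Metric n M) (x : M) (y : Eu n) : Eu n →L[ℝ] Endo n :=
  christoffel (bilCoord (metricAt g) x) y

/-- `v ↦ ∇_v u` in the chart at `x`. -/
def gradCoord (g : Metric n M) (u : M → Eu n) (x : M) (y : Eu n) : Endo n :=
  fderiv ℝ (vecCoord u x) y + (leviCivita g x y).flip (vecCoord u x y)

/-- The covariant derivative `v ↦ ∇_v u` at `x`. -/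
def grad (g : Metric n M) (u : M → Eu n) (x : M) : Endo n :=
  gradCoord g u x (extChartAt (𝓡 n) x x)

/-- The second covariant derivative `∇²u(v, w)` at `x`. -/
def grad2 (g : Metric n M) (u : M → Eu n) (x : M) (v w : Eu n) : Eu n :=
  let y := extChartAt (𝓡 n) x x
  fderiv ℝ (gradCoord g u x) y v w + leviCivita g x y v (grad g u x w)
    - grad g u x (leviCivita g x y v w)

/-- `div u = tr ∇u = 0`. -/
def DivFree (g : Metric n M) (u : M → Eu n) : Prop :=
  ∀ x, LinearMap.trace ℝ (Eu n) (grad g u x).toLinearMap = 0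

/-- The norm `‖u‖_{W^{2,∞}} = ‖u‖_∞ + ‖∇u‖_∞ + ‖∇²u‖_∞`. It is only used for smooth fields, for
which weak derivatives are classical and essential suprema are suprema. -/
def w2infNorm (g : Metric n M) (u : M → Eu n) : ℝ≥0∞ :=
  (⨆ x : M, ENNReal.ofReal (vecNorm (metricAt g x) (u x))) +
  (⨆ x : M, ⨆ v : {v : Eu n // vecNorm (metricAt g x) v ≤ 1},
    ENNReal.ofReal (vecNorm (metricAt g x) (grad g u x v))) +
  (⨆ x : M, ⨆ v : {v : Eu n // vecNorm (metricAt g x) v ≤ 1},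
    ⨆ w : {w : Eu n // vecNorm (metricAt g x) w ≤ 1},
      ENNReal.ofReal (vecNorm (metricAt g x) (grad2 g u x v w)))

/-- The deformation tensor `S(v, w) = ½ (g(∇_v u, w) + g(∇_w u, v))`. -/
def deformation (g : Metric n M) (u : M → Eu n) (x : M) : Bil n :=
  let B : Bil n := metricAt g x ∘L grad g u x
  (1 / 2 : ℝ) • (B + B.flip)

/-- The effective metric `g'(t) = g + α ∫_{t₀}^t S(s) ds`. -/
def effMetric (g : Metric n M) (α t₀ : ℝ) (u : ℝ → M → Eu n) (t : ℝ) (x : M) : Bil n :=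
  metricAt g x + α • ∫ s in t₀..t, deformation g (u s) x

/-- Christoffel symbols `(Γᵘ)^j_{ik} = Γ^j_{ik} + g'_{ik} u^j` of the effective connection in the
chart at `x`. -/
def effChristoffel (g : Metric n M) (α t₀ : ℝ) (u : ℝ → M → Eu n) (t : ℝ) (x : M) (y : Eu n) :
    Eu n →L[ℝ] Endo n :=
  leviCivita g x y +
    (ContinuousLinearMap.compL ℝ (Eu n) ℝ (Eu n)
      (ContinuousLinearMap.toSpanSingleton ℝ (vecCoord (u t) x y))) ∘L
        (bilCoord (effMetric g α t₀ u t) x y)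

/-- The curvature tensor `Rᵘ` of the effective connection at `x`. -/
def effCurvature (g : Metric n M) (α t₀ : ℝ) (u : ℝ → M → Eu n) (t : ℝ) (x : M) : Curv n :=
  curvature (effChristoffel g α t₀ u t x) (extChartAt (𝓡 n) x x)

/-! ### The cotangent bundle and the cosphere bundle -/

variable (n M) in
/-- The cotangent bundle `T*M`. -/
abbrev Cotangent := Bundle.TotalSpace (Eu n →L[ℝ] ℝ)
  (fun x : M => TangentSpace (𝓡 n) x →L[ℝ] Bundle.Trivial M ℝ x)

/-- The point `(x, ξ)` of `T*M`. -/
def mkCot (x : M) (ξ : Eu n →L[ℝ] ℝ) : Cotangent n M := ⟨x, ξ⟩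

/-- The covector `ξ` of the point `(x, ξ)`. -/
def covec (p : Cotangent n M) : Eu n →L[ℝ] ℝ := p.2

/-- `‖ξ‖_g` for a point `(x, ξ)` of `T*M`. -/
def coNorm (g : Metric n M) (p : Cotangent n M) : ℝ :=
  Real.sqrt (coSq (metricAt g p.proj) (covec p))

/-- The unit cosphere bundle `S*M = {(x, ξ) : ‖ξ‖_g = 1}`. -/
abbrev Cosphere (g : Metric n M) := {p : Cotangent n M // coNorm g p = 1}

/-- The inverse of the canonical coordinates of `T*M` over the chart at `x`:
`(y, η) ↦ ∑ ηᵢ dyⁱ`. -/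
def cotCoord (x : M) (q : Eu n × (Eu n →L[ℝ] ℝ)) : Cotangent n M :=
  mkCot ((extChartAt (𝓡 n) x).symm q.1) (q.2 ∘L coframe x q.1)

variable (n M) in
/-- The Borel sets of `T*M`. -/
instance : MeasurableSpace (Cotangent n M) := borel _

variable (n M) in
/-- The canonical volume of `T*M`, which is `dy dη` in each system of canonical coordinates. The
measures `dy dη` on the parts of `T*M` over the chart domains agree on overlaps, so that their
supremum in the lattice of measures is the measure that they define together. -/
def cotVolume : Measure (Cotangent n M) :=
  ⨆ x : M, (((volume : Measure (Eu n)).restrict (extChartAt (𝓡 n) x).target).prod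
    ((volume : Measure (Eu n)).map (InnerProductSpace.toDual ℝ (Eu n)))).map (cotCoord x)

/-- The radial projection `(x, ξ) ↦ (x, ξ / ‖ξ‖_g)`. -/
def radial (g : Metric n M) (p : Cotangent n M) : Cotangent n M :=
  mkCot p.proj ((coNorm g p)⁻¹ • covec p)

/-- The Liouville measure `|θ ∧ (dθ)^{n-1}|` of `S*M`, `θ` being the contact form. In polar
coordinates `ξ = r ζ` the canonical volume form of `T*M` is `(d(rθ))ⁿ = n r^{n-1} dr ∧ θ ∧
(dθ)^{n-1}`, and it is `n! dy dη` up to sign, so the Liouville measure of `A ⊆ S*M` is `n!` times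
the volume of the cone `{(x, r ζ) : (x, ζ) ∈ A, 0 < r < 1}`. -/
def liouville (g : Metric n M) : Measure (Cosphere g) :=
  (n.factorial : ℝ≥0∞) •
    ((((cotVolume n M).restrict {p | 0 < coNorm g p ∧ coNorm g p < 1}).map (radial g)).comap
      Subtype.val)

/-! ### Microlocal forms

A microlocal `k`-form assigns to `(x, ξ) ∈ S*M` a `k`-form on `T_xM`. As usual, sections over `S*M`
are identified with sections over `T*M ∖ 0` that are homogeneous of degree `0` in `ξ`; the field
`X_u` preserves that homogeneity, and in this way it acts on sections over `S*M`. -/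

/-- A microlocal form in the canonical coordinates over the chart at `x`. -/
def liftCoord {k : ℕ} (Λ : Cotangent n M → KForm n k) (x : M)
    (q : Eu n × (Eu n →L[ℝ] ℝ)) : KForm n k :=
  (Λ (cotCoord x q)).compContinuousLinearMap (frame x q.1)

/-- The field is homogeneous of degree `0` in `ξ ≠ 0`. -/
def HomogeneousZero {k : ℕ} (Λ : Cotangent n M → KForm n k) : Prop :=
  ∀ (x : M) (ξ : Eu n →L[ℝ] ℝ) (r : ℝ), ξ ≠ 0 → 0 < r → Λ (mkCot x (r • ξ)) = Λ (mkCot x ξ)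

/-- The time dependent microlocal form is `C¹` in `(t, x, ξ)` for `t ∈ [t₀, T)`, `ξ ≠ 0`. -/
def IsC1Lift {k : ℕ} (t₀ T : ℝ) (Λ : ℝ → Cotangent n M → KForm n k) : Prop :=
  ∀ x : M, ContDiffOn ℝ 1
    (fun r : ℝ × (Eu n × (Eu n →L[ℝ] ℝ)) => liftCoord (Λ r.1) x r.2)
    (Ico t₀ T ×ˢ ((extChartAt (𝓡 n) x).target ×ˢ {0}ᶜ))

/-- The part of `[t₀, T] × S*M` over the chart at `x`, in canonical coordinates. -/
def sphereDomain (g : Metric n M) (t₀ T : ℝ) (x : M) : Set (ℝ × (Eu n × (Eu n →L[ℝ] ℝ))) :=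
  {r | r.1 ∈ Icc t₀ T ∧ r.2.1 ∈ (extChartAt (𝓡 n) x).target ∧ coNorm g (cotCoord x r.2) = 1}

/-- The time dependent microlocal form is continuous on `[t₀, T] × S*M`. -/
def IsContinuousLift {k : ℕ} (g : Metric n M) (t₀ T : ℝ) (Λ : ℝ → Cotangent n M → KForm n k) :
    Prop :=
  ∀ x : M, ContinuousOn
    (fun r : ℝ × (Eu n × (Eu n →L[ℝ] ℝ)) => liftCoord (Λ r.1) x r.2) (sphereDomain g t₀ T x)

/-- Let `W` be a space of tensors on a tangent space, with `push x y` as in `pushEndo` and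
`pushCurv`. A field `K` of linear maps from `W` to the endomorphisms of the space of `k`-forms is
continuous on `[t₀, T] × S*M` if its components in all charts are. -/
def IsContinuousCoeff {k : ℕ} {W : Type*} [AddCommGroup W] [Module ℝ W]
    (push : M → Eu n → W → W) (g : Metric n M) (t₀ T : ℝ)
    (K : ℝ → Cotangent n M → W →ₗ[ℝ] KForm n k →ₗ[ℝ] KForm n k) : Prop :=
  ∀ (x : M) (w : W) (lam : KForm n k), ContinuousOn
    (fun r : ℝ × (Eu n × (Eu n →L[ℝ] ℝ)) =>
      (K r.1 (cotCoord x r.2) (push x r.2.1 w)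
        (lam.compContinuousLinearMap (coframe x r.2.1))).compContinuousLinearMap (frame x r.2.1))
    (sphereDomain g t₀ T x)

/-- The Lie derivative `𝓛_{X_u} Λ` at `p = (x, ξ)`, evaluated on `v₁, …, vₖ ∈ T_xM`. In canonical
coordinates the lifted field `X_u = uʲ X_jᴴ - (∇_k uⁱ) ξ_i ∂/∂ξ_k` is
`uʲ ∂/∂xʲ - (∂_k uⁱ) ξ_i ∂/∂ξ_k`, since the Christoffel symbols of the horizontal lift and of `∇u`
cancel, and `(𝓛_{X_u} Λ)(v₁, …, vₖ) = (X_u Λ)(v₁, …, vₖ) + ∑ᵢ Λ(v₁, …, Du vᵢ, …, vₖ)`. -/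
def lieDeriv {k : ℕ} (u : M → Eu n) (Λ : Cotangent n M → KForm n k) (p : Cotangent n M)
    (v : Fin k → Eu n) : ℂ :=
  let x := p.proj
  let y := extChartAt (𝓡 n) x x
  let Du : Endo n := fderiv ℝ (vecCoord u x) y
  (fderiv ℝ (liftCoord Λ x) (y, covec p) (vecCoord u x y, -(covec p ∘L Du))) v +
    ∑ i, Λ p (Function.update v i (Du (v i)))

/-- `Λ` is a `C¹` solution on `[t₀, T)` of the lifted evolution equation
`∂_t Λ + 𝓛_{X_u} Λ + ν ‖ξ‖²_{g'} Λ = R̃[Λ] + C̃[Λ] + F` on `S*M`. The zeroth order curvature operator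
is `R̃[Λ] = K(Rᵘ) Λ`, linear in the curvature of the effective connection, and the zeroth order
commutator operator is `C̃[Λ] = N(∇u) Λ`, linear in the velocity gradient. -/
structure IsLiftedSolution {k : ℕ} (g : Metric n M) (α ν t₀ T : ℝ) (u : ℝ → M → Eu n)
    (K : ℝ → Cotangent n M → Curv n →ₗ[ℝ] KForm n k →ₗ[ℝ] KForm n k)
    (N : ℝ → Cotangent n M → Endo n →ₗ[ℝ] KForm n k →ₗ[ℝ] KForm n k)
    (F Λ : ℝ → Cotangent n M → KForm n k) : Prop where
  homogeneous : ∀ t ∈ Ico t₀ T, HomogeneousZero (Λ t)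
  c1 : IsC1Lift t₀ T Λ
  equation : ∀ t ∈ Ico t₀ T, ∀ p : Cotangent n M, coNorm g p = 1 → ∀ v : Fin k → Eu n,
    (derivWithin (fun s => Λ s p) (Ico t₀ T) t) v + lieDeriv (u t) (Λ t) p v +
        ((ν * coSq (effMetric g α t₀ u t p.proj) (covec p) : ℝ) : ℂ) * Λ t p v =
      K t p (effCurvature g α t₀ u t p.proj) (Λ t p) v +
        N t p (grad g (u t) p.proj) (Λ t p) v + F t p v

/-- The energy density `⟨Λ(t), Λ(t)⟩_{g'(t)}` on `S*M`. -/
def energyDensity {k : ℕ} (g : Metric n M) (α t₀ : ℝ) (u : ℝ → M → Eu n)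
    (Λ : ℝ → Cotangent n M → KForm n k) (t : ℝ) (p : Cosphere g) : ℝ :=
  formSq (effMetric g α t₀ u t p.1.proj) (Λ t p.1)

/-- The lifted energy `𝓔(t) = ½ ∫_{S*M} ⟨Λ(t), Λ(t)⟩_{g'(t)} dμ`. -/
def liftedEnergy {k : ℕ} (g : Metric n M) (α t₀ : ℝ) (u : ℝ → M → Eu n)
    (Λ : ℝ → Cotangent n M → KForm n k) (t : ℝ) : ℝ :=
  (1 / 2) * ∫ p, energyDensity g α t₀ u Λ t p ∂(liouville g)

end Manifold

end CosphereLift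

end

open CosphereLift

/-! The energy is controlled through a pointwise bound. A maximum principle bounds the comass of the
solution over the unit cosphere bundle, uniformly on `[t₀, T)`. The energy bound follows because
`g'(t)` dominates a fixed multiple of `g` and the Liouville measure of `S*M` is finite.

Maximum principle. Consider `exp(-2E(s - t₀)) (|Λ_s(v₁, …, vₖ)|² + 1)` over times `s ∈ [t₀, t]`,
unit covectors and vectors of `g`-length at most 1. At a maximum with `s > t₀`, the time derivative
satisfies `⟨Λ(v), ∂_tΛ(v)⟩ ≥ E (|Λ(v)|² + 1)` (`le_inner_of_max`). In the Lie derivative,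
degree-zero homogeneity turns the maximum over `S*M` into one over all `ξ ≠ 0`. Parallel transport
of the `vᵢ` along `u` preserves lengths to first order, so differentiation along the lifted field
contributes nothing there, and only `∑ᵢ Λ(…, ∇_{vᵢ}u, …)` remains (`inner_lieDeriv_eq`). The viscous
term has a favourable sign, and the other terms are of order zero with bounded coefficients. Hence
`⟨Λ(v), ∂_tΛ(v)⟩ ≤ D (|Λ(v)|² + 1)` with `D` independent of time
(`IsLiftedSolution.exists_growth_le`). With `E = D + 1` this is a contradiction, so the maximum sits
at `t₀` (`IsLiftedSolution.exists_isFormBound`).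

Uniformity up to `T` is where `W^{2,∞}` enters. The curvature `Rᵘ` is that of `g` plus terms in
`g'`, `∇g'`, `u` and `∇u` (`curvature_add_tensorVec`). As `∇g = 0`, one has `∇g' = α ∫ ∇S`, which
involves only `∇²u`; thus `Rᵘ` is bounded (`IsBoundedFlow.exists_effCurvature_le`). Boundedness of
`S` also makes `g'` continuous on the compact `[t₀, T] × M`, where positivity becomes a uniform
lower bound (`IsBoundedFlow.exists_metric_le_effMetric`).

Finiteness of the measure rests on the invariance of `dy dη` under changes of canonical coordinates,
which reduces the supremum over all charts to finitely many compact pieces (`cotVolume_le_sum`). -/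

noncomputable section

namespace CosphereLift

open scoped Topology

/-! ### Changes of chart, frames and coframes -/

section Charts

variable {n : ℕ} {M : Type*} [TopologicalSpace M] [ChartedSpace (Eu n) M]
  [IsManifold (𝓡 n) ∞ M]

/-- The change of coordinates from the chart at `x` to the chart at `x'`. -/
def transition (x x' : M) (y : Eu n) : Eu n :=
  extChartAt (𝓡 n) x' ((extChartAt (𝓡 n) x).symm y)

/-- The domain of the change of coordinates from the chart at `x` to the chart at `x'`. -/
def overlap (x x' : M) : Set (Eu n) :=
  (extChartAt (𝓡 n) x).target ∩ (extChartAt (𝓡 n) x).symm ⁻¹' (extChartAt (𝓡 n) x').source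

omit [IsManifold (𝓡 n) ∞ M] in
lemma isOpen_overlap (x x' : M) : IsOpen (overlap (n := n) x x') :=
  (continuousOn_extChartAt_symm (I := 𝓡 n) x).isOpen_inter_preimage
    (isOpen_extChartAt_target x) (isOpen_extChartAt_source x')

omit [IsManifold (𝓡 n) ∞ M] in
lemma transition_mem {x x' : M} {y : Eu n} (hy : y ∈ overlap x x') :
    transition x x' y ∈ (extChartAt (𝓡 n) x').target :=
  (extChartAt (𝓡 n) x').map_source hy.2

omit [IsManifold (𝓡 n) ∞ M] in
lemma symm_transition {x x' : M} {y : Eu n} (hy : y ∈ overlap x x') :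
    (extChartAt (𝓡 n) x').symm (transition x x' y) = (extChartAt (𝓡 n) x).symm y :=
  (extChartAt (𝓡 n) x').left_inv hy.2

lemma contDiffOn_transition (x x' : M) : ContDiffOn ℝ ∞ (transition x x') (overlap (n := n) x x') := by
  have h := contDiffOn_ext_coord_change (I := 𝓡 n) (n := ∞) x' x
  rwa [PartialEquiv.trans_source, PartialEquiv.symm_source] at h

lemma hasFDerivAt_transition {x x' : M} {y : Eu n} (hy : y ∈ overlap x x') :
    HasFDerivAt (transition x x')
      (tangentCoordChange (𝓡 n) x x' ((extChartAt (𝓡 n) x).symm y)) y := by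
  have h := hasFDerivWithinAt_tangentCoordChange (I := 𝓡 n) (x := x) (y := x')
    (z := (extChartAt (𝓡 n) x).symm y) ⟨(extChartAt (𝓡 n) x).map_target hy.1, hy.2⟩
  rw [(extChartAt (𝓡 n) x).right_inv hy.1] at h
  simpa [hasFDerivWithinAt_univ] using! h

lemma coframe_frame {x : M} {y : Eu n} (hy : y ∈ (extChartAt (𝓡 n) x).target) :
    coframe x y ∘L frame x y = ContinuousLinearMap.id ℝ (Eu n) := by
  ext1 v
  have hz := (extChartAt (𝓡 n) x).map_target hy
  simp only [coframe, frame, ContinuousLinearMap.comp_apply, ContinuousLinearMap.id_apply]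
  rw [tangentCoordChange_comp ⟨⟨hz, mem_extChartAt_source _⟩, hz⟩, tangentCoordChange_self hz]

lemma frame_coframe {x : M} {y : Eu n} (hy : y ∈ (extChartAt (𝓡 n) x).target) :
    frame x y ∘L coframe x y = ContinuousLinearMap.id ℝ (Eu n) := by
  ext1 v
  have hz := (extChartAt (𝓡 n) x).map_target hy
  simp only [coframe, frame, ContinuousLinearMap.comp_apply, ContinuousLinearMap.id_apply]
  rw [tangentCoordChange_comp ⟨⟨mem_extChartAt_source _, hz⟩, mem_extChartAt_source _⟩,
    tangentCoordChange_self (mem_extChartAt_source _)]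

lemma coframe_frame_apply {x : M} {y : Eu n} (hy : y ∈ (extChartAt (𝓡 n) x).target) (v : Eu n) :
    coframe x y (frame x y v) = v := DFunLike.congr_fun (coframe_frame hy) v

lemma frame_coframe_apply {x : M} {y : Eu n} (hy : y ∈ (extChartAt (𝓡 n) x).target) (v : Eu n) :
    frame x y (coframe x y v) = v := DFunLike.congr_fun (frame_coframe hy) v

lemma frame_self (x : M) : frame x (extChartAt (𝓡 n) x x) = ContinuousLinearMap.id ℝ (Eu n) := by
  ext1 v
  simp only [frame, extChartAt_to_inv]
  exact tangentCoordChange_self (mem_extChartAt_source _)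

lemma coframe_self (x : M) :
    coframe x (extChartAt (𝓡 n) x x) = ContinuousLinearMap.id ℝ (Eu n) := by
  ext1 v
  simp only [coframe, extChartAt_to_inv]
  exact tangentCoordChange_self (mem_extChartAt_source _)

/-- The derivative of the change of coordinates. -/
def jac (x x' : M) (y : Eu n) : Endo n := fderiv ℝ (transition x x') y

/-- The tangent space at a point is itself written in a third, preferred chart. By the cocycle
identity that chart drops out, so tensors transform by cancelling frames against coframes. -/
lemma jac_eq {x x' : M} {y : Eu n} (hy : y ∈ overlap x x') :
    jac x x' y = coframe x' (transition x x' y) ∘L frame x y := by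
  rw [jac, (hasFDerivAt_transition hy).fderiv]
  ext1 v
  simp only [coframe, frame, ContinuousLinearMap.comp_apply, symm_transition hy]
  rw [tangentCoordChange_comp ⟨⟨(extChartAt (𝓡 n) x).map_target hy.1, mem_extChartAt_source _⟩, hy.2⟩]

lemma frame_jac {x x' : M} {y : Eu n} (hy : y ∈ overlap x x') (v : Eu n) :
    frame x' (transition x x' y) (jac x x' y v) = frame x y v := by
  rw [jac_eq hy]
  exact frame_coframe_apply (transition_mem hy) _

lemma jac_coframe {x x' : M} {y : Eu n} (hy : y ∈ overlap x x') (v : Eu n) :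
    jac x x' y (coframe x y v) = coframe x' (transition x x' y) v := by
  rw [jac_eq hy, ContinuousLinearMap.comp_apply, frame_coframe_apply hy.1]

/-- The inverse of the derivative of the change of coordinates. -/
def jacInv (x x' : M) (y : Eu n) : Endo n := coframe x y ∘L frame x' (transition x x' y)

lemma jacInv_jac {x x' : M} {y : Eu n} (hy : y ∈ overlap x x') (v : Eu n) :
    jacInv x x' y (jac x x' y v) = v := by
  simp [jacInv, frame_jac hy, coframe_frame_apply hy.1]

lemma jac_jacInv {x x' : M} {y : Eu n} (hy : y ∈ overlap x x') (v : Eu n) :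
    jac x x' y (jacInv x x' y v) = v := by
  simp [jacInv, jac_coframe hy, coframe_frame_apply (transition_mem hy)]

lemma vecCoord_transition (u : M → Eu n) {x x' : M} {y : Eu n} (hy : y ∈ overlap x x') :
    vecCoord u x' (transition x x' y) = jac x x' y (vecCoord u x y) := by
  simp only [vecCoord, jac_coframe hy, symm_transition hy]

lemma bilCoord_apply (b : M → Bil n) (x : M) (y v w : Eu n) : bilCoord b x y v w =
    b ((extChartAt (𝓡 n) x).symm y) (frame x y v) (frame x y w) := by
  simp [bilCoord]

lemma bilCoord_transition (b : M → Bil n) {x x' : M} {y : Eu n} (hy : y ∈ overlap x x')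
    (v w : Eu n) : bilCoord b x' (transition x x' y) (jac x x' y v) (jac x x' y w) =
      bilCoord b x y v w := by
  simp only [bilCoord_apply, frame_jac hy, symm_transition hy]

/-- Covectors transform by the transposed inverse of the Jacobian; this is what makes `dy dη`
independent of the chart. -/
lemma cotCoord_transition {x x' : M} {y : Eu n} (hy : y ∈ overlap x x') (η : Eu n →L[ℝ] ℝ) :
    cotCoord x' (transition x x' y, η ∘L jacInv x x' y) = cotCoord x (y, η) := by
  simp only [cotCoord, symm_transition hy]
  congr 1
  ext v
  simp [jacInv, frame_coframe_apply (transition_mem hy)]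

lemma cotCoord_self (p : Cotangent n M) :
    cotCoord p.proj (extChartAt (𝓡 n) p.proj p.proj, covec p) = p := by
  simp only [cotCoord, coframe_self, extChartAt_to_inv]
  rfl

lemma exists_cotCoord (x : M) (p : Cotangent n M) (hp : p.proj ∈ (extChartAt (𝓡 n) x).source) :
    cotCoord x (extChartAt (𝓡 n) x p.proj,
      covec p ∘L frame x (extChartAt (𝓡 n) x p.proj)) = p := by
  simp only [cotCoord, (extChartAt (𝓡 n) x).left_inv hp]
  rw [ContinuousLinearMap.comp_assoc, frame_coframe ((extChartAt (𝓡 n) x).map_source hp)]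
  rfl

end Charts

/-! ### Smoothness of coordinate expressions -/

section Charts

variable {n : ℕ} {M : Type*} [TopologicalSpace M] [ChartedSpace (Eu n) M]
  [IsManifold (𝓡 n) ∞ M]

lemma trivializationAt_tangent_snd (x z : M) (v : Eu n) :
    (trivializationAt (Eu n) (TangentSpace (𝓡 n)) x
      (⟨z, v⟩ : TangentBundle (𝓡 n) M)).2 = tangentCoordChange (𝓡 n) z x z v := rfl

lemma mem_trivializationAt_tangent_source {x z : M} (v : Eu n)
    (hz : z ∈ (extChartAt (𝓡 n) x).source) : (⟨z, v⟩ : TangentBundle (𝓡 n) M) ∈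
      (trivializationAt (Eu n) (TangentSpace (𝓡 n)) x).source := by
  rw [extChartAt_source] at hz
  exact (trivializationAt (Eu n) (TangentSpace (𝓡 n)) x).mem_source.2 hz

/-- The coordinates of a smooth time dependent vector field are smooth. -/
lemma contDiffOn_vecCoord {s : Set ℝ} {u : ℝ → M → Eu n}
    (hu : ContMDiffOn (𝓘(ℝ, ℝ).prod (𝓡 n)) (𝓡 n).tangent ∞
      (fun q : ℝ × M => (⟨q.2, u q.1 q.2⟩ : TangentBundle (𝓡 n) M)) (s ×ˢ univ)) (x : M) :
    ContDiffOn ℝ ∞ (fun r : ℝ × Eu n => vecCoord (u r.1) x r.2)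
      (s ×ˢ (extChartAt (𝓡 n) x).target) := by
  have h1 : ContMDiffOn 𝓘(ℝ, ℝ × Eu n) (𝓘(ℝ, ℝ).prod (𝓡 n)) ∞
      (fun r : ℝ × Eu n => (r.1, (extChartAt (𝓡 n) x).symm r.2))
      (s ×ˢ (extChartAt (𝓡 n) x).target) := by
    refine ContMDiffOn.prodMk ?_ ?_
    · exact contMDiff_iff_contDiff.2 contDiff_fst |>.contMDiffOn
    · exact (contMDiffOn_extChartAt_symm x).comp
        (contMDiff_iff_contDiff.2 contDiff_snd).contMDiffOn (fun r hr => hr.2)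
  have h2 := hu.comp h1 (fun r hr => ⟨hr.1, mem_univ _⟩)
  have h3 := ((trivializationAt (Eu n) (TangentSpace (𝓡 n)) x).contMDiffOn_iff
    (fun r hr => mem_trivializationAt_tangent_source _
      ((extChartAt (𝓡 n) x).map_target hr.2))).1 h2
  exact contMDiffOn_iff_contDiffOn.1 h3.2

/-- A coordinate vector field is smooth. -/
lemma contMDiffOn_frame (x : M) (v : Eu n) :
    ContMDiffOn (𝓡 n) (𝓡 n).tangent ∞ (fun z : M =>
      (⟨z, tangentCoordChange (𝓡 n) x z z v⟩ : TangentBundle (𝓡 n) M))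
      (extChartAt (𝓡 n) x).source := by
  refine ((trivializationAt (Eu n) (TangentSpace (𝓡 n)) x).contMDiffOn_iff
    (fun z hz => mem_trivializationAt_tangent_source _ hz)).2 ⟨contMDiffOn_id, ?_⟩
  refine (contMDiffOn_const (c := v)).congr fun z hz => ?_
  rw [trivializationAt_tangent_snd, tangentCoordChange_comp ⟨⟨hz, mem_extChartAt_source _⟩, hz⟩,
    tangentCoordChange_self hz]

/-- The coordinates of a Riemannian metric are smooth. -/
lemma contDiffOn_bilCoord_metric (g : Metric n M) (x : M) :
    ContDiffOn ℝ ∞ (bilCoord (metricAt g) x) (extChartAt (𝓡 n) x).target := by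
  refine contDiffOn_clm_apply.2 fun v => contDiffOn_clm_apply.2 fun w => ?_
  have h1 : ContMDiffOn (𝓡 n) ((𝓡 n).prod 𝓘(ℝ, ℝ)) ∞ (fun z : M =>
      (⟨z, g.inner z (tangentCoordChange (𝓡 n) x z z v : Eu n)
        (tangentCoordChange (𝓡 n) x z z w : Eu n)⟩ : Bundle.TotalSpace ℝ (Bundle.Trivial M ℝ)))
      (extChartAt (𝓡 n) x).source := by
    intro z hz
    exact ContMDiffWithinAt.clm_bundle_apply₂ (F₁ := Eu n) (F₂ := Eu n)
      (E₁ := TangentSpace (𝓡 n)) (E₂ := TangentSpace (𝓡 n))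
      (g.contMDiff z).contMDiffWithinAt (contMDiffOn_frame x v z hz) (contMDiffOn_frame x w z hz)
  have h2 : ContMDiffOn (𝓡 n) 𝓘(ℝ, ℝ) ∞ (fun z : M =>
      g.inner z (tangentCoordChange (𝓡 n) x z z v : Eu n)
        (tangentCoordChange (𝓡 n) x z z w : Eu n)) (extChartAt (𝓡 n) x).source := by
    intro z hz
    have := h1 z hz
    simp only [Bundle.contMDiffWithinAt_totalSpace] at this
    exact this.2
  have h3 := h2.comp (contMDiffOn_extChartAt_symm x) (extChartAt (𝓡 n) x).mapsTo_symm
  exact (contMDiffOn_iff_contDiffOn.1 h3).congr fun y _ => bilCoord_apply _ _ _ _ _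

end Charts

/-! ### Levi-Civita connection and curvature in coordinates -/

section Christoffel

variable {n : ℕ}

/-- A positive definite bilinear form is nondegenerate. -/
lemma isInvertible_of_pos {b : Bil n} (hb : ∀ v, v ≠ 0 → 0 < b v v) : b.IsInvertible := by
  have hinj : Function.Injective (b : Eu n →ₗ[ℝ] (Eu n →L[ℝ] ℝ)) := by
    rw [injective_iff_map_eq_zero]
    intro v hv
    by_contra h
    have h1 := hb v h
    have h2 : b v = 0 := hv
    simp [h2] at h1
  have hfin : Module.finrank ℝ (Eu n) = Module.finrank ℝ (Eu n →L[ℝ] ℝ) :=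
    (InnerProductSpace.toDual ℝ (Eu n)).toLinearEquiv.finrank_eq
  refine ⟨(LinearEquiv.ofInjectiveOfFinrankEq _ hinj hfin).toContinuousLinearEquiv, ?_⟩
  ext v w
  rfl

lemma apply_inverse_of_isInvertible {b : Bil n} (hb : b.IsInvertible) (ξ : Eu n →L[ℝ] ℝ) :
    b (b.inverse ξ) = ξ := by
  obtain ⟨e, rfl⟩ := hb
  simp [ContinuousLinearMap.inverse_equiv]

/-- Koszul's formula. Invertibility of `G y` is essential: `ContinuousLinearMap.inverse` is zero on
a map that is not invertible. -/
lemma christoffel_koszul (G : Eu n → Bil n) {y : Eu n} (hG : (G y).IsInvertible) (v w z : Eu n) :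
    G y (christoffel G y v w) z =
      (1 / 2 : ℝ) * (fderiv ℝ G y v w z + fderiv ℝ G y w v z - fderiv ℝ G y z v w) := by
  simp only [christoffel, ContinuousLinearMap.comp_apply, ContinuousLinearMap.compL_apply,
    apply_inverse_of_isInvertible hG]
  simp [ContinuousLinearMap.flip_apply]

lemma fderiv_symm_of_eventually {G : Eu n → Bil n} {y : Eu n} (hd : DifferentiableAt ℝ G y)
    (hs : ∀ᶠ y' in 𝓝 y, ∀ v w, G y' v w = G y' w v) (v w z : Eu n) :
    fderiv ℝ G y v w z = fderiv ℝ G y v z w := by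
  have h1 : HasFDerivAt (fun y' => G y' w z) (((fderiv ℝ G y).flip w).flip z) y := by
    simpa using ((hd.hasFDerivAt.clm_apply (hasFDerivAt_const w y)).clm_apply
      (hasFDerivAt_const z y))
  have h2 : HasFDerivAt (fun y' => G y' z w) (((fderiv ℝ G y).flip z).flip w) y := by
    simpa using ((hd.hasFDerivAt.clm_apply (hasFDerivAt_const z y)).clm_apply
      (hasFDerivAt_const w y))
  have h3 := (h2.congr_of_eventuallyEq (hs.mono fun y' h => h w z)).unique h1
  exact (DFunLike.congr_fun h3 v).symm

lemma eq_of_forall_apply_eq {b : Bil n} (hb : ∀ v, v ≠ 0 → 0 < b v v) {v w : Eu n}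
    (h : ∀ z, b v z = b w z) : v = w := by
  by_contra hne
  have h1 := hb (v - w) (sub_ne_zero.2 hne)
  have h2 : b (v - w) (v - w) = b v (v - w) - b w (v - w) := by
    rw [map_sub b]; rfl
  rw [h2, h, sub_self] at h1
  exact lt_irrefl _ h1

/-- A metric on a coordinate domain, near the point `y`. -/
structure IsMetricNear (G : Eu n → Bil n) (y : Eu n) : Prop where
  diff : DifferentiableAt ℝ G y
  symm : ∀ᶠ y' in 𝓝 y, ∀ v w, G y' v w = G y' w v
  pos : ∀ v, v ≠ 0 → 0 < G y v v

namespace IsMetricNear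

variable {G : Eu n → Bil n} {y : Eu n}

lemma symm_self (h : IsMetricNear G y) (v w : Eu n) : G y v w = G y w v :=
  h.symm.self_of_nhds v w

lemma christoffel_symm (h : IsMetricNear G y) (v w : Eu n) :
    christoffel G y v w = christoffel G y w v := by
  refine eq_of_forall_apply_eq h.pos fun z => ?_
  rw [christoffel_koszul G (isInvertible_of_pos h.pos),
    christoffel_koszul G (isInvertible_of_pos h.pos), fderiv_symm_of_eventually h.diff h.symm z v w]
  ring

/-- The Levi-Civita connection is compatible with the metric. -/
lemma fderiv_apply (h : IsMetricNear G y) (v w z : Eu n) :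
    fderiv ℝ G y v w z = G y (christoffel G y v w) z + G y w (christoffel G y v z) := by
  rw [h.symm_self w, christoffel_koszul G (isInvertible_of_pos h.pos),
    christoffel_koszul G (isInvertible_of_pos h.pos), fderiv_symm_of_eventually h.diff h.symm v z w]
  ring

end IsMetricNear

/-- The transformation law of the Christoffel symbols of the Levi-Civita connection. -/
lemma christoffel_transform {G G' : Eu n → Bil n} {φ : Eu n → Eu n} {y : Eu n}
    (hG : IsMetricNear G y) (hG' : IsMetricNear G' (φ y)) (hφ : ContDiffAt ℝ 2 φ y)
    (hsurj : Function.Surjective (fderiv ℝ φ y))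
    (h : ∀ᶠ y' in 𝓝 y, ∀ v w, G' (φ y') (fderiv ℝ φ y' v) (fderiv ℝ φ y' w) = G y' v w)
    (v w : Eu n) :
    fderiv ℝ φ y (christoffel G y v w) =
      christoffel G' (φ y) (fderiv ℝ φ y v) (fderiv ℝ φ y w) + fderiv ℝ (fderiv ℝ φ) y v w := by
  set P := fderiv ℝ φ y with hP
  set P2 := fderiv ℝ (fderiv ℝ φ) y with hP2
  have hsym : ∀ v w, P2 v w = P2 w v := fun v w => hφ.isSymmSndFDerivAt (by simp) v w
  have hd1 : HasFDerivAt φ P y := (hφ.differentiableAt (by simp)).hasFDerivAt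
  have hd2 : HasFDerivAt (fderiv ℝ φ) P2 y :=
    ((hφ.fderiv_right (m := 1) (by norm_num)).differentiableAt (by simp)).hasFDerivAt
  -- The isometry relation `h`, differentiated once. In the Koszul combination of three such
  -- identities all terms with `P2` cancel except two copies of `P2 v w`.
  have key : ∀ v w z, fderiv ℝ G y v w z = fderiv ℝ G' (φ y) (P v) (P w) (P z) +
      G' (φ y) (P2 v w) (P z) + G' (φ y) (P w) (P2 v z) := by
    intro v w z
    have h1 : HasFDerivAt (fun y' => G y' w z) (((fderiv ℝ G y).flip w).flip z) y := by
      simpa using ((hG.diff.hasFDerivAt.clm_apply (hasFDerivAt_const w y)).clm_apply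
        (hasFDerivAt_const z y))
    have hw : HasFDerivAt (fun y' => fderiv ℝ φ y' w) (P2.flip w) y := by
      simpa using hd2.clm_apply (hasFDerivAt_const w y)
    have hz : HasFDerivAt (fun y' => fderiv ℝ φ y' z) (P2.flip z) y := by
      simpa using hd2.clm_apply (hasFDerivAt_const z y)
    have h2 := ((hG'.diff.hasFDerivAt.comp y hd1).clm_apply hw).clm_apply hz
    have h3 := DFunLike.congr_fun
      (h1.unique (h2.congr_of_eventuallyEq (h.mono fun y' h => (h w z).symm))) v
    simp only [ContinuousLinearMap.flip_apply] at h3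
    rw [h3]
    simp [← hP]
    ring
  refine eq_of_forall_apply_eq hG'.pos fun z' => ?_
  obtain ⟨z, rfl⟩ := hsurj z'
  have e1 : G' (φ y) (P (christoffel G y v w)) (P z) = G y (christoffel G y v w) z :=
    h.self_of_nhds _ _
  rw [e1, map_add, _root_.add_apply, christoffel_koszul G (isInvertible_of_pos hG.pos),
    christoffel_koszul G' (isInvertible_of_pos hG'.pos), key, key, key, hsym w v, hsym z v, hsym z w,
    hG'.symm_self (P v), hG'.symm_self (P2 v z)]
  ring

/-- The curvature in terms of components. -/
lemma curvature_apply (Γ : Eu n → (Eu n →L[ℝ] Endo n)) (y v w z : Eu n) :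
    curvature Γ y v w z = fderiv ℝ Γ y v w z - fderiv ℝ Γ y w v z +
      Γ y v (Γ y w z) - Γ y w (Γ y v z) := by
  simp [curvature]

/-- The curvature of a connection is a tensor. -/
lemma curvature_transform {Γ Γ' : Eu n → (Eu n →L[ℝ] Endo n)} {φ : Eu n → Eu n} {y : Eu n}
    (hΓ : DifferentiableAt ℝ Γ y) (hΓ' : DifferentiableAt ℝ Γ' (φ y)) (hφ : ContDiffAt ℝ 3 φ y)
    (h : ∀ᶠ y' in 𝓝 y, ∀ v w, fderiv ℝ φ y' (Γ y' v w) =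
      Γ' (φ y') (fderiv ℝ φ y' v) (fderiv ℝ φ y' w) + fderiv ℝ (fderiv ℝ φ) y' v w)
    (v w z : Eu n) :
    fderiv ℝ φ y (curvature Γ y v w z) =
      curvature Γ' (φ y) (fderiv ℝ φ y v) (fderiv ℝ φ y w) (fderiv ℝ φ y z) := by
  have h0 := h.self_of_nhds
  have hφ1 : ContDiffAt ℝ 2 (fderiv ℝ φ) y := hφ.fderiv_right (by norm_num)
  have hd1 : HasFDerivAt φ (fderiv ℝ φ y) y := (hφ.differentiableAt (by simp)).hasFDerivAt
  have hd2 : HasFDerivAt (fderiv ℝ φ) (fderiv ℝ (fderiv ℝ φ) y) y :=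
    (hφ1.differentiableAt (by simp)).hasFDerivAt
  have hd3 : HasFDerivAt (fderiv ℝ (fderiv ℝ φ)) (fderiv ℝ (fderiv ℝ (fderiv ℝ φ)) y) y :=
    ((hφ1.fderiv_right (m := 1) (by norm_num)).differentiableAt (by simp)).hasFDerivAt
  have hsym2 : ∀ v w, fderiv ℝ (fderiv ℝ φ) y v w = fderiv ℝ (fderiv ℝ φ) y w v :=
    fun v w => hφ.isSymmSndFDerivAt (by simp; norm_num) v w
  have hsym3 : ∀ v w, fderiv ℝ (fderiv ℝ (fderiv ℝ φ)) y v w =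
      fderiv ℝ (fderiv ℝ (fderiv ℝ φ)) y w v :=
    fun v w => hφ1.isSymmSndFDerivAt (by simp) v w
  set P := fderiv ℝ φ y with hP
  set P2 := fderiv ℝ (fderiv ℝ φ) y with hP2
  set P3 := fderiv ℝ (fderiv ℝ (fderiv ℝ φ)) y with hP3
  -- The transformation law of `Γ`, differentiated once. Antisymmetrisation in `v, w` removes the
  -- third derivative `P3` by symmetry, and the surviving `P2` terms cancel against the quadratic
  -- part of the curvature.
  have key : ∀ v w z, P2 v (Γ y w z) + P (fderiv ℝ Γ y v w z) =
      fderiv ℝ Γ' (φ y) (P v) (P w) (P z) + Γ' (φ y) (P2 v w) (P z) + Γ' (φ y) (P w) (P2 v z) +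
        P3 v w z := by
    intro v w z
    have hw : HasFDerivAt (fun y' => fderiv ℝ φ y' w) (P2.flip w) y := by
      simpa using hd2.clm_apply (hasFDerivAt_const w y)
    have hz : HasFDerivAt (fun y' => fderiv ℝ φ y' z) (P2.flip z) y := by
      simpa using hd2.clm_apply (hasFDerivAt_const z y)
    have h1 := hd2.clm_apply ((hΓ.hasFDerivAt.clm_apply (hasFDerivAt_const w y)).clm_apply
      (hasFDerivAt_const z y))
    have h2 := (((hΓ'.hasFDerivAt.comp y hd1).clm_apply hw).clm_apply hz).add
      ((hd3.clm_apply (hasFDerivAt_const w y)).clm_apply (hasFDerivAt_const z y))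
    have h3 := DFunLike.congr_fun
      (h1.unique (h2.congr_of_eventuallyEq (h.mono fun y' h => h w z))) v
    simp [← hP] at h3
    rw [add_comm, h3]
    abel
  have k1 := key v w z
  have k2 := key w v z
  rw [hsym2 w v, hsym3 w v] at k2
  have k3 : P (fderiv ℝ Γ y v w z) - P (fderiv ℝ Γ y w v z) =
      fderiv ℝ Γ' (φ y) (P v) (P w) (P z) + Γ' (φ y) (P w) (P2 v z)
      - (fderiv ℝ Γ' (φ y) (P w) (P v) (P z) + Γ' (φ y) (P v) (P2 w z))
      - (P2 v (Γ y w z) - P2 w (Γ y v z)) := by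
    rw [eq_sub_of_add_eq' k1, eq_sub_of_add_eq' k2]
    abel
  simp only [curvature_apply, map_add, map_sub, h0, k3]
  abel

end Christoffel

/-! ### Tensoriality of the covariant derivative and of the curvature -/

section Charts

variable {n : ℕ} {M : Type*} [TopologicalSpace M] [ChartedSpace (Eu n) M]
  [IsManifold (𝓡 n) ∞ M]

lemma metricAt_symm (g : Metric n M) (x : M) (v w : Eu n) : metricAt g x v w = metricAt g x w v :=
  g.symm x v w

lemma metricAt_pos (g : Metric n M) (x : M) {v : Eu n} (hv : v ≠ 0) : 0 < metricAt g x v v :=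
  g.pos x v hv

lemma frame_ne_zero {x : M} {y v : Eu n} (hy : y ∈ (extChartAt (𝓡 n) x).target) (hv : v ≠ 0) :
    frame x y v ≠ 0 := fun h => hv <| by rw [← coframe_frame_apply hy v, h, map_zero]

omit [IsManifold (𝓡 n) ∞ M] in
lemma target_mem_nhds {x : M} {y : Eu n} (hy : y ∈ (extChartAt (𝓡 n) x).target) :
    (extChartAt (𝓡 n) x).target ∈ 𝓝 y := (isOpen_extChartAt_target x).mem_nhds hy

lemma isMetricNear (g : Metric n M) {x : M} {y : Eu n} (hy : y ∈ (extChartAt (𝓡 n) x).target) :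
    IsMetricNear (bilCoord (metricAt g) x) y where
  diff := ((contDiffOn_bilCoord_metric g x).contDiffAt (target_mem_nhds hy)).differentiableAt
    (by simp)
  symm := Filter.Eventually.of_forall fun y' v w => by
    rw [bilCoord_apply, bilCoord_apply, metricAt_symm]
  pos v hv := by
    rw [bilCoord_apply]
    exact metricAt_pos g _ (frame_ne_zero hy hv)

/-- Inversion of linear maps is smooth at invertible ones, and positivity keeps the metric there. -/
lemma contDiffOn_leviCivita (g : Metric n M) (x : M) :
    ContDiffOn ℝ ∞ (leviCivita g x) (extChartAt (𝓡 n) x).target := by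
  have hG := contDiffOn_bilCoord_metric g x
  have hD : ContDiffOn ℝ ∞ (fderiv ℝ (bilCoord (metricAt g) x)) (extChartAt (𝓡 n) x).target :=
    hG.fderiv_of_isOpen (isOpen_extChartAt_target x) (by simp)
  have hinv : ContDiffOn ℝ ∞ (fun y => (bilCoord (metricAt g) x y).inverse)
      (extChartAt (𝓡 n) x).target := by
    intro y hy
    obtain ⟨e, he⟩ := isInvertible_of_pos (isMetricNear g hy).pos
    have h1 := contDiffAt_map_inverse (n := ∞) e
    rw [he] at h1
    exact h1.comp_contDiffWithinAt y (hG y hy)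
  unfold leviCivita christoffel
  refine ContDiffOn.clm_comp ?_ ?_
  · exact (ContinuousLinearMap.contDiff _).comp_contDiffOn hinv
  · refine ContDiffOn.const_smul _ ((hD.add ?_).sub ?_)
    · exact ((ContinuousLinearMap.flipₗᵢ ℝ (Eu n) (Eu n) (Eu n →L[ℝ] ℝ)).contDiff).comp_contDiffOn hD
    · refine contDiffOn_const.clm_comp ?_
      exact ((ContinuousLinearMap.flipₗᵢ ℝ (Eu n) (Eu n) (Eu n →L[ℝ] ℝ)).contDiff).comp_contDiffOn hD

lemma contDiffAt_transition {x x' : M} {y : Eu n} (hy : y ∈ overlap x x') :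
    ContDiffAt ℝ ∞ (transition x x') y :=
  (contDiffOn_transition x x').contDiffAt ((isOpen_overlap x x').mem_nhds hy)

lemma leviCivita_transition (g : Metric n M) {x x' : M} {y : Eu n} (hy : y ∈ overlap x x')
    (v w : Eu n) :
    jac x x' y (leviCivita g x y v w) =
      leviCivita g x' (transition x x' y) (jac x x' y v) (jac x x' y w) +
        fderiv ℝ (jac x x') y v w :=
  christoffel_transform (isMetricNear g hy.1) (isMetricNear g (transition_mem hy))
    ((contDiffAt_transition hy).of_le (by norm_cast))
    (fun v => ⟨jacInv x x' y v, jac_jacInv hy v⟩)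
    (Filter.eventually_of_mem ((isOpen_overlap x x').mem_nhds hy) fun _ h v w =>
      bilCoord_transition (metricAt g) h v w) v w

/-- The curvature of the Levi-Civita connection is a tensor. -/
lemma curvature_leviCivita_transition (g : Metric n M) {x x' : M} {y : Eu n}
    (hy : y ∈ overlap x x') (v w z : Eu n) :
    jac x x' y (curvature (leviCivita g x) y v w z) =
      curvature (leviCivita g x') (transition x x' y) (jac x x' y v) (jac x x' y w)
        (jac x x' y z) :=
  curvature_transform
    (((contDiffOn_leviCivita g x).contDiffAt (target_mem_nhds hy.1)).differentiableAt (by simp))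
    (((contDiffOn_leviCivita g x').contDiffAt
      (target_mem_nhds (transition_mem hy))).differentiableAt (by simp))
    ((contDiffAt_transition hy).of_le (by norm_cast))
    (Filter.eventually_of_mem ((isOpen_overlap x x').mem_nhds hy) fun _ h v w =>
      leviCivita_transition g h v w) v w z

/-- The covariant derivative of a vector field is a tensor. -/
lemma gradCoord_transition (g : Metric n M) {u : M → Eu n} {x x' : M} {y : Eu n}
    (hy : y ∈ overlap x x') (hu : DifferentiableAt ℝ (vecCoord u x) y)
    (hu' : DifferentiableAt ℝ (vecCoord u x') (transition x x' y)) (v : Eu n) :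
    jac x x' y (gradCoord g u x y v) = gradCoord g u x' (transition x x' y) (jac x x' y v) := by
  have hφ := contDiffAt_transition hy
  have hj : HasFDerivAt (jac x x') (fderiv ℝ (jac x x') y) y :=
    ((hφ.fderiv_right (m := 1) (by norm_cast)).differentiableAt (by simp)).hasFDerivAt
  have h1 := hu'.hasFDerivAt.comp y (hφ.differentiableAt (by simp)).hasFDerivAt
  have h2 := hj.clm_apply hu.hasFDerivAt
  have h3 := DFunLike.congr_fun (h1.unique (h2.congr_of_eventuallyEq
    (Filter.eventually_of_mem ((isOpen_overlap x x').mem_nhds hy) fun y' h =>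
      vecCoord_transition u h))) v
  -- The second derivative of the transition appears both in `D(vecCoord u x')` and in the law for
  -- `Γ`, with its arguments exchanged; its symmetry makes the two cancel.
  have hsymm : fderiv ℝ (jac x x') y v (vecCoord u x y) =
      fderiv ℝ (jac x x') y (vecCoord u x y) v :=
    (hφ.of_le (m := 2) (by norm_cast)).isSymmSndFDerivAt (by simp) _ _
  have e1 : fderiv ℝ (vecCoord u x') (transition x x' y) (jac x x' y v) =
      jac x x' y (fderiv ℝ (vecCoord u x) y v) + fderiv ℝ (jac x x') y v (vecCoord u x y) := by
    simpa [jac] using! h3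
  have e2 := leviCivita_transition g hy v (vecCoord u x y)
  simp only [gradCoord, _root_.add_apply, ContinuousLinearMap.flip_apply, map_add, e1, e2,
    vecCoord_transition u hy]
  abel

omit [IsManifold (𝓡 n) ∞ M] in
lemma mem_overlap_symm {x : M} {y : Eu n} (hy : y ∈ (extChartAt (𝓡 n) x).target) :
    y ∈ overlap x ((extChartAt (𝓡 n) x).symm y) := ⟨hy, mem_extChartAt_source _⟩

omit [IsManifold (𝓡 n) ∞ M] in
lemma transition_symm_self (x : M) (y : Eu n) : transition x ((extChartAt (𝓡 n) x).symm y) y =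
    extChartAt (𝓡 n) ((extChartAt (𝓡 n) x).symm y) ((extChartAt (𝓡 n) x).symm y) := rfl

/-- The bridge from charts to pointwise definitions: `grad` and the curvature at a point use its
preferred chart, and the passage to that chart from the chart at `x` has the frame as its Jacobian.
-/
lemma jac_symm_self {x : M} {y : Eu n} (hy : y ∈ (extChartAt (𝓡 n) x).target) :
    jac x ((extChartAt (𝓡 n) x).symm y) y = frame x y := by
  rw [jac_eq (mem_overlap_symm hy), transition_symm_self, coframe_self]
  rfl

/-- A vector field that is differentiable in all charts. -/
def IsDiffField (u : M → Eu n) : Prop :=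
  ∀ (x : M), ∀ y ∈ (extChartAt (𝓡 n) x).target, DifferentiableAt ℝ (vecCoord u x) y

lemma frame_gradCoord (g : Metric n M) {u : M → Eu n} (hu : IsDiffField u) {x : M} {y : Eu n}
    (hy : y ∈ (extChartAt (𝓡 n) x).target) (v : Eu n) :
    frame x y (gradCoord g u x y v) = grad g u ((extChartAt (𝓡 n) x).symm y) (frame x y v) := by
  have h := gradCoord_transition g (mem_overlap_symm hy) (hu x y hy)
    (hu _ _ (transition_mem (mem_overlap_symm hy))) v
  rwa [jac_symm_self hy] at h

lemma bilCoord_deformation (g : Metric n M) {u : M → Eu n} (hu : IsDiffField u) {x : M} {y : Eu n}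
    (hy : y ∈ (extChartAt (𝓡 n) x).target) (v w : Eu n) :
    bilCoord (deformation g u) x y v w = (1 / 2 : ℝ) *
      (bilCoord (metricAt g) x y (gradCoord g u x y v) w +
        bilCoord (metricAt g) x y (gradCoord g u x y w) v) := by
  simp only [bilCoord_apply, frame_gradCoord g hu hy, deformation]
  simp
  ring

lemma frame_curvature_leviCivita (g : Metric n M) {x : M} {y : Eu n}
    (hy : y ∈ (extChartAt (𝓡 n) x).target) (v w z : Eu n) :
    frame x y (curvature (leviCivita g x) y v w z) =
      curvature (leviCivita g ((extChartAt (𝓡 n) x).symm y))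
        (extChartAt (𝓡 n) ((extChartAt (𝓡 n) x).symm y) ((extChartAt (𝓡 n) x).symm y))
        (frame x y v) (frame x y w) (frame x y z) := by
  have h := curvature_leviCivita_transition g (mem_overlap_symm hy) v w z
  rwa [jac_symm_self hy] at h

end Charts

/-! ### Inner products on a tangent space -/

section InnerForms

variable {n : ℕ}

/-- A Euclidean inner product on a tangent space. -/
structure IsInner (b : Bil n) : Prop where
  symm : ∀ v w, b v w = b w v
  pos : ∀ v, v ≠ 0 → 0 < b v v

lemma vecNorm_nonneg (b : Bil n) (v : Eu n) : 0 ≤ vecNorm b v := Real.sqrt_nonneg _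

lemma vecNorm_smul (b : Bil n) (c : ℝ) (v : Eu n) : vecNorm b (c • v) = |c| * vecNorm b v := by
  have : b (c • v) (c • v) = c ^ 2 * b v v := by simp; ring
  rw [vecNorm, vecNorm, this, Real.sqrt_mul (sq_nonneg c), Real.sqrt_sq_eq_abs]

namespace IsInner

variable {b : Bil n}

lemma nonneg (hb : IsInner b) (v : Eu n) : 0 ≤ b v v := by
  by_cases h : v = 0
  · simp [h]
  · exact (hb.pos v h).le

lemma vecNorm_sq (hb : IsInner b) (v : Eu n) : vecNorm b v ^ 2 = b v v :=
  Real.sq_sqrt (hb.nonneg v)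

lemma vecNorm_pos (hb : IsInner b) {v : Eu n} (hv : v ≠ 0) : 0 < vecNorm b v :=
  Real.sqrt_pos.2 (hb.pos v hv)

/-- The Cauchy-Schwarz inequality. -/
lemma abs_apply_le (hb : IsInner b) (v w : Eu n) : |b v w| ≤ vecNorm b v * vecNorm b w := by
  refine abs_le_of_sq_le_sq ?_ (mul_nonneg (vecNorm_nonneg _ _) (vecNorm_nonneg _ _))
  rw [mul_pow, hb.vecNorm_sq, hb.vecNorm_sq]
  -- This nonnegative quantity equals `b v v * (b v v * b w w - (b v w)²)`.
  have h := hb.nonneg ((b v v) • w - (b v w) • v)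
  by_cases hv : v = 0
  · simp [hv]
  have hp := hb.pos v hv
  simp only [map_sub, map_smul, _root_.sub_apply, _root_.smul_apply, smul_eq_mul, hb.symm w v] at h
  nlinarith [h, hp]

lemma vecNorm_add_le (hb : IsInner b) (v w : Eu n) :
    vecNorm b (v + w) ≤ vecNorm b v + vecNorm b w := by
  refine abs_le_of_sq_le_sq' ?_ (add_nonneg (vecNorm_nonneg _ _) (vecNorm_nonneg _ _)) |>.2
  have h := (abs_le.1 (hb.abs_apply_le v w)).2
  rw [hb.vecNorm_sq, add_sq, hb.vecNorm_sq, hb.vecNorm_sq]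
  simp only [map_add, _root_.add_apply, hb.symm w v]
  linarith

lemma vecNorm_sub_le (hb : IsInner b) (v w : Eu n) :
    vecNorm b (v - w) ≤ vecNorm b v + vecNorm b w := by
  have h := hb.vecNorm_add_le v ((-1 : ℝ) • w)
  rw [vecNorm_smul] at h
  simpa [sub_eq_add_neg] using h

end IsInner

/-- If a map homogeneous of degree one is bounded by `C` on the unit ball, then it is bounded by
`C` times the norm. -/
lemma le_mul_vecNorm_of_unit_ball {b : Bil n} (hb : IsInner b) {f : Eu n → ℝ} {C : ℝ}
    (hf : ∀ (c : ℝ) v, 0 ≤ c → f (c • v) = c * f v) (h : ∀ v, vecNorm b v ≤ 1 → f v ≤ C)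
    (v : Eu n) : f v ≤ C * vecNorm b v := by
  by_cases hv : v = 0
  · subst hv
    have := hf 0 0 le_rfl
    simp at this
    simp [this, vecNorm]
  have hp := hb.vecNorm_pos hv
  have h1 := h ((vecNorm b v)⁻¹ • v) (by
    rw [vecNorm_smul, abs_of_pos (inv_pos.2 hp), inv_mul_cancel₀ hp.ne'])
  rwa [hf _ _ (inv_pos.2 hp).le, inv_mul_le_iff₀ hp, mul_comm] at h1

/-- A continuous family of inner products on a compact set is bounded below. -/
lemma exists_le_of_isCompact {X : Type*} [TopologicalSpace X] {K : Set X} (hK : IsCompact K)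
    {b : X → Bil n} (hb : ContinuousOn b K) (hpos : ∀ y ∈ K, ∀ v, v ≠ 0 → 0 < b y v v) :
    ∃ c > 0, ∀ y ∈ K, ∀ v, c * ‖v‖ ^ 2 ≤ b y v v := by
  have hcomp : IsCompact (K ×ˢ Metric.sphere (0 : Eu n) 1) := hK.prod (isCompact_sphere _ _)
  have hcont : ContinuousOn (fun p : X × Eu n => b p.1 p.2 p.2)
      (K ×ˢ Metric.sphere (0 : Eu n) 1) := by
    have h1 : ContinuousOn (fun p : X × Eu n => b p.1) (K ×ˢ Metric.sphere (0 : Eu n) 1) :=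
      hb.comp continuousOn_fst fun p hp => hp.1
    exact (h1.clm_apply continuousOn_snd).clm_apply continuousOn_snd
  obtain ⟨c, hc, h⟩ : ∃ c > 0, ∀ p ∈ K ×ˢ Metric.sphere (0 : Eu n) 1, c ≤ b p.1 p.2 p.2 := by
    -- The unit sphere is empty when `n = 0`, and `K` may be empty; any positive constant then
    -- serves.
    rcases (K ×ˢ Metric.sphere (0 : Eu n) 1).eq_empty_or_nonempty with he | hne
    · exact ⟨1, one_pos, by simp [he]⟩
    obtain ⟨p, hp, hmin⟩ := hcomp.exists_isMinOn hne hcont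
    refine ⟨b p.1 p.2 p.2, hpos _ hp.1 _ ?_, fun q hq => hmin hq⟩
    rintro h0
    have := hp.2
    simp [h0] at this
  refine ⟨c, hc, fun y hy v => ?_⟩
  by_cases hv : v = 0
  · simp [hv]
  have hn : 0 < ‖v‖ := norm_pos_iff.2 hv
  have h1 := h (y, ‖v‖⁻¹ • v) ⟨hy, by simp [norm_smul, hn.ne']⟩
  simp only [map_smul, _root_.smul_apply, smul_eq_mul] at h1
  calc c * ‖v‖ ^ 2 ≤ (‖v‖⁻¹ * (‖v‖⁻¹ * b y v v)) * ‖v‖ ^ 2 := by gcongr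
    _ = b y v v := by field_simp

end InnerForms

/-! ### Differentiation of time integrals with respect to the space variable -/

section Parametric

variable {E F : Type*} [NormedAddCommGroup E] [NormedSpace ℝ E] [NormedAddCommGroup F]
  [NormedSpace ℝ F] {a b : ℝ} {U : Set E} {f : ℝ × E → F}

/-- The time interval is closed at `a`, so the joint derivative is one within the domain. Restricted
to space directions it is the genuine derivative of the slice, because `U` is open. -/
lemma contDiffOn_partial_fderiv (hU : IsOpen U) (hf : ContDiffOn ℝ ∞ f (Ico a b ×ˢ U)) :
    ContDiffOn ℝ ∞ (fun r : ℝ × E => fderiv ℝ (fun y => f (r.1, y)) r.2) (Ico a b ×ˢ U) := by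
  have huniq : UniqueDiffOn ℝ (Ico a b ×ˢ U) := (uniqueDiffOn_Ico a b).prod hU.uniqueDiffOn
  have h1 := hf.fderivWithin huniq (m := ∞) (by simp)
  refine (h1.clm_comp (contDiffOn_const (c := ContinuousLinearMap.inr ℝ ℝ E))).congr ?_
  rintro ⟨s, y⟩ ⟨hs, hy⟩
  have h2 : HasFDerivWithinAt f (fderivWithin ℝ f (Ico a b ×ˢ U) (s, y)) (Ico a b ×ˢ U) (s, y) :=
    ((hf (s, y) ⟨hs, hy⟩).differentiableWithinAt (by simp)).hasFDerivWithinAt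
  have h3 : HasFDerivWithinAt (fun y' => (s, y')) (ContinuousLinearMap.inr ℝ ℝ E) U y :=
    (hasFDerivAt_prodMk_right s y).hasFDerivWithinAt
  exact ((h2.comp y h3 fun y' hy' => ⟨hs, hy'⟩).hasFDerivAt (hU.mem_nhds hy)).fderiv

lemma differentiableAt_of_contDiffOn_prod (hU : IsOpen U) (hf : ContDiffOn ℝ ∞ f (Ico a b ×ˢ U))
    {s : ℝ} (hs : s ∈ Ico a b) {y : E} (hy : y ∈ U) :
    DifferentiableAt ℝ (fun y => f (s, y)) y := by
  have h1 : ContDiffOn ℝ ∞ (fun y => f (s, y)) U :=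
    hf.comp (contDiff_prodMk_right s).contDiffOn fun y' hy' => ⟨hs, hy'⟩
  exact (h1.contDiffAt (hU.mem_nhds hy)).differentiableAt (by simp)

omit [NormedSpace ℝ E] [NormedSpace ℝ F] in
lemma intervalIntegrable_of_continuousOn_prod (hf : ContinuousOn f (Ico a b ×ˢ U)) {t : ℝ}
    (ht : t ∈ Ico a b) {y : E} (hy : y ∈ U) :
    IntervalIntegrable (fun s => f (s, y)) volume a t := by
  refine ContinuousOn.intervalIntegrable ?_
  rw [uIcc_of_le ht.1]
  exact hf.comp (by fun_prop) fun s hs => ⟨⟨hs.1, hs.2.trans_lt ht.2⟩, hy⟩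

/-- For `t < b` the set `[a, t]` times a compact neighbourhood of `y` lies in the domain of
smoothness. The space derivative is bounded there, which provides the dominating constant. -/
lemma hasFDerivAt_intervalIntegral [CompleteSpace F] [LocallyCompactSpace E] (hU : IsOpen U)
    (hf : ContDiffOn ℝ ∞ f (Ico a b ×ˢ U)) {t : ℝ} (ht : t ∈ Ico a b) {y : E} (hy : y ∈ U) :
    HasFDerivAt (fun y => ∫ s in a..t, f (s, y))
      (∫ s in a..t, fderiv ℝ (fun y => f (s, y)) y) y ∧
      IntervalIntegrable (fun s => fderiv ℝ (fun y => f (s, y)) y) volume a t := by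
  have hsub : Icc a t ⊆ Ico a b := fun s hs => ⟨hs.1, hs.2.trans_lt ht.2⟩
  have huIoc : uIoc a t ⊆ Icc a t := by
    rw [uIoc_of_le ht.1]
    exact Ioc_subset_Icc_self
  have hD := (contDiffOn_partial_fderiv hU hf).continuousOn
  obtain ⟨K, hK, hKU, hKc⟩ := local_compact_nhds (hU.mem_nhds hy)
  obtain ⟨C, hC⟩ := (isCompact_Icc.prod hKc).exists_bound_of_continuousOn
    (hD.mono (prod_mono hsub hKU))
  refine ⟨?_, intervalIntegrable_of_continuousOn_prod hD ht hy⟩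
  refine intervalIntegral.hasFDerivAt_integral_of_dominated_of_fderiv_le
    (F' := fun y s => fderiv ℝ (fun y => f (s, y)) y) (bound := fun _ => C) hK ?_
    (intervalIntegrable_of_continuousOn_prod hf.continuousOn ht hy) ?_ ?_ intervalIntegrable_const ?_
  · filter_upwards [hU.mem_nhds hy] with y' hy'
    exact (intervalIntegrable_iff.1 (intervalIntegrable_of_continuousOn_prod hf.continuousOn ht hy')).aestronglyMeasurable
  · exact (intervalIntegrable_iff.1 (intervalIntegrable_of_continuousOn_prod hD ht hy)).aestronglyMeasurable
  · exact Filter.Eventually.of_forall fun s hs y' hy' => hC (s, y') ⟨huIoc hs, hy'⟩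
  · exact Filter.Eventually.of_forall fun s hs y' hy' =>
      (differentiableAt_of_contDiffOn_prod hU hf (hsub (huIoc hs)) (hKU hy')).hasFDerivAt

end Parametric

/-! ### From local to uniform bounds on a compact manifold -/

section Charts

variable {n : ℕ} {M : Type*} [TopologicalSpace M] [ChartedSpace (Eu n) M]

/-- To bound a quantity on a compact manifold it is enough to bound it on the compact subsets of
the charts. -/
lemma exists_uniform_bound [CompactSpace M] (P : M → ℝ → Prop)
    (mono : ∀ z C C', C ≤ C' → P z C → P z C')
    (h : ∀ (x : M) (K : Set (Eu n)), IsCompact K → K ⊆ (extChartAt (𝓡 n) x).target →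
      ∃ C, ∀ y ∈ K, P ((extChartAt (𝓡 n) x).symm y) C) : ∃ C, 0 ≤ C ∧ ∀ z, P z C := by
  have h1 : ∀ x : M, ∃ C, {z | P z C} ∈ 𝓝 x := by
    intro x
    obtain ⟨K, hK, hKt, hKc⟩ := local_compact_nhds (extChartAt_target_mem_nhds (I := 𝓡 n) x)
    obtain ⟨C, hC⟩ := h x K hKc hKt
    refine ⟨C, ?_⟩
    filter_upwards [(continuousAt_extChartAt (I := 𝓡 n) x) hK,
      extChartAt_source_mem_nhds (I := 𝓡 n) x] with z hz hzs
    have := hC _ hz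
    rwa [(extChartAt (𝓡 n) x).left_inv hzs] at this
  choose C hC using h1
  obtain ⟨t, ht⟩ := CompactSpace.elim_nhds_subcover _ hC
  -- A sum of absolute values dominates each local constant, whatever its sign, so that `mono`
  -- applies.
  refine ⟨∑ x ∈ t, |C x|, Finset.sum_nonneg fun _ _ => abs_nonneg _, fun z => ?_⟩
  have hz : z ∈ ⋃ x ∈ t, {z | P z (C x)} := ht ▸ mem_univ z
  simp only [mem_iUnion] at hz
  obtain ⟨x, hx, hzx⟩ := hz
  exact mono z _ _ ((le_abs_self _).trans
    (Finset.single_le_sum (f := fun x => |C x|) (fun _ _ => abs_nonneg _) hx)) hzx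

end Charts

/-! ### Bounded velocity fields and the effective metric -/

section Charts

variable {n : ℕ} {M : Type*} [TopologicalSpace M] [ChartedSpace (Eu n) M]
  [IsManifold (𝓡 n) ∞ M]

lemma isInner_metricAt (g : Metric n M) (x : M) : IsInner (metricAt g x) :=
  ⟨metricAt_symm g x, fun _ hv => metricAt_pos g x hv⟩

lemma bilCoord_self (b : M → Bil n) (x : M) : bilCoord b x (extChartAt (𝓡 n) x x) = b x := by
  ext v w
  rw [bilCoord_apply, frame_self, extChartAt_to_inv]
  rfl

/-- The quantitative content of a bound on the `W^{2,∞}` norm. -/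
structure IsBoundedField (g : Metric n M) (u : M → Eu n) (C : ℝ) : Prop where
  le : ∀ x, vecNorm (metricAt g x) (u x) ≤ C
  grad_le : ∀ x v, vecNorm (metricAt g x) (grad g u x v) ≤ C * vecNorm (metricAt g x) v
  grad2_le : ∀ x v w, vecNorm (metricAt g x) (grad2 g u x v w) ≤
    C * vecNorm (metricAt g x) v * vecNorm (metricAt g x) w

lemma grad2_smul_smul (g : Metric n M) (u : M → Eu n) (x : M) (a b : ℝ) (v w : Eu n) :
    grad2 g u x (a • v) (b • w) = (a * b) • grad2 g u x v w := by
  simp only [grad2, map_smul, _root_.smul_apply, smul_sub, smul_add, smul_smul, mul_comm b a]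

/-- Each of the three suprema is at most `C`. Bounds over unit balls become operator bounds by
homogeneity, used once per slot of `∇²u`. -/
lemma isBoundedField_of_w2infNorm_le (g : Metric n M) {u : M → Eu n} {C : ℝ≥0}
    (h : w2infNorm g u ≤ C) : IsBoundedField g u C := by
  unfold w2infNorm at h
  have h1 := (le_self_add.trans le_self_add).trans h
  have h2 := (le_add_self.trans le_self_add).trans h
  have h3 := le_add_self.trans h
  simp only [iSup_le_iff, Subtype.forall] at h1 h2 h3
  have conv : ∀ {r : ℝ}, ENNReal.ofReal r ≤ (C : ℝ≥0∞) → r ≤ C := fun hr => by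
    rw [ENNReal.ofReal_le_iff_le_toReal ENNReal.coe_ne_top] at hr
    simpa using hr
  refine ⟨fun x => conv (h1 x), fun x v => ?_, fun x v w => ?_⟩
  · refine le_mul_vecNorm_of_unit_ball (isInner_metricAt g x)
      (f := fun v => vecNorm (metricAt g x) (grad g u x v)) (fun c v hc => ?_)
      (fun v hv => conv (h2 x v hv)) v
    rw [map_smul, vecNorm_smul, abs_of_nonneg hc]
  · refine le_mul_vecNorm_of_unit_ball (isInner_metricAt g x)
      (f := fun w => vecNorm (metricAt g x) (grad2 g u x v w)) (fun c w hc => ?_)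
      (fun w hw => ?_) w
    · have := grad2_smul_smul g u x 1 c v w
      rw [one_smul, one_mul] at this
      rw [this, vecNorm_smul, abs_of_nonneg hc]
    · refine le_mul_vecNorm_of_unit_ball (isInner_metricAt g x)
        (f := fun v => vecNorm (metricAt g x) (grad2 g u x v w)) (fun c v hc => ?_)
        (fun v hv => conv (h3 x v hv w hw)) v
      have := grad2_smul_smul g u x c 1 v w
      rw [one_smul, mul_one] at this
      rw [this, vecNorm_smul, abs_of_nonneg hc]

lemma deformation_apply (g : Metric n M) (u : M → Eu n) (x : M) (v w : Eu n) :
    deformation g u x v w = (1 / 2 : ℝ) *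
      (metricAt g x (grad g u x v) w + metricAt g x (grad g u x w) v) := by
  simp [deformation]
  ring

lemma IsBoundedField.abs_deformation_le {g : Metric n M} {u : M → Eu n} {C : ℝ}
    (h : IsBoundedField g u C) (x : M) (v w : Eu n) :
    |deformation g u x v w| ≤ C * vecNorm (metricAt g x) v * vecNorm (metricAt g x) w := by
  have h1 := (isInner_metricAt g x).abs_apply_le (grad g u x v) w
  have h2 := (isInner_metricAt g x).abs_apply_le (grad g u x w) v
  have h3 := mul_le_mul_of_nonneg_right (h.grad_le x v) (vecNorm_nonneg (metricAt g x) w)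
  have h4 := mul_le_mul_of_nonneg_right (h.grad_le x w) (vecNorm_nonneg (metricAt g x) v)
  rw [deformation_apply, abs_mul, abs_of_pos (by norm_num : (0 : ℝ) < 1 / 2)]
  have h5 := abs_add_le (metricAt g x (grad g u x v) w) (metricAt g x (grad g u x w) v)
  nlinarith

/-- The coordinate length is comparable to the length, on compact subsets of a chart. -/
lemma exists_norm_compare (g : Metric n M) (x : M) {K : Set (Eu n)} (hK : IsCompact K)
    (hKt : K ⊆ (extChartAt (𝓡 n) x).target) :
    ∃ C, 0 < C ∧ ∀ y ∈ K, ∀ v,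
      ‖v‖ ≤ C * vecNorm (metricAt g ((extChartAt (𝓡 n) x).symm y)) (frame x y v) ∧
      vecNorm (metricAt g ((extChartAt (𝓡 n) x).symm y)) (frame x y v) ≤ C * ‖v‖ := by
  have hcont := (contDiffOn_bilCoord_metric g x).continuousOn.mono hKt
  obtain ⟨c, hc, h⟩ := exists_le_of_isCompact hK hcont
    fun y hy v hv => (isMetricNear g (hKt hy)).pos v hv
  obtain ⟨B, hB⟩ := hK.exists_bound_of_continuousOn hcont
  -- One constant for both inequalities: the first summand comes from the lower bound `c` on the
  -- metric coefficients, the second from their upper bound `B`.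
  refine ⟨(Real.sqrt c)⁻¹ + Real.sqrt |B|, by positivity, fun y hy v => ⟨?_, ?_⟩⟩
  · have h1 := Real.sqrt_le_sqrt (h y hy v)
    rw [Real.sqrt_mul hc.le, Real.sqrt_sq (norm_nonneg v), bilCoord_apply] at h1
    change _ ≤ vecNorm _ _ at h1
    have h2 : ‖v‖ ≤ (Real.sqrt c)⁻¹ *
        vecNorm (metricAt g ((extChartAt (𝓡 n) x).symm y)) (frame x y v) := by
      rwa [le_inv_mul_iff₀ (Real.sqrt_pos.2 hc)]
    refine h2.trans (mul_le_mul_of_nonneg_right ?_ (vecNorm_nonneg _ _))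
    linarith [Real.sqrt_nonneg |B|]
  · have h1 : bilCoord (metricAt g) x y v v ≤ |B| * ‖v‖ ^ 2 := by
      calc bilCoord (metricAt g) x y v v ≤ ‖bilCoord (metricAt g) x y v v‖ := le_abs_self _
        _ ≤ ‖bilCoord (metricAt g) x y‖ * ‖v‖ * ‖v‖ := ContinuousLinearMap.le_opNorm₂ _ _ _
        _ ≤ |B| * ‖v‖ * ‖v‖ := by gcongr; exact (hB y hy).trans (le_abs_self _)
        _ = |B| * ‖v‖ ^ 2 := by ring
    have h2 := Real.sqrt_le_sqrt h1
    rw [Real.sqrt_mul (abs_nonneg B), Real.sqrt_sq (norm_nonneg v), bilCoord_apply] at h2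
    change vecNorm _ _ ≤ _ at h2
    refine h2.trans (mul_le_mul_of_nonneg_right ?_ (norm_nonneg _))
    have : 0 ≤ (Real.sqrt c)⁻¹ := by positivity
    linarith

/-- A time dependent velocity field that is smooth and bounded in `W^{2,∞}`. -/
structure IsBoundedFlow (g : Metric n M) (t₀ T : ℝ) (u : ℝ → M → Eu n) (C : ℝ) : Prop where
  smooth : ContMDiffOn (𝓘(ℝ, ℝ).prod (𝓡 n)) (𝓡 n).tangent ∞
    (fun q : ℝ × M => (⟨q.2, u q.1 q.2⟩ : TangentBundle (𝓡 n) M)) (Ico t₀ T ×ˢ univ)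
  bounded : ∀ t ∈ Ico t₀ T, IsBoundedField g (u t) C
  nonneg : 0 ≤ C

namespace IsBoundedFlow

variable {g : Metric n M} {t₀ T : ℝ} {u : ℝ → M → Eu n} {C : ℝ}

lemma isDiffField (h : IsBoundedFlow g t₀ T u C) {t : ℝ} (ht : t ∈ Ico t₀ T) :
    IsDiffField (u t) := fun x _ hy =>
  differentiableAt_of_contDiffOn_prod (isOpen_extChartAt_target x)
    (contDiffOn_vecCoord h.smooth x) ht hy

lemma contDiffOn_gradCoord (h : IsBoundedFlow g t₀ T u C) (x : M) :
    ContDiffOn ℝ ∞ (fun r : ℝ × Eu n => gradCoord g (u r.1) x r.2)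
      (Ico t₀ T ×ˢ (extChartAt (𝓡 n) x).target) := by
  have hu := contDiffOn_vecCoord h.smooth x
  have hΓ : ContDiffOn ℝ ∞ (fun r : ℝ × Eu n => leviCivita g x r.2)
      (Ico t₀ T ×ˢ (extChartAt (𝓡 n) x).target) :=
    (contDiffOn_leviCivita g x).comp contDiff_snd.contDiffOn fun r hr => hr.2
  refine (contDiffOn_partial_fderiv (isOpen_extChartAt_target x) hu).add ?_
  refine ContDiffOn.clm_apply ?_ hu
  exact (ContinuousLinearMap.flipₗᵢ ℝ (Eu n) (Eu n) (Eu n)).contDiff.comp_contDiffOn hΓ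

lemma contDiffOn_deformation (h : IsBoundedFlow g t₀ T u C) (x : M) :
    ContDiffOn ℝ ∞ (fun r : ℝ × Eu n => bilCoord (deformation g (u r.1)) x r.2)
      (Ico t₀ T ×ˢ (extChartAt (𝓡 n) x).target) := by
  have hG : ContDiffOn ℝ ∞ (fun r : ℝ × Eu n => bilCoord (metricAt g) x r.2)
      (Ico t₀ T ×ˢ (extChartAt (𝓡 n) x).target) :=
    (contDiffOn_bilCoord_metric g x).comp contDiff_snd.contDiffOn fun r hr => hr.2
  have hA := h.contDiffOn_gradCoord x
  refine contDiffOn_clm_apply.2 fun v => contDiffOn_clm_apply.2 fun w => ?_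
  refine ContDiffOn.congr (f := fun r : ℝ × Eu n => (1 / 2 : ℝ) *
      (bilCoord (metricAt g) x r.2 (gradCoord g (u r.1) x r.2 v) w +
        bilCoord (metricAt g) x r.2 (gradCoord g (u r.1) x r.2 w) v)) ?_
    fun r hr => bilCoord_deformation g (h.isDiffField hr.1) hr.2 v w
  refine contDiffOn_const.mul (ContDiffOn.add ?_ ?_)
  · exact (hG.clm_apply (hA.clm_apply contDiffOn_const)).clm_apply contDiffOn_const
  · exact (hG.clm_apply (hA.clm_apply contDiffOn_const)).clm_apply contDiffOn_const

/-- The bound is uniform on all of `[t₀, T)`, not only on compact subintervals, because it comes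
from the bound on `∇u` rather than from continuity. -/
lemma exists_norm_deformation_le (h : IsBoundedFlow g t₀ T u C) (x : M) {K : Set (Eu n)}
    (hK : IsCompact K) (hKt : K ⊆ (extChartAt (𝓡 n) x).target) :
    ∃ B, 0 ≤ B ∧ ∀ s ∈ Ico t₀ T, ∀ y ∈ K, ‖bilCoord (deformation g (u s)) x y‖ ≤ B := by
  obtain ⟨D, hD, hcomp⟩ := exists_norm_compare g x hK hKt
  have hC := h.nonneg
  refine ⟨C * D * D, by positivity, fun s hs y hy =>
    ContinuousLinearMap.opNorm_le_bound₂ _ (by positivity) fun v w => ?_⟩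
  rw [bilCoord_apply]
  refine ((h.bounded s hs).abs_deformation_le _ _ _).trans ?_
  have h1 := (hcomp y hy v).2
  have h2 := (hcomp y hy w).2
  calc C * _ * _ ≤ C * (D * ‖v‖) * (D * ‖w‖) := by
        gcongr
        exact vecNorm_nonneg _ _
    _ = C * D * D * ‖v‖ * ‖w‖ := by ring

/-- The field is smooth only before `T`; boundedness makes `S` integrable up to `T`. Hence the
integral that defines `g'(T)` is a true one and not the default value zero. -/
lemma integrableOn_deformation (h : IsBoundedFlow g t₀ T u C) {x : M} {y : Eu n}
    (hy : y ∈ (extChartAt (𝓡 n) x).target) :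
    IntegrableOn (fun s => bilCoord (deformation g (u s)) x y) (Ico t₀ T) := by
  obtain ⟨B, -, hB⟩ := h.exists_norm_deformation_le x isCompact_singleton
    (singleton_subset_iff.2 hy)
  refine Integrable.of_bound (C := B) ?_ ?_
  · have hc : ContinuousOn (fun s => bilCoord (deformation g (u s)) x y) (Ico t₀ T) :=
      (h.contDiffOn_deformation x).continuousOn.comp (f := fun s : ℝ => (s, y))
        (by fun_prop) fun s hs => ⟨hs, hy⟩
    exact hc.aestronglyMeasurable measurableSet_Ico
  · exact (ae_restrict_iff' (measurableSet_Ico (a := t₀) (b := T))).2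
      (Filter.Eventually.of_forall fun s hs => hB s hs y rfl)

lemma intervalIntegrable_deformation (h : IsBoundedFlow g t₀ T u C) {x : M} {y : Eu n}
    (hy : y ∈ (extChartAt (𝓡 n) x).target) {t t' : ℝ} (ht : t ∈ Icc t₀ T) (ht' : t' ∈ Icc t₀ T) :
    IntervalIntegrable (fun s => bilCoord (deformation g (u s)) x y) volume t t' := by
  have h1 := h.integrableOn_deformation hy
  rw [← intervalIntegrable_iff_integrableOn_Ico_of_le (ht.1.trans ht.2)] at h1
  refine h1.mono_set ?_
  rw [uIcc_of_le (ht.1.trans ht.2)]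
  exact uIcc_subset_Icc ht ht'

/-- The effective metric integrates components in the preferred chart of each point, whereas here
one chart serves a whole neighbourhood. Evaluation on frame vectors commutes with the integral once
integrability is known. -/
lemma bilCoord_effMetric (h : IsBoundedFlow g t₀ T u C) (α : ℝ) {x : M} {y : Eu n}
    (hy : y ∈ (extChartAt (𝓡 n) x).target) {t : ℝ} (ht : t ∈ Icc t₀ T) :
    bilCoord (effMetric g α t₀ u t) x y = bilCoord (metricAt g) x y +
      α • ∫ s in t₀..t, bilCoord (deformation g (u s)) x y := by
  have ht0 : t₀ ∈ Icc t₀ T := ⟨le_rfl, ht.1.trans ht.2⟩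
  have h1 := h.intervalIntegrable_deformation hy ht0 ht
  set z := (extChartAt (𝓡 n) x).symm y
  have h2 := h.intervalIntegrable_deformation (mem_extChartAt_target (I := 𝓡 n) z) ht0 ht
  simp only [bilCoord_self] at h2
  have app : ∀ {f : ℝ → Bil n}, IntervalIntegrable f volume t₀ t → ∀ v w,
      (∫ s in t₀..t, f s) v w = ∫ s in t₀..t, f s v w := by
    intro f hf v w
    rw [ContinuousLinearMap.intervalIntegral_apply hf, ContinuousLinearMap.intervalIntegral_apply]
    exact ⟨hf.1.apply_continuousLinearMap v, hf.2.apply_continuousLinearMap v⟩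
  ext v w
  rw [bilCoord_apply]
  simp only [effMetric, _root_.add_apply, _root_.smul_apply, app h1, bilCoord_apply]
  exact congrArg (fun r => _ + α • r) (app h2 _ _)

/-- The coordinates of the effective metric are continuous up to the final time. -/
lemma continuousOn_effMetric (h : IsBoundedFlow g t₀ T u C) (α : ℝ) (x : M) {K : Set (Eu n)}
    (hK : IsCompact K) (hKt : K ⊆ (extChartAt (𝓡 n) x).target) :
    ContinuousOn (fun r : ℝ × Eu n => bilCoord (effMetric g α t₀ u r.1) x r.2)
      (Icc t₀ T ×ˢ K) := by
  obtain ⟨B, hB0, hB⟩ := h.exists_norm_deformation_le x hK hKt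
  -- Nothing is known about `u T`, but a single instant is negligible in the integral.
  have hae : ∀ᵐ s : ℝ, s ≠ T := by simp [ae_iff]
  have hsub : ∀ {t t' s : ℝ}, t ∈ Icc t₀ T → t' ∈ Icc t₀ T → s ∈ uIoc t t' → s ≠ T →
      s ∈ Ico t₀ T := by
    intro t t' s ht ht' hs hsT
    have := uIcc_subset_Icc ht ht' (uIoc_subset_uIcc hs)
    exact ⟨this.1, lt_of_le_of_ne this.2 hsT⟩
  refine ContinuousOn.congr (f := fun r : ℝ × Eu n => bilCoord (metricAt g) x r.2 +
      α • ∫ s in t₀..r.1, bilCoord (deformation g (u s)) x r.2) ?_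
    fun r hr => h.bilCoord_effMetric α (hKt hr.2) hr.1
  refine ContinuousOn.add ?_ (ContinuousOn.const_smul ?_ α)
  · exact ((contDiffOn_bilCoord_metric g x).continuousOn.mono hKt).comp continuousOn_snd
      fun r hr => hr.2
  -- Joint continuity from two separate facts: continuity in `y` by dominated convergence, and a
  -- Lipschitz bound in `t` with the constant `B`, uniform in `y`.
  refine continuousOn_prod_of_continuousOn_lipschitzOnWith _ B.toNNReal ?_ ?_
  · intro t ht y hy
    have ht0 : t₀ ∈ Icc t₀ T := ⟨le_rfl, ht.1.trans ht.2⟩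
    refine intervalIntegral.continuousWithinAt_of_dominated_interval (bound := fun _ => B) ?_ ?_
      intervalIntegrable_const ?_
    · filter_upwards [self_mem_nhdsWithin] with y' hy'
      exact (intervalIntegrable_iff.1
        (h.intervalIntegrable_deformation (hKt hy') ht0 ht)).aestronglyMeasurable
    · filter_upwards [self_mem_nhdsWithin] with y' hy'
      filter_upwards [hae] with s hsT hs
      exact hB s (hsub ht0 ht hs hsT) y' hy'
    · filter_upwards [hae] with s hsT hs
      exact ((h.contDiffOn_deformation x).continuousOn.comp (f := fun y : Eu n => (s, y))
        (by fun_prop) fun y' hy' => ⟨hsub ht0 ht hs hsT, hKt hy'⟩) y hy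
  · intro y hy
    refine LipschitzOnWith.of_dist_le_mul fun t ht t' ht' => ?_
    have ht0 : t₀ ∈ Icc t₀ T := ⟨le_rfl, ht.1.trans ht.2⟩
    rw [dist_eq_norm, intervalIntegral.integral_interval_sub_left
      (h.intervalIntegrable_deformation (hKt hy) ht0 ht)
      (h.intervalIntegrable_deformation (hKt hy) ht0 ht'), Real.coe_toNNReal _ hB0]
    refine (intervalIntegral.norm_integral_le_of_norm_le_const_ae (C := B) ?_).trans_eq ?_
    · filter_upwards [hae] with s hsT hs
      exact hB s (hsub ht' ht hs hsT) y hy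
    · rw [Real.dist_eq]

/-- The metric is bounded by the effective metric, uniformly in time. -/
lemma exists_metric_le_effMetric [CompactSpace M] (h : IsBoundedFlow g t₀ T u C) (α : ℝ)
    (hg' : ∀ t ∈ Icc t₀ T, ∀ x : M, ∀ v : Eu n, v ≠ 0 → 0 < effMetric g α t₀ u t x v v) :
    ∃ D, 0 ≤ D ∧ ∀ z : M, ∀ t ∈ Icc t₀ T, ∀ v,
      metricAt g z v v ≤ D * effMetric g α t₀ u t z v v := by
  refine exists_uniform_bound (n := n) (fun z D => ∀ t ∈ Icc t₀ T, ∀ v,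
    metricAt g z v v ≤ D * effMetric g α t₀ u t z v v) ?_ ?_
  · intro z D D' hD hP t ht v
    refine (hP t ht v).trans (mul_le_mul_of_nonneg_right hD ?_)
    by_cases hv : v = 0
    · simp [hv]
    · exact (hg' t ht z v hv).le
  intro x K hK hKt
  -- Positivity at the final time `T` is used here: it makes the parameter set compact.
  obtain ⟨c, hc, hle⟩ := exists_le_of_isCompact (isCompact_Icc.prod hK)
    (h.continuousOn_effMetric α x hK hKt) (fun r hr v hv => by
      rw [bilCoord_apply]
      exact hg' r.1 hr.1 _ _ (frame_ne_zero (hKt hr.2) hv))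
  obtain ⟨D, hD, hcomp⟩ := exists_norm_compare g x hK hKt
  -- Both metrics are compared with the coordinate norm of the components of `v`: `D²` bounds `g`
  -- from above and `c` bounds `g'` from below.
  refine ⟨D ^ 2 * c⁻¹, fun y hy t ht v => ?_⟩
  have h1 := (hcomp y hy (coframe x y v)).2
  have h2 := hle (t, y) ⟨ht, hy⟩ (coframe x y v)
  simp only [bilCoord_apply, frame_coframe_apply (hKt hy)] at h1 h2
  rw [← (isInner_metricAt g _).vecNorm_sq]
  calc _ ≤ (D * ‖coframe x y v‖) ^ 2 := by
        gcongr
        exact vecNorm_nonneg _ _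
    _ = D ^ 2 * c⁻¹ * (c * ‖coframe x y v‖ ^ 2) := by field_simp
    _ ≤ _ := by gcongr

/-- The effective metric is bounded, uniformly in time. -/
lemma abs_effMetric_le (h : IsBoundedFlow g t₀ T u C) (α : ℝ) {t : ℝ} (ht : t ∈ Icc t₀ T)
    (z : M) (v w : Eu n) : |effMetric g α t₀ u t z v w| ≤
      (1 + |α| * (C * (T - t₀))) * vecNorm (metricAt g z) v * vecNorm (metricAt g z) w := by
  have ht0 : t₀ ∈ Icc t₀ T := ⟨le_rfl, ht.1.trans ht.2⟩
  have h1 := h.bilCoord_effMetric α (mem_extChartAt_target (I := 𝓡 n) z) ht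
  have h2 := h.intervalIntegrable_deformation (mem_extChartAt_target (I := 𝓡 n) z) ht0 ht
  simp only [bilCoord_self] at h1 h2
  have h3 : (∫ s in t₀..t, deformation g (u s) z) v w =
      ∫ s in t₀..t, deformation g (u s) z v w := by
    rw [ContinuousLinearMap.intervalIntegral_apply h2, ContinuousLinearMap.intervalIntegral_apply]
    exact ⟨h2.1.apply_continuousLinearMap v, h2.2.apply_continuousLinearMap v⟩
  rw [h1]
  simp only [_root_.add_apply, _root_.smul_apply, smul_eq_mul, h3]
  have h4 : ‖∫ s in t₀..t, deformation g (u s) z v w‖ ≤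
      (C * vecNorm (metricAt g z) v * vecNorm (metricAt g z) w) * |t - t₀| := by
    refine intervalIntegral.norm_integral_le_of_norm_le_const_ae ?_
    have hae : ∀ᵐ s : ℝ, s ≠ T := by simp [ae_iff]
    filter_upwards [hae] with s hsT hs
    have := uIcc_subset_Icc ht0 ht (uIoc_subset_uIcc hs)
    exact (h.bounded s ⟨this.1, lt_of_le_of_ne this.2 hsT⟩).abs_deformation_le z v w
  rw [Real.norm_eq_abs, abs_of_nonneg (sub_nonneg.2 ht.1)] at h4
  have hV := vecNorm_nonneg (metricAt g z) v
  have hW := vecNorm_nonneg (metricAt g z) w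
  have hC := h.nonneg
  have h5 : |∫ s in t₀..t, deformation g (u s) z v w| ≤
      (C * vecNorm (metricAt g z) v * vecNorm (metricAt g z) w) * (T - t₀) :=
    h4.trans (by gcongr; exact ht.2)
  calc _ ≤ |metricAt g z v w| + |α * ∫ s in t₀..t, deformation g (u s) z v w| := abs_add_le _ _
    _ ≤ vecNorm (metricAt g z) v * vecNorm (metricAt g z) w + |α| *
        ((C * vecNorm (metricAt g z) v * vecNorm (metricAt g z) w) * (T - t₀)) := by
      rw [abs_mul]
      gcongr
      exact (isInner_metricAt g z).abs_apply_le v w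
    _ = _ := by ring

end IsBoundedFlow

end Charts

/-! ### Curvature of a connection perturbed by `b ⊗ U` -/

section EffectiveConnection

variable {n : ℕ}

/-- The Christoffel symbols `b ⊗ U`. -/
def tensorVec (b : Bil n) (U : Eu n) : Eu n →L[ℝ] Endo n :=
  (ContinuousLinearMap.compL ℝ (Eu n) ℝ (Eu n) (ContinuousLinearMap.toSpanSingleton ℝ U)) ∘L b

lemma tensorVec_apply (b : Bil n) (U v w : Eu n) : tensorVec b U v w = b v w • U := by
  simp [tensorVec]

lemma differentiableAt_tensorVec {b : Eu n → Bil n} {U : Eu n → Eu n} {y : Eu n}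
    (hb : DifferentiableAt ℝ b y) (hU : DifferentiableAt ℝ U y) :
    DifferentiableAt ℝ (fun y => tensorVec (b y) (U y)) y := by
  have h1 : DifferentiableAt ℝ (fun y => ContinuousLinearMap.toSpanSingleton ℝ (U y)) y :=
    (ContinuousLinearMap.toSpanSingletonCLE (𝕜 := ℝ) (E := Eu n)).differentiableAt.comp y hU
  exact ((ContinuousLinearMap.compL ℝ (Eu n) ℝ (Eu n)).differentiableAt.comp y h1).clm_comp hb

lemma fderiv_tensorVec_apply {b : Eu n → Bil n} {U : Eu n → Eu n} {y : Eu n}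
    (hb : DifferentiableAt ℝ b y) (hU : DifferentiableAt ℝ U y) (v w z : Eu n) :
    fderiv ℝ (fun y => tensorVec (b y) (U y)) y v w z =
      fderiv ℝ b y v w z • U y + b y w z • fderiv ℝ U y v := by
  have h1 := ((differentiableAt_tensorVec hb hU).hasFDerivAt.clm_apply
    (hasFDerivAt_const w y)).clm_apply (hasFDerivAt_const z y)
  have h2 := ((hb.hasFDerivAt.clm_apply (hasFDerivAt_const w y)).clm_apply
    (hasFDerivAt_const z y)).smul hU.hasFDerivAt
  have h3 := DFunLike.congr_fun (h1.unique (h2.congr_of_eventuallyEq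
    (Filter.Eventually.of_forall fun y' => tensorVec_apply _ _ _ _))) v
  simpa [add_comm] using h3

/-- The curvature of the connection `Γ + b ⊗ U`. -/
lemma curvature_add_tensorVec {Γ : Eu n → (Eu n →L[ℝ] Endo n)} {b : Eu n → Bil n}
    {U : Eu n → Eu n} {y : Eu n} (hΓ : DifferentiableAt ℝ Γ y) (hb : DifferentiableAt ℝ b y)
    (hU : DifferentiableAt ℝ U y) (hsymm : ∀ v w, Γ y v w = Γ y w v) {Q : Eu n → Eu n → Eu n → ℝ}
    (hQ : ∀ v w z, fderiv ℝ b y v w z = b y (Γ y v w) z + b y w (Γ y v z) + Q v w z)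
    (v w z : Eu n) :
    curvature (fun y => Γ y + tensorVec (b y) (U y)) y v w z = curvature Γ y v w z +
      ((Q v w z - Q w v z) • U y + (b y w z • (fderiv ℝ U y v + Γ y v (U y)) -
        b y v z • (fderiv ℝ U y w + Γ y w (U y))) +
        ((b y w z * b y v (U y)) • U y - (b y v z * b y w (U y)) • U y)) := by
  have hd : fderiv ℝ (fun y => Γ y + tensorVec (b y) (U y)) y =
      fderiv ℝ Γ y + fderiv ℝ (fun y => tensorVec (b y) (U y)) y :=
    fderiv_add hΓ (differentiableAt_tensorVec hb hU)
  -- By `hQ`, the derivative of `b` is its covariant derivative `Q` plus Christoffel terms. The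
  -- terms `b(Γ(v, w), z)` vanish on antisymmetrisation because `Γ` is symmetric. The terms `b(w,
  -- Γ(v, z))` cancel against the cross terms of the quadratic part, so only covariant quantities
  -- survive.
  simp only [curvature_apply, hd, _root_.add_apply, fderiv_tensorVec_apply hb hU, hQ,
    tensorVec_apply, map_add, map_smul, hsymm w v]
  module

end EffectiveConnection

/-! ### Boundedness of the effective curvature -/

section Charts

variable {n : ℕ} {M : Type*} [TopologicalSpace M] [ChartedSpace (Eu n) M]
  [IsManifold (𝓡 n) ∞ M]

/-- The curvature of a Riemannian metric on a compact manifold is bounded. -/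
lemma exists_curvature_le [CompactSpace M] (g : Metric n M) : ∃ C, 0 ≤ C ∧ ∀ z : M, ∀ v w a,
    vecNorm (metricAt g z) (curvature (leviCivita g z) (extChartAt (𝓡 n) z z) v w a) ≤
      C * vecNorm (metricAt g z) v * vecNorm (metricAt g z) w * vecNorm (metricAt g z) a := by
  refine exists_uniform_bound (n := n) (fun z C => ∀ v w a,
    vecNorm (metricAt g z) (curvature (leviCivita g z) (extChartAt (𝓡 n) z z) v w a) ≤
      C * vecNorm (metricAt g z) v * vecNorm (metricAt g z) w * vecNorm (metricAt g z) a) ?_ ?_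
  · intro z C C' hC h v w a
    refine (h v w a).trans ?_
    have := vecNorm_nonneg (metricAt g z)
    exact mul_le_mul_of_nonneg_right (mul_le_mul_of_nonneg_right
      (mul_le_mul_of_nonneg_right hC (this v)) (this w)) (this a)
  intro x K hK hKt
  obtain ⟨D, hD, hcomp⟩ := exists_norm_compare g x hK hKt
  have hΓ := contDiffOn_leviCivita g x
  have hDΓ : ContinuousOn (fderiv ℝ (leviCivita g x)) (extChartAt (𝓡 n) x).target :=
    hΓ.continuousOn_fderiv_of_isOpen (isOpen_extChartAt_target x) (by simp)
  have hcurv : ∀ v w a, ContinuousOn (fun y => curvature (leviCivita g x) y v w a) K := by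
    intro v w a
    simp only [curvature_apply]
    have h1 : ∀ v w a, ContinuousOn (fun y => fderiv ℝ (leviCivita g x) y v w a) K :=
      fun v w a => (((hDΓ.mono hKt).clm_apply continuousOn_const).clm_apply
        continuousOn_const).clm_apply continuousOn_const
    have h2 : ∀ v w a, ContinuousOn
        (fun y => leviCivita g x y v (leviCivita g x y w a)) K := fun v w a =>
      ((hΓ.continuousOn.mono hKt).clm_apply continuousOn_const).clm_apply
        (((hΓ.continuousOn.mono hKt).clm_apply continuousOn_const).clm_apply continuousOn_const)
    exact (((h1 v w a).sub (h1 w v a)).add (h2 v w a)).sub (h2 w v a)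
  have hcont : ContinuousOn (fun y => curvature (leviCivita g x) y) K :=
    continuousOn_clm_apply.2 fun v => continuousOn_clm_apply.2 fun w =>
      continuousOn_clm_apply.2 fun a => hcurv v w a
  obtain ⟨B, hB⟩ := hK.exists_bound_of_continuousOn hcont
  refine ⟨D * |B| * D * D * D, fun y hy v w a => ?_⟩
  have h := frame_curvature_leviCivita g (hKt hy) (coframe x y v) (coframe x y w) (coframe x y a)
  simp only [frame_coframe_apply (hKt hy)] at h
  rw [← h]
  have hv := (hcomp y hy (coframe x y v)).1
  have hw := (hcomp y hy (coframe x y w)).1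
  have ha := (hcomp y hy (coframe x y a)).1
  simp only [frame_coframe_apply (hKt hy)] at hv hw ha
  refine (hcomp y hy _).2.trans ?_
  set R := curvature (leviCivita g x) y
  have hR : ‖R (coframe x y v) (coframe x y w) (coframe x y a)‖ ≤
      |B| * ‖coframe x y v‖ * ‖coframe x y w‖ * ‖coframe x y a‖ := by
    refine ((R (coframe x y v) (coframe x y w)).le_opNorm _).trans ?_
    gcongr
    refine ((R (coframe x y v)).le_opNorm _).trans ?_
    gcongr
    refine (R.le_opNorm _).trans ?_
    gcongr
    exact (hB y hy).trans (le_abs_self _)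
  set V := vecNorm (metricAt g ((extChartAt (𝓡 n) x).symm y)) v
  set W := vecNorm (metricAt g ((extChartAt (𝓡 n) x).symm y)) w
  set A := vecNorm (metricAt g ((extChartAt (𝓡 n) x).symm y)) a
  have hV : 0 ≤ V := vecNorm_nonneg _ _
  have hW : 0 ≤ W := vecNorm_nonneg _ _
  calc _ ≤ D * (|B| * ‖coframe x y v‖ * ‖coframe x y w‖ * ‖coframe x y a‖) := by gcongr
    _ ≤ D * (|B| * (D * V) * (D * W) * (D * A)) := by gcongr
    _ = _ := by ring

namespace IsBoundedFlow

variable {g : Metric n M} {t₀ T : ℝ} {u : ℝ → M → Eu n} {C : ℝ}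

/-- The derivative of the coordinates of the deformation tensor, in terms of the second covariant
derivative of the velocity. -/
lemma fderiv_deformation (h : IsBoundedFlow g t₀ T u C) {s : ℝ} (hs : s ∈ Ico t₀ T) (x : M)
    (v w z : Eu n) :
    fderiv ℝ (bilCoord (deformation g (u s)) x) (extChartAt (𝓡 n) x x) v w z =
      deformation g (u s) x (leviCivita g x (extChartAt (𝓡 n) x x) v w) z +
      deformation g (u s) x w (leviCivita g x (extChartAt (𝓡 n) x x) v z) +
      (1 / 2 : ℝ) * (metricAt g x (grad2 g (u s) x v w) z +
        metricAt g x (grad2 g (u s) x v z) w) := by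
  set y := extChartAt (𝓡 n) x x with hy
  have hyt : y ∈ (extChartAt (𝓡 n) x).target := mem_extChartAt_target x
  have hd := h.isDiffField hs
  have hm := isMetricNear g hyt
  have hS : DifferentiableAt ℝ (bilCoord (deformation g (u s)) x) y :=
    differentiableAt_of_contDiffOn_prod (isOpen_extChartAt_target x) (h.contDiffOn_deformation x)
      hs hyt
  have hA : DifferentiableAt ℝ (gradCoord g (u s) x) y :=
    differentiableAt_of_contDiffOn_prod (isOpen_extChartAt_target x) (h.contDiffOn_gradCoord x)
      hs hyt
  have h1 := (hS.hasFDerivAt.clm_apply (hasFDerivAt_const w y)).clm_apply (hasFDerivAt_const z y)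
  have h2 : ∀ w z, HasFDerivAt (fun y => bilCoord (metricAt g) x y (gradCoord g (u s) x y w) z) _ y :=
    fun w z => (hm.diff.hasFDerivAt.clm_apply
      (hA.hasFDerivAt.clm_apply (hasFDerivAt_const w y))).clm_apply (hasFDerivAt_const z y)
  have h3 := ((h2 w z).add (h2 z w)).const_mul (1 / 2 : ℝ)
  have h4 := DFunLike.congr_fun (h1.unique (h3.congr_of_eventuallyEq
    (Filter.eventually_of_mem (target_mem_nhds hyt) fun y' hy' =>
      bilCoord_deformation g hd hy' w z))) v
  have hg2 : ∀ w, grad2 g (u s) x v w = fderiv ℝ (gradCoord g (u s) x) y v w +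
    leviCivita g x y v (grad g (u s) x w) - grad g (u s) x (leviCivita g x y v w) := fun w => rfl
  have hcompat : ∀ w z, fderiv ℝ (bilCoord (metricAt g) x) y v w z =
      metricAt g x (leviCivita g x y v w) z + metricAt g x w (leviCivita g x y v z) := by
    intro w z
    have := hm.fderiv_apply v w z
    rwa [bilCoord_self] at this
  have hgr : gradCoord g (u s) x y = grad g (u s) x := rfl
  simp [hgr, hcompat, hy ▸ bilCoord_self (metricAt g) x] at h4
  rw [h4]
  simp only [deformation_apply, hg2, map_add, map_sub, _root_.add_apply, _root_.sub_apply]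
  rw [metricAt_symm g x (grad g (u s) x w) (leviCivita g x y v z),
    metricAt_symm g x (grad g (u s) x z) (leviCivita g x y v w)]
  ring

/-- Differentiation under the integral needs `t < T`. A bound that survives as `t` tends to `T` is
not visible in this formula; it comes from rewriting the integrand through `∇²u`. -/
lemma differentiableAt_effMetric (h : IsBoundedFlow g t₀ T u C) (α : ℝ) {t : ℝ}
    (ht : t ∈ Ico t₀ T) (x : M) :
    HasFDerivAt (bilCoord (effMetric g α t₀ u t) x)
      (fderiv ℝ (bilCoord (metricAt g) x) (extChartAt (𝓡 n) x x) + α • ∫ s in t₀..t,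
        fderiv ℝ (bilCoord (deformation g (u s)) x) (extChartAt (𝓡 n) x x))
      (extChartAt (𝓡 n) x x) := by
  have hyt := mem_extChartAt_target (I := 𝓡 n) x
  have h1 := (hasFDerivAt_intervalIntegral (isOpen_extChartAt_target x)
    (h.contDiffOn_deformation x) ht hyt).1
  refine ((isMetricNear g hyt).diff.hasFDerivAt.add (h1.const_smul α)).congr_of_eventuallyEq ?_
  exact Filter.eventually_of_mem (target_mem_nhds hyt) fun y hy =>
    h.bilCoord_effMetric α hy (Ico_subset_Icc_self ht)

/-- The covariant derivative of the effective metric is bounded. -/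
lemma exists_fderiv_effMetric (h : IsBoundedFlow g t₀ T u C) (α : ℝ) {t : ℝ}
    (ht : t ∈ Ico t₀ T) (x : M) : ∃ Q : Eu n → Eu n → Eu n → ℝ,
    (∀ v w z, fderiv ℝ (bilCoord (effMetric g α t₀ u t) x) (extChartAt (𝓡 n) x x) v w z =
      effMetric g α t₀ u t x (leviCivita g x (extChartAt (𝓡 n) x x) v w) z +
      effMetric g α t₀ u t x w (leviCivita g x (extChartAt (𝓡 n) x x) v z) + Q v w z) ∧
    ∀ v w z, |Q v w z| ≤ |α| * (C * (T - t₀)) * vecNorm (metricAt g x) v *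
      vecNorm (metricAt g x) w * vecNorm (metricAt g x) z := by
  set y := extChartAt (𝓡 n) x x with hy
  have hyt : y ∈ (extChartAt (𝓡 n) x).target := mem_extChartAt_target x
  have ht' := Ico_subset_Icc_self ht
  have ht0 : t₀ ∈ Icc t₀ T := ⟨le_rfl, ht'.1.trans ht'.2⟩
  have hico : ∀ s ∈ uIcc t₀ t, s ∈ Ico t₀ T := fun s hs => by
    rw [uIcc_of_le ht.1] at hs
    exact ⟨hs.1, hs.2.trans_lt ht.2⟩
  have hintD := (hasFDerivAt_intervalIntegral (isOpen_extChartAt_target x)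
    (h.contDiffOn_deformation x) ht hyt).2
  have hintS := h.intervalIntegrable_deformation hyt ht0 ht'
  rw [hy] at hintS
  simp only [bilCoord_self] at hintS
  have happ : ∀ {E F : Type} [NormedAddCommGroup E] [NormedSpace ℝ E] [NormedAddCommGroup F]
      [NormedSpace ℝ F] {f : ℝ → E →L[ℝ] F}, IntervalIntegrable f volume t₀ t → ∀ v,
      IntervalIntegrable (fun s => f s v) volume t₀ t := fun hf v =>
    ⟨hf.1.apply_continuousLinearMap v, hf.2.apply_continuousLinearMap v⟩
  have hS : ∀ v w, (∫ s in t₀..t, deformation g (u s) x) v w =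
      ∫ s in t₀..t, deformation g (u s) x v w := fun v w => by
    rw [ContinuousLinearMap.intervalIntegral_apply hintS,
      ContinuousLinearMap.intervalIntegral_apply (happ hintS v)]
  have hD : ∀ v w z, (∫ s in t₀..t, fderiv ℝ (bilCoord (deformation g (u s)) x) y) v w z =
      ∫ s in t₀..t, fderiv ℝ (bilCoord (deformation g (u s)) x) y v w z := fun v w z => by
    rw [ContinuousLinearMap.intervalIntegral_apply hintD,
      ContinuousLinearMap.intervalIntegral_apply (happ hintD v),
      ContinuousLinearMap.intervalIntegral_apply (happ (happ hintD v) w)]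
  -- The witness is `∇g'`. As `∇g = 0`, it equals `α ∫ ∇S`, and `∇S` is the symmetrisation of `∇²u`.
  refine ⟨fun v w z => α * ∫ s in t₀..t, (1 / 2 : ℝ) * (metricAt g x (grad2 g (u s) x v w) z +
        metricAt g x (grad2 g (u s) x v z) w), fun v w z => ?_, fun v w z => ?_⟩
  · have e : ∫ s in t₀..t, fderiv ℝ (bilCoord (deformation g (u s)) x) y v w z =
        (∫ s in t₀..t, deformation g (u s) x (leviCivita g x y v w) z) +
        (∫ s in t₀..t, deformation g (u s) x w (leviCivita g x y v z)) +
        ∫ s in t₀..t, (1 / 2 : ℝ) * (metricAt g x (grad2 g (u s) x v w) z +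
          metricAt g x (grad2 g (u s) x v z) w) := by
      have i1 := happ (happ hintS (leviCivita g x y v w)) z
      have i2 := happ (happ hintS w) (leviCivita g x y v z)
      have i3 := ((happ (happ (happ hintD v) w) z).sub i1).sub i2
      have e3 : ∫ s in t₀..t, (1 / 2 : ℝ) * (metricAt g x (grad2 g (u s) x v w) z +
          metricAt g x (grad2 g (u s) x v z) w) =
          ∫ s in t₀..t, fderiv ℝ (bilCoord (deformation g (u s)) x) y v w z -
            deformation g (u s) x (leviCivita g x y v w) z -
            deformation g (u s) x w (leviCivita g x y v z) :=
        intervalIntegral.integral_congr fun s hs => by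
          simp only [h.fderiv_deformation (hico s hs) x v w z, hy]
          ring
      rw [e3, intervalIntegral.integral_sub ((happ (happ (happ hintD v) w) z).sub i1) i2,
        intervalIntegral.integral_sub (happ (happ (happ hintD v) w) z) i1]
      ring
    rw [(h.differentiableAt_effMetric α ht x).fderiv]
    have hcompat := (isMetricNear g hyt).fderiv_apply v w z
    rw [hy, bilCoord_self, ← hy] at hcompat
    simp only [_root_.add_apply, _root_.smul_apply, ← hy, hD, e, hcompat, effMetric, smul_eq_mul, hS]
    simp only [leviCivita]
    ring
  · have hV := vecNorm_nonneg (metricAt g x)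
    have hin := isInner_metricAt g x
    have hb : ‖∫ s in t₀..t, (1 / 2 : ℝ) * (metricAt g x (grad2 g (u s) x v w) z +
        metricAt g x (grad2 g (u s) x v z) w)‖ ≤ (C * vecNorm (metricAt g x) v *
      vecNorm (metricAt g x) w * vecNorm (metricAt g x) z) * |t - t₀| := by
      refine intervalIntegral.norm_integral_le_of_norm_le_const fun s hs => ?_
      have hbd := h.bounded s (hico s (uIoc_subset_uIcc hs))
      have h1 := (hin.abs_apply_le (grad2 g (u s) x v w) z).trans
        (mul_le_mul_of_nonneg_right (hbd.grad2_le x v w) (hV z))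
      have h2 := (hin.abs_apply_le (grad2 g (u s) x v z) w).trans
        (mul_le_mul_of_nonneg_right (hbd.grad2_le x v z) (hV w))
      have h3 := abs_add_le (metricAt g x (grad2 g (u s) x v w) z)
        (metricAt g x (grad2 g (u s) x v z) w)
      rw [Real.norm_eq_abs, abs_mul, abs_of_pos (by norm_num : (0 : ℝ) < 1 / 2)]
      linarith
    rw [Real.norm_eq_abs, abs_of_nonneg (sub_nonneg.2 ht.1)] at hb
    have hC := h.nonneg
    rw [abs_mul]
    calc _ ≤ |α| * ((C * vecNorm (metricAt g x) v *
          vecNorm (metricAt g x) w * vecNorm (metricAt g x) z) * (T - t₀)) := by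
          refine mul_le_mul_of_nonneg_left (hb.trans ?_) (abs_nonneg _)
          refine mul_le_mul_of_nonneg_left (by linarith [ht'.2]) ?_
          have := hV v; have := hV w; have := hV z
          positivity
      _ = _ := by ring

/-- The curvature of the effective connection is bounded, uniformly in time. -/
lemma exists_effCurvature_le [CompactSpace M] (h : IsBoundedFlow g t₀ T u C) (α : ℝ) :
    ∃ D, 0 ≤ D ∧ ∀ t ∈ Ico t₀ T, ∀ x v w a,
      vecNorm (metricAt g x) (effCurvature g α t₀ u t x v w a) ≤
        D * vecNorm (metricAt g x) v * vecNorm (metricAt g x) w * vecNorm (metricAt g x) a := by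
  obtain ⟨R, hR, hcurv⟩ := exists_curvature_le g
  by_cases hT : t₀ < T
  swap
  · exact ⟨0, le_rfl, fun t ht => absurd (ht.1.trans_lt ht.2) hT⟩
  have hC := h.nonneg
  set q := |α| * (C * (T - t₀)) with hq
  have hq0 : 0 ≤ q := mul_nonneg (abs_nonneg _) (mul_nonneg hC (sub_pos.2 hT).le)
  -- Here `q` bounds `∇g'` and `1 + q` bounds `g'`. The three added terms bound `∇g' ⊗ u`, `g' ⊗ ∇u`
  -- and `g' ⊗ g'(·, u) u`; the factors 2 come from antisymmetrisation.
  refine ⟨R + (2 * q * C + 2 * (1 + q) * C + 2 * (1 + q) ^ 2 * C ^ 2), by positivity, ?_⟩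
  intro t ht x v w a
  set y := extChartAt (𝓡 n) x x with hy
  have hyt : y ∈ (extChartAt (𝓡 n) x).target := mem_extChartAt_target x
  obtain ⟨Q, hQ, hQb⟩ := h.exists_fderiv_effMetric α ht x
  have hb : bilCoord (effMetric g α t₀ u t) x y = effMetric g α t₀ u t x := bilCoord_self _ _
  have hu : vecCoord (u t) x y = u t x := by
    rw [vecCoord, hy, coframe_self, extChartAt_to_inv]
    rfl
  have hcf := curvature_add_tensorVec (U := vecCoord (u t) x) (Γ := leviCivita g x)
    (((contDiffOn_leviCivita g x).contDiffAt (target_mem_nhds hyt)).differentiableAt (by simp))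
    (h.differentiableAt_effMetric α ht x).differentiableAt (h.isDiffField ht x y hyt)
    (isMetricNear g hyt).christoffel_symm (Q := Q) (by
      intro v w z
      rw [hQ v w z, bilCoord_self]) v w a
  have hgr : ∀ v, fderiv ℝ (vecCoord (u t) x) y v + leviCivita g x y v (vecCoord (u t) x y) =
    grad g (u t) x v := fun v => rfl
  rw [hgr, hgr, hb, hu] at hcf
  have he : effCurvature g α t₀ u t x v w a = _ := hcf
  rw [he]
  have hin := isInner_metricAt g x
  have hbd := h.bounded t ht
  have hN := vecNorm_nonneg (metricAt g x)
  have hE : ∀ v w, |effMetric g α t₀ u t x v w| ≤ (1 + q) * vecNorm (metricAt g x) v *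
    vecNorm (metricAt g x) w := h.abs_effMetric_le α (Ico_subset_Icc_self ht) x
  have hv := hN v
  have hw := hN w
  have ha := hN a
  have b1 := hcurv x v w a
  have b2 : vecNorm (metricAt g x) ((Q v w a - Q w v a) • u t x) ≤
      (2 * q * C) * vecNorm (metricAt g x) v * vecNorm (metricAt g x) w *
        vecNorm (metricAt g x) a := by
    rw [vecNorm_smul]
    have h1 := hQb v w a
    have h2 := hQb w v a
    have h3 := abs_sub (Q v w a) (Q w v a)
    calc _ ≤ (2 * q * vecNorm (metricAt g x) v * vecNorm (metricAt g x) w *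
        vecNorm (metricAt g x) a) * C := by
          gcongr
          · exact hN _
          · linarith
          · exact hbd.le x
      _ = _ := by ring
  have b3 : ∀ v w, vecNorm (metricAt g x) (effMetric g α t₀ u t x w a • grad g (u t) x v) ≤
      ((1 + q) * C) * vecNorm (metricAt g x) v * vecNorm (metricAt g x) w *
        vecNorm (metricAt g x) a := by
    intro v w
    rw [vecNorm_smul]
    have := hN w
    calc _ ≤ ((1 + q) * vecNorm (metricAt g x) w * vecNorm (metricAt g x) a) *
        (C * vecNorm (metricAt g x) v) :=
          mul_le_mul (hE w a) (hbd.grad_le x v) (hN _) (by positivity)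
      _ = _ := by ring
  have b4 : ∀ v w, vecNorm (metricAt g x)
      ((effMetric g α t₀ u t x w a * effMetric g α t₀ u t x v (u t x)) • u t x) ≤
      ((1 + q) ^ 2 * C ^ 2) * vecNorm (metricAt g x) v * vecNorm (metricAt g x) w *
        vecNorm (metricAt g x) a := by
    intro v w
    rw [vecNorm_smul, abs_mul]
    have := hN w
    have := hN v
    calc _ ≤ (((1 + q) * vecNorm (metricAt g x) w * vecNorm (metricAt g x) a) *
        ((1 + q) * vecNorm (metricAt g x) v * C)) * C := by
          refine mul_le_mul (mul_le_mul (hE w a) ((hE v _).trans ?_) (abs_nonneg _)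
            (by positivity)) (hbd.le x) (hN _) (by positivity)
          gcongr
          exact hbd.le x
      _ = _ := by ring
  have c1 := hin.vecNorm_add_le (curvature (leviCivita g x) y v w a)
    ((Q v w a - Q w v a) • u t x + (effMetric g α t₀ u t x w a • grad g (u t) x v -
      effMetric g α t₀ u t x v a • grad g (u t) x w) +
      ((effMetric g α t₀ u t x w a * effMetric g α t₀ u t x v (u t x)) • u t x -
        (effMetric g α t₀ u t x v a * effMetric g α t₀ u t x w (u t x)) • u t x))
  refine c1.trans ((add_le_add b1 ((hin.vecNorm_add_le _ _).trans
    (add_le_add ((hin.vecNorm_add_le _ _).trans (add_le_add b2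
      ((hin.vecNorm_sub_le _ _).trans (add_le_add (b3 v w) (b3 w v)))))
      ((hin.vecNorm_sub_le _ _).trans (add_le_add (b4 v w) (b4 w v)))))).trans_eq ?_)
  ring

end IsBoundedFlow

end Charts

/-! ### Orthonormal frames and norms of covectors and forms -/

section Orthonormal

variable {n : ℕ}

/-- Orthonormal frames of an inner product. -/
def IsOrthonormal (b : Bil n) (e : Fin n → Eu n) : Prop :=
  ∀ a c, b (e a) (e c) = if a = c then 1 else 0

lemma eu_eq_sum (v : Eu n) : v = ∑ i, v i • basisVec i := by
  ext j
  simp [basisVec, Pi.single_apply]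

lemma apply_eq_sum (b : Bil n) (v w : Eu n) :
    b v w = ∑ i, ∑ j, v i * w j * b (basisVec i) (basisVec j) := by
  conv_lhs => rw [eu_eq_sum v, eu_eq_sum w]
  simp only [map_sum, map_smul, _root_.sum_apply, _root_.smul_apply, smul_eq_mul, Finset.mul_sum]
  rw [Finset.sum_comm]
  exact Finset.sum_congr rfl fun i _ => Finset.sum_congr rfl fun j _ => by ring

/-- The Gram matrix. -/
def gram (b : Bil n) : Matrix (Fin n) (Fin n) ℝ :=
  Matrix.of fun i j => b (basisVec i) (basisVec j)

open scoped Matrix in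
lemma apply_toLp_toLp (b : Bil n) (B : Matrix (Fin n) (Fin n) ℝ) (a c : Fin n) :
    b (WithLp.toLp 2 (B a)) (WithLp.toLp 2 (B c)) = (B * gram b * Bᵀ) a c := by
  rw [apply_eq_sum]
  simp only [Matrix.mul_apply, Matrix.transpose_apply, gram, Matrix.of_apply, Finset.sum_mul]
  rw [Finset.sum_comm]
  exact Finset.sum_congr rfl fun i _ => Finset.sum_congr rfl fun j _ => by ring

-- With the frame vectors as the rows of `B`, orthonormality reads `B G Bᵀ = 1`. One-sided inverses
-- of square matrices are two-sided, so `G (Bᵀ B) = 1`.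
open scoped Matrix in
lemma IsOrthonormal.invGram_eq {b : Bil n} {e : Fin n → Eu n} (he : IsOrthonormal b e)
    (i j : Fin n) : invGram b i j = ∑ a, e a i * e a j := by
  set B : Matrix (Fin n) (Fin n) ℝ := Matrix.of fun a i => e a i with hB
  have h1 : B * gram b * Bᵀ = 1 := by
    ext a c
    rw [← apply_toLp_toLp, Matrix.one_apply]
    exact he a c
  have h2 : gram b * (Bᵀ * B) = 1 := by
    rw [Matrix.mul_assoc, mul_eq_one_comm] at h1
    rwa [Matrix.mul_assoc] at h1
  have h3 : invGram b = Bᵀ * B := Matrix.inv_eq_right_inv h2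
  rw [h3]
  simp [Matrix.mul_apply, hB]

-- The inverse Gram matrix is positive and therefore factors as `Bᵀ B`; the rows of `B` form the
-- frame.
open scoped Matrix MatrixOrder in
lemma IsInner.exists_isOrthonormal {b : Bil n} (hb : IsInner b) :
    ∃ e : Fin n → Eu n, IsOrthonormal b e := by
  have hG : (gram b).PosDef := by
    refine Matrix.PosDef.of_dotProduct_mulVec_pos ?_ ?_
    · ext i j
      simp [gram, hb.symm]
    · intro x hx
      have h := hb.pos (WithLp.toLp 2 x) (by simpa using hx)
      rw [apply_eq_sum] at h
      refine h.trans_eq ?_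
      simp only [dotProduct, Matrix.mulVec, gram, Matrix.of_apply, Finset.mul_sum, star_trivial]
      exact Finset.sum_congr rfl fun i _ => Finset.sum_congr rfl fun j _ => by ring
  obtain ⟨B, hB⟩ := CStarAlgebra.nonneg_iff_eq_star_mul_self.1
    (Matrix.nonneg_iff_posSemidef.2 hG.inv.posSemidef)
  have hB' : Bᵀ * B * gram b = 1 := by
    have h1 := Matrix.nonsing_inv_mul (gram b) ((Matrix.isUnit_iff_isUnit_det _).1 hG.isUnit)
    rw [hB] at h1
    simpa [Matrix.star_eq_conjTranspose] using h1
  refine ⟨fun a => WithLp.toLp 2 (B a), fun a c => ?_⟩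
  rw [apply_toLp_toLp, ← Matrix.one_apply]
  rw [Matrix.mul_assoc, mul_eq_one_comm] at hB'
  rw [hB']

lemma IsOrthonormal.linearIndependent {b : Bil n} {e : Fin n → Eu n} (he : IsOrthonormal b e) :
    LinearIndependent ℝ e := by
  rw [Fintype.linearIndependent_iff]
  intro c hc i
  have h := congrArg (fun v => b v (e i)) hc
  simpa [_root_.sum_apply, he _ _] using h

lemma IsOrthonormal.eq_sum {b : Bil n} {e : Fin n → Eu n} (he : IsOrthonormal b e) (v : Eu n) :
    v = ∑ a, b v (e a) • e a := by
  have hspan := he.linearIndependent.span_eq_top_of_card_eq_finrank' (by simp)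
  obtain ⟨c, hc⟩ := (Submodule.mem_span_range_iff_exists_fun ℝ).1
    (hspan ▸ Submodule.mem_top : v ∈ Submodule.span ℝ (range e))
  rw [← hc]
  refine Finset.sum_congr rfl fun a _ => ?_
  congr 1
  simp [_root_.sum_apply, he _ _]

lemma IsOrthonormal.coSq_eq {b : Bil n} {e : Fin n → Eu n} (he : IsOrthonormal b e)
    (ξ : Eu n →L[ℝ] ℝ) : coSq b ξ = ∑ a, ξ (e a) ^ 2 := by
  have h : ∀ a, ξ (e a) = ∑ i, e a i * ξ (basisVec i) := fun a => by
    conv_lhs => rw [eu_eq_sum (e a)]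
    simp
  have h2 : ∀ a, ξ (e a) ^ 2 =
      ∑ i, ∑ j, e a i * e a j * ξ (basisVec i) * ξ (basisVec j) := fun a => by
    rw [h, sq, Finset.sum_mul_sum]
    exact Finset.sum_congr rfl fun i _ => Finset.sum_congr rfl fun j _ => by ring
  simp only [coSq, he.invGram_eq, h2, Finset.sum_mul]
  conv_rhs => rw [Finset.sum_comm]
  refine Finset.sum_congr rfl fun i _ => ?_
  rw [Finset.sum_comm]

/-- In an orthonormal frame this is the Cauchy-Schwarz inequality for the components of `ξ` and `v`.
-/
lemma IsInner.abs_covector_le {b : Bil n} (hb : IsInner b) (ξ : Eu n →L[ℝ] ℝ) (v : Eu n) :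
    |ξ v| ≤ Real.sqrt (coSq b ξ) * vecNorm b v := by
  obtain ⟨e, he⟩ := hb.exists_isOrthonormal
  have h1 : ξ v = ∑ a, ξ (e a) * b v (e a) := by
    conv_lhs => rw [he.eq_sum v]
    simp [mul_comm]
  have h2 : b v v = ∑ a, b v (e a) ^ 2 := by
    conv_lhs => arg 2; rw [he.eq_sum v]
    simp [sq]
  rw [vecNorm, ← Real.sqrt_mul (by rw [he.coSq_eq]; positivity), ← Real.sqrt_sq_eq_abs]
  refine Real.sqrt_le_sqrt ?_
  rw [h1, h2, he.coSq_eq]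
  exact Finset.sum_mul_sq_le_sq_mul_sq _ _ _

/-- Expanding the frame vectors in coordinates turns the contraction with inverse Gram matrices into
a sum of squares. Positivity and invariance of `formSq` are read from this form. -/
lemma IsOrthonormal.formSq_eq {k : ℕ} {b : Bil n} {e : Fin n → Eu n} (he : IsOrthonormal b e)
    (lam : KForm n k) : formSq b lam =
      ((k.factorial : ℝ))⁻¹ * ∑ A : Fin k → Fin n, ‖lam fun a => e (A a)‖ ^ 2 := by
  have h : ∀ A : Fin k → Fin n, (lam fun a => e (A a)) =
      ∑ I : Fin k → Fin n, ((∏ a, e (A a) (I a) : ℝ) : ℂ) * lam (fun a => basisVec (I a)) := by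
    intro A
    have h1 : (fun a => e (A a)) = fun a => ∑ i, e (A a) i • basisVec i :=
      funext fun a => eu_eq_sum _
    rw [h1]
    have h2 := (lam.toAlternatingMap.toMultilinearMap).map_sum
      (fun (a : Fin k) (i : Fin n) => e (A a) i • basisVec i)
    refine h2.trans (Finset.sum_congr rfl fun I _ => ?_)
    rw [MultilinearMap.map_smul_univ]
    exact Complex.real_smul
  have h3 : ∀ A : Fin k → Fin n, ‖lam fun a => e (A a)‖ ^ 2 =
      ∑ I : Fin k → Fin n, ∑ J : Fin k → Fin n, (∏ a, e (A a) (I a) * e (A a) (J a)) *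
        (lam (fun a => basisVec (I a)) *
          (starRingEnd ℂ) (lam (fun a => basisVec (J a)))).re := by
    intro A
    have h4 : ‖lam fun a => e (A a)‖ ^ 2 =
        ((lam fun a => e (A a)) * (starRingEnd ℂ) (lam fun a => e (A a))).re := by
      rw [Complex.mul_conj, Complex.normSq_eq_norm_sq, Complex.ofReal_re]
    rw [h4, h A, map_sum, Finset.sum_mul_sum, Complex.re_sum]
    refine Finset.sum_congr rfl fun I _ => ?_
    rw [Complex.re_sum]
    refine Finset.sum_congr rfl fun J _ => ?_
    rw [map_mul, Complex.conj_ofReal, mul_mul_mul_comm, ← Complex.ofReal_mul,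
      Complex.re_ofReal_mul, Finset.prod_mul_distrib]
  rw [formSq]
  congr 1
  simp only [h3]
  conv_rhs => rw [Finset.sum_comm]
  refine Finset.sum_congr rfl fun I _ => ?_
  conv_rhs => rw [Finset.sum_comm]
  refine Finset.sum_congr rfl fun J _ => ?_
  simp only [he.invGram_eq]
  rw [Finset.prod_univ_sum, Fintype.piFinset_univ, Finset.sum_mul]

variable {b : Bil n} {A B : Endo n}

lemma IsOrthonormal.comp {e : Fin n → Eu n} (he : IsOrthonormal b e) (hAB : ∀ v, A (B v) = v) :
    IsOrthonormal (b.bilinearComp A A) (fun a => B (e a)) := fun a c => by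
  simp [hAB, he a c]

lemma coSq_comp (hb : IsInner b) (hAB : ∀ v, A (B v) = v) (ξ : Eu n →L[ℝ] ℝ) :
    coSq (b.bilinearComp A A) (ξ ∘L A) = coSq b ξ := by
  obtain ⟨e, he⟩ := hb.exists_isOrthonormal
  rw [he.coSq_eq, (he.comp hAB).coSq_eq]
  simp [hAB]

/-- The map `B` carries a `b`-orthonormal frame to a frame orthonormal for the pulled back inner
product, and the form takes the same values on the two frames. -/
lemma formSq_comp {k : ℕ} (hb : IsInner b) (hAB : ∀ v, A (B v) = v) (lam : KForm n k) :
    formSq (b.bilinearComp A A) (lam.compContinuousLinearMap A) = formSq b lam := by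
  obtain ⟨e, he⟩ := hb.exists_isOrthonormal
  rw [he.formSq_eq, (he.comp hAB).formSq_eq]
  simp [hAB, Function.comp_def]

/-- A `b`-unit vector has `g`-length at most `√D`, and there are `n ^ k` tuples of frame vectors. -/
lemma formSq_le {k : ℕ} (hb : IsInner b) {lam : KForm n k} {C D : ℝ} (hC : 0 ≤ C)
    {g : Bil n} (hg : ∀ v, g v v ≤ D * b v v)
    (h : ∀ v, ‖lam v‖ ≤ C * ∏ i, vecNorm g (v i)) :
    formSq b lam ≤ ((k.factorial : ℝ))⁻¹ * ((n : ℝ) ^ k * (C * Real.sqrt D ^ k) ^ 2) := by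
  obtain ⟨e, he⟩ := hb.exists_isOrthonormal
  rw [he.formSq_eq]
  gcongr
  calc _ ≤ ∑ A : Fin k → Fin n, (C * Real.sqrt D ^ k) ^ 2 := by
        refine Finset.sum_le_sum fun A _ => ?_
        gcongr
        refine (h _).trans ?_
        gcongr
        calc _ ≤ ∏ i : Fin k, Real.sqrt D := by
              refine Finset.prod_le_prod (fun i _ => vecNorm_nonneg _ _) fun i _ => ?_
              refine Real.sqrt_le_sqrt ((hg _).trans_eq ?_)
              simp [he _ _]
          _ = _ := by simp
    _ = _ := by simp

lemma formSq_nonneg {k : ℕ} (hb : IsInner b) (lam : KForm n k) : 0 ≤ formSq b lam := by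
  obtain ⟨e, he⟩ := hb.exists_isOrthonormal
  rw [he.formSq_eq]
  positivity

lemma coSq_nonneg (hb : IsInner b) (ξ : Eu n →L[ℝ] ℝ) : 0 ≤ coSq b ξ := by
  obtain ⟨e, he⟩ := hb.exists_isOrthonormal
  rw [he.coSq_eq]
  positivity

/-- The inverse Gram matrix depends continuously on the inner product. -/
lemma continuousOn_invGram {X : Type*} [TopologicalSpace X] {S : Set X} {b : X → Bil n}
    (hb : ContinuousOn b S) (hin : ∀ x ∈ S, IsInner (b x)) (i j : Fin n) :
    ContinuousOn (fun x => invGram (b x) i j) S := by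
  have hG : ContinuousOn (fun x => gram (b x)) S := by
    refine continuousOn_pi.2 fun i => continuousOn_pi.2 fun j => ?_
    exact (hb.clm_apply continuousOn_const).clm_apply continuousOn_const
  -- A vector in the kernel of the Gram matrix would have length zero. Continuity of the inverse
  -- then follows from the adjugate formula.
  have hdet : ∀ x ∈ S, (gram (b x)).det ≠ 0 := by
    intro x hx h0
    obtain ⟨v, hv, hv0⟩ := Matrix.exists_mulVec_eq_zero_iff.2 h0
    have h := (hin x hx).pos (WithLp.toLp 2 v) (by simpa using hv)
    rw [apply_eq_sum] at h
    have h1 : ∑ i, v i * (gram (b x)).mulVec v i = 0 := by simp [hv0]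
    refine h.ne' (Eq.trans ?_ h1)
    simp only [dotProduct, Matrix.mulVec, gram, Matrix.of_apply, Finset.mul_sum]
    exact Finset.sum_congr rfl fun i _ => Finset.sum_congr rfl fun j _ => by ring
  have h1 : ContinuousOn (fun x => ((gram (b x)).det)⁻¹ * (gram (b x)).adjugate i j) S := by
    intro x hx
    have hGx := hG x hx
    have h2 : ContinuousWithinAt (fun x => (gram (b x)).det) S x :=
      (Continuous.matrix_det continuous_id).continuousAt.comp_continuousWithinAt hGx
    have h3 : ContinuousWithinAt (fun x => (gram (b x)).adjugate) S x :=
      (Continuous.matrix_adjugate continuous_id).continuousAt.comp_continuousWithinAt hGx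
    exact (h2.inv₀ (hdet x hx)).mul
      ((continuous_apply_apply i j).continuousAt.comp_continuousWithinAt h3)
  refine h1.congr fun x _ => ?_
  change (gram (b x))⁻¹ i j = _
  rw [Matrix.inv_def]
  simp

lemma continuousOn_coSq {X : Type*} [TopologicalSpace X] {S : Set X} {b : X → Bil n}
    (hb : ContinuousOn b S) (hin : ∀ x ∈ S, IsInner (b x)) {ξ : X → (Eu n →L[ℝ] ℝ)}
    (hξ : ContinuousOn ξ S) : ContinuousOn (fun x => coSq (b x) (ξ x)) S := by
  unfold coSq
  refine continuousOn_finsetSum _ fun i _ => continuousOn_finsetSum _ fun j _ => ?_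
  exact ((continuousOn_invGram hb hin i j).mul (hξ.clm_apply continuousOn_const)).mul
    (hξ.clm_apply continuousOn_const)

lemma continuousOn_formSq {k : ℕ} {X : Type*} [TopologicalSpace X] {S : Set X} {b : X → Bil n}
    (hb : ContinuousOn b S) (hin : ∀ x ∈ S, IsInner (b x)) {lam : X → KForm n k}
    (hlam : ContinuousOn lam S) : ContinuousOn (fun x => formSq (b x) (lam x)) S := by
  have happ : ∀ v : Fin k → Eu n, ContinuousOn (fun x => lam x v) S := fun v =>
    (ContinuousAlternatingMap.apply ℝ (Eu n) ℂ v).continuous.comp_continuousOn hlam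
  unfold formSq
  refine continuousOn_const.mul
    (continuousOn_finsetSum _ fun i _ => continuousOn_finsetSum _ fun j _ => ?_)
  refine ContinuousOn.mul (continuousOn_finsetProd _ fun a _ => continuousOn_invGram hb hin _ _) ?_
  exact Complex.continuous_re.comp_continuousOn
    ((happ _).mul (Complex.continuous_conj.comp_continuousOn (happ _)))

end Orthonormal

/-! ### Compact pieces of the cosphere bundle and comass bounds -/

section Charts

variable {n : ℕ} {M : Type*} [TopologicalSpace M] [ChartedSpace (Eu n) M]
  [IsManifold (𝓡 n) ∞ M]

lemma mkCot_eq_cotCoord {x : M} {y : Eu n} (hy : y ∈ (extChartAt (𝓡 n) x).target)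
    (ξ : Eu n →L[ℝ] ℝ) :
    cotCoord x (y, ξ ∘L frame x y) = mkCot ((extChartAt (𝓡 n) x).symm y) ξ := by
  simp only [cotCoord]
  rw [ContinuousLinearMap.comp_assoc, frame_coframe hy]
  rfl

lemma isInner_bilCoord {b : M → Bil n} {x : M} {y : Eu n}
    (hy : y ∈ (extChartAt (𝓡 n) x).target) (hb : IsInner (b ((extChartAt (𝓡 n) x).symm y))) :
    IsInner (bilCoord b x y) where
  symm v w := by rw [bilCoord_apply, bilCoord_apply, hb.symm]
  pos v hv := by
    rw [bilCoord_apply]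
    exact hb.pos _ (frame_ne_zero hy hv)

lemma coNorm_cotCoord (g : Metric n M) {x : M} {y : Eu n}
    (hy : y ∈ (extChartAt (𝓡 n) x).target) (η : Eu n →L[ℝ] ℝ) :
    coNorm g (cotCoord x (y, η)) = Real.sqrt (coSq (bilCoord (metricAt g) x y) η) := by
  have h := coSq_comp (isInner_metricAt g ((extChartAt (𝓡 n) x).symm y))
    (A := frame x y) (B := coframe x y) (frame_coframe_apply hy) (η ∘L coframe x y)
  rw [ContinuousLinearMap.comp_assoc, coframe_frame hy] at h
  exact congrArg Real.sqrt h.symm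

lemma formSq_liftCoord {k : ℕ} {b : M → Bil n} {x : M} {y : Eu n}
    (hy : y ∈ (extChartAt (𝓡 n) x).target) (hb : IsInner (b ((extChartAt (𝓡 n) x).symm y)))
    (Λ : Cotangent n M → KForm n k) (η : Eu n →L[ℝ] ℝ) :
    formSq (bilCoord b x y) (liftCoord Λ x (y, η)) =
      formSq (b ((extChartAt (𝓡 n) x).symm y)) (Λ (cotCoord x (y, η))) :=
  formSq_comp hb (frame_coframe_apply hy) _

lemma continuousOn_coNorm_cotCoord (g : Metric n M) (x : M) :
    ContinuousOn (fun q : Eu n × (Eu n →L[ℝ] ℝ) => coNorm g (cotCoord x q))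
      ((extChartAt (𝓡 n) x).target ×ˢ univ) := by
  have h1 : ContinuousOn (fun q : Eu n × (Eu n →L[ℝ] ℝ) =>
      coSq (bilCoord (metricAt g) x q.1) q.2) ((extChartAt (𝓡 n) x).target ×ˢ univ) :=
    continuousOn_coSq ((contDiffOn_bilCoord_metric g x).continuousOn.comp continuousOn_fst
      fun q hq => hq.1) (fun q hq => isInner_bilCoord hq.1 (isInner_metricAt g _)) continuousOn_snd
  exact (Real.continuous_sqrt.comp_continuousOn h1).congr fun q hq => coNorm_cotCoord g hq.1 q.2

lemma abs_covec_le (g : Metric n M) (z : M) (ξ : Eu n →L[ℝ] ℝ) (v : Eu n) :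
    |ξ v| ≤ coNorm g (mkCot z ξ) * vecNorm (metricAt g z) v :=
  (isInner_metricAt g z).abs_covector_le ξ v

/-- Coordinate bound for covectors of the unit coball. It confines the fibres over a compact set to
a fixed ball, which gives both compactness of the sphere and finiteness of the volume. -/
lemma norm_le_of_coNorm_le (g : Metric n M) {x : M} {y : Eu n}
    (hy : y ∈ (extChartAt (𝓡 n) x).target) {D : ℝ} (hD : 0 ≤ D)
    (hcomp : ∀ v, vecNorm (metricAt g ((extChartAt (𝓡 n) x).symm y)) (frame x y v) ≤ D * ‖v‖)
    {η : Eu n →L[ℝ] ℝ} (hη : coNorm g (cotCoord x (y, η)) ≤ 1) : ‖η‖ ≤ D := by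
  refine ContinuousLinearMap.opNorm_le_bound _ hD fun v => ?_
  have h := abs_covec_le g ((extChartAt (𝓡 n) x).symm y) (η ∘L coframe x y) (frame x y v)
  rw [ContinuousLinearMap.comp_apply, coframe_frame_apply hy] at h
  calc |η v| ≤ _ := h
    _ ≤ 1 * (D * ‖v‖) := mul_le_mul hη (hcomp v) (vecNorm_nonneg _ _) zero_le_one
    _ = _ := one_mul _

/-- The part of `[a, b] × S*M` over a compact subset of a chart is compact. -/
lemma isCompact_sphere_part (g : Metric n M) (a b : ℝ) (x : M) {K : Set (Eu n)} (hK : IsCompact K)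
    (hKt : K ⊆ (extChartAt (𝓡 n) x).target) :
    IsCompact {r : ℝ × (Eu n × (Eu n →L[ℝ] ℝ)) |
      r.1 ∈ Icc a b ∧ r.2.1 ∈ K ∧ coNorm g (cotCoord x r.2) = 1} := by
  obtain ⟨D, hD, hcomp⟩ := exists_norm_compare g x hK hKt
  have hS : IsCompact (Icc a b ×ˢ (K ×ˢ Metric.closedBall (0 : Eu n →L[ℝ] ℝ) D)) :=
    isCompact_Icc.prod (hK.prod (isCompact_closedBall _ _))
  have hcont : ContinuousOn (fun r : ℝ × (Eu n × (Eu n →L[ℝ] ℝ)) => coNorm g (cotCoord x r.2))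
      (Icc a b ×ˢ (K ×ˢ Metric.closedBall (0 : Eu n →L[ℝ] ℝ) D)) :=
    (continuousOn_coNorm_cotCoord g x).comp continuousOn_snd
      fun r hr => ⟨hKt hr.2.1, mem_univ _⟩
  -- The conorm is known to be continuous only over the chart, so closedness is obtained inside the
  -- compact box.
  have hcl := hcont.preimage_isClosed_of_isClosed hS.isClosed (isClosed_singleton (x := (1 : ℝ)))
  convert! hS.of_isClosed_subset hcl inter_subset_left using 1
  ext ⟨t, y, η⟩
  constructor
  · rintro ⟨ht, hy, hη⟩
    refine ⟨⟨ht, hy, ?_⟩, hη⟩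
    exact mem_closedBall_zero_iff.2
      (norm_le_of_coNorm_le g (hKt hy) hD.le (fun v => (hcomp y hy v).2) (le_of_eq hη))
  · rintro ⟨⟨ht, hy, -⟩, hη⟩
    exact ⟨ht, hy, hη⟩

variable {k : ℕ}

/-- The form `lam` on `T_zM` has comass at most `c`. -/
def IsFormBound (g : Metric n M) (z : M) (lam : KForm n k) (c : ℝ) : Prop :=
  ∀ v, ‖lam v‖ ≤ c * ∏ i, vecNorm (metricAt g z) (v i)

lemma IsFormBound.mono {g : Metric n M} {z : M} {lam : KForm n k} {c c' : ℝ}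
    (h : IsFormBound g z lam c) (hc : c ≤ c') : IsFormBound g z lam c' := fun v =>
  (h v).trans (mul_le_mul_of_nonneg_right hc (Finset.prod_nonneg fun _ _ => vecNorm_nonneg _ _))

lemma norm_compContinuousLinearMap_frame_le {g : Metric n M} {x : M} {y : Eu n} {D : ℝ}
    (hD : 0 ≤ D)
    (hcomp : ∀ v, vecNorm (metricAt g ((extChartAt (𝓡 n) x).symm y)) (frame x y v) ≤ D * ‖v‖)
    {lam : KForm n k} {c : ℝ} (hc : 0 ≤ c)
    (h : IsFormBound g ((extChartAt (𝓡 n) x).symm y) lam c) :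
    ‖lam.compContinuousLinearMap (frame x y)‖ ≤ c * D ^ k := by
  refine ContinuousAlternatingMap.opNorm_le_bound _ (by positivity) fun v => ?_
  refine (h _).trans ?_
  rw [mul_assoc]
  gcongr
  calc _ ≤ ∏ i, D * ‖v i‖ :=
        Finset.prod_le_prod (fun _ _ => vecNorm_nonneg _ _) fun i _ => hcomp (v i)
    _ = _ := by simp [Finset.prod_mul_distrib]

lemma isFormBound_of_norm_le {g : Metric n M} {x : M} {y : Eu n}
    (hy : y ∈ (extChartAt (𝓡 n) x).target) {D : ℝ}
    (hcomp : ∀ v, ‖v‖ ≤ D * vecNorm (metricAt g ((extChartAt (𝓡 n) x).symm y)) (frame x y v))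
    {lam : KForm n k} {B : ℝ} (h : ‖lam.compContinuousLinearMap (frame x y)‖ ≤ B) :
    IsFormBound g ((extChartAt (𝓡 n) x).symm y) lam (B * D ^ k) := by
  intro v
  have h1 := (lam.compContinuousLinearMap (frame x y)).le_opNorm fun i => coframe x y (v i)
  have h2 : (lam.compContinuousLinearMap (frame x y)) (fun i => coframe x y (v i)) = lam v := by
    simp [Function.comp_def, frame_coframe_apply hy]
  rw [h2] at h1
  refine h1.trans ?_
  have hB : 0 ≤ B := (norm_nonneg _).trans h
  rw [mul_assoc]
  have h3 : ∏ i, ‖coframe x y (v i)‖ ≤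
      D ^ k * ∏ i, vecNorm (metricAt g ((extChartAt (𝓡 n) x).symm y)) (v i) := by
    calc _ ≤ ∏ i, D * vecNorm (metricAt g ((extChartAt (𝓡 n) x).symm y)) (v i) := by
          refine Finset.prod_le_prod (fun _ _ => norm_nonneg _) fun i _ => ?_
          have := hcomp (coframe x y (v i))
          rwa [frame_coframe_apply hy] at this
      _ = _ := by simp [Finset.prod_mul_distrib]
  exact mul_le_mul h h3 (Finset.prod_nonneg fun _ _ => norm_nonneg _) hB

/-- The forcing is bounded. -/
lemma exists_isFormBound_forcing [CompactSpace M] (g : Metric n M) {t₀ T : ℝ}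
    {F : ℝ → Cotangent n M → KForm n k} (hF : IsContinuousLift g t₀ T F) :
    ∃ D, 0 ≤ D ∧ ∀ z, ∀ t ∈ Icc t₀ T, ∀ ξ, coNorm g (mkCot z ξ) = 1 →
      IsFormBound g z (F t (mkCot z ξ)) D := by
  refine exists_uniform_bound (n := n) (fun z D => ∀ t ∈ Icc t₀ T, ∀ ξ, coNorm g (mkCot z ξ) = 1 →
      IsFormBound g z (F t (mkCot z ξ)) D)
    (fun z C C' hC h t ht ξ hξ => (h t ht ξ hξ).mono hC) fun x K hK hKt => ?_
  obtain ⟨D, hD, hcomp⟩ := exists_norm_compare g x hK hKt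
  obtain ⟨B, hB⟩ := (isCompact_sphere_part g t₀ T x hK hKt).exists_bound_of_continuousOn
    ((hF x).mono fun r hr => ⟨hr.1, hKt hr.2.1, hr.2.2⟩)
  refine ⟨B * D ^ k, fun y hy t ht ξ hξ => ?_⟩
  rw [← mkCot_eq_cotCoord (hKt hy)] at hξ ⊢
  exact isFormBound_of_norm_le (hKt hy) (fun v => (hcomp y hy v).1)
    (hB (t, (y, ξ ∘L frame x y)) ⟨ht, hy, hξ⟩)

end Charts

/-- A family of bilinear maps on finite dimensional spaces, depending continuously on a parameter in
a compact set, is bounded. -/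
lemma exists_bilinear_bound {X V W Z : Type*} [TopologicalSpace X] {S : Set X} (hS : IsCompact S)
    [NormedAddCommGroup V] [NormedSpace ℝ V] [FiniteDimensional ℝ V]
    [NormedAddCommGroup W] [NormedSpace ℝ W] [FiniteDimensional ℝ W]
    [NormedAddCommGroup Z] [NormedSpace ℝ Z] {f : X → V →ₗ[ℝ] W →ₗ[ℝ] Z}
    (hf : ∀ v w, ContinuousOn (fun x => f x v w) S) :
    ∃ B, 0 ≤ B ∧ ∀ x ∈ S, ∀ v w, ‖f x v w‖ ≤ B * ‖v‖ * ‖w‖ := by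
  let bV := Module.finBasis ℝ V
  let bW := Module.finBasis ℝ W
  choose C hC using fun i j => hS.exists_bound_of_continuousOn (hf (bV i) (bW j))
  let cV := fun i => ‖LinearMap.toContinuousLinearMap (bV.coord i)‖
  let cW := fun j => ‖LinearMap.toContinuousLinearMap (bW.coord j)‖
  -- Only the values on pairs of basis vectors need bounds; `cV` and `cW` are the norms of the
  -- coordinate functionals.
  refine ⟨∑ i, ∑ j, cV i * cW j * |C i j|, Finset.sum_nonneg fun i _ =>
    Finset.sum_nonneg fun j _ => by positivity, fun x hx v w => ?_⟩
  have h1 : f x v w = ∑ i, ∑ j, (bV.coord i v * bW.coord j w) • f x (bV i) (bW j) := by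
    conv_lhs => rw [← bV.sum_repr v, ← bW.sum_repr w]
    simp only [map_sum, map_smul, LinearMap.sum_apply, LinearMap.smul_apply, Finset.smul_sum,
      smul_smul, Module.Basis.coord_apply]
    rw [Finset.sum_comm]
    exact Finset.sum_congr rfl fun i _ => Finset.sum_congr rfl fun j _ => by rw [mul_comm]
  rw [h1, Finset.sum_mul, Finset.sum_mul]
  refine (norm_sum_le _ _).trans (Finset.sum_le_sum fun i _ => ?_)
  rw [Finset.sum_mul, Finset.sum_mul]
  refine (norm_sum_le _ _).trans (Finset.sum_le_sum fun j _ => ?_)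
  rw [norm_smul, norm_mul]
  have e1 : ‖bV.coord i v‖ ≤ cV i * ‖v‖ :=
    (LinearMap.toContinuousLinearMap (bV.coord i)).le_opNorm v
  have e2 : ‖bW.coord j w‖ ≤ cW j * ‖w‖ :=
    (LinearMap.toContinuousLinearMap (bW.coord j)).le_opNorm w
  have e3 : ‖f x (bV i) (bW j)‖ ≤ |C i j| := (hC i j x hx).trans (le_abs_self _)
  calc _ ≤ (cV i * ‖v‖) * (cW j * ‖w‖) * |C i j| := by gcongr
    _ = _ := by ring

instance (n k : ℕ) : FiniteDimensional ℝ (KForm n k) :=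
  Module.Finite.of_injective
    (ContinuousMultilinearMap.toMultilinearMapLinear ∘ₗ
      (ContinuousAlternatingMap.toContinuousMultilinearMapLinear (R := ℝ) (A := ℝ) (M := Eu n)
        (N := ℂ) (ι := Fin k)))
    (ContinuousMultilinearMap.toMultilinearMap_injective.comp
      ContinuousAlternatingMap.toContinuousMultilinearMap_injective)

/-! ### Bounds on the zeroth order operators -/

section Charts

variable {n : ℕ} {M : Type*} [TopologicalSpace M] [ChartedSpace (Eu n) M]
  [IsManifold (𝓡 n) ∞ M] {k : ℕ}

/-- Zeroth order operators with continuous coefficients are bounded. Here `size z w r` says that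
the tensor `w` on `T_zM` is bounded by `r`. -/
lemma exists_operator_bound [CompactSpace M] {W : Type*} [NormedAddCommGroup W] [NormedSpace ℝ W]
    [FiniteDimensional ℝ W] {push : M → Eu n → W → W} (hlin : ∀ x y, IsLinearMap ℝ (push x y))
    (g : Metric n M) {t₀ T : ℝ} {K : ℝ → Cotangent n M → W →ₗ[ℝ] KForm n k →ₗ[ℝ] KForm n k}
    (hK : IsContinuousCoeff push g t₀ T K) {size : M → W → ℝ → Prop}
    (hsize : ∀ (x : M) (S : Set (Eu n)), IsCompact S → S ⊆ (extChartAt (𝓡 n) x).target →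
      ∃ D, 0 ≤ D ∧ ∀ y ∈ S, ∀ w r, 0 ≤ r → size ((extChartAt (𝓡 n) x).symm y) w r →
        ∃ w', push x y w' = w ∧ ‖w'‖ ≤ D * r) :
    ∃ D, 0 ≤ D ∧ ∀ z, ∀ t ∈ Icc t₀ T, ∀ ξ, coNorm g (mkCot z ξ) = 1 → ∀ w r lam c, 0 ≤ r → 0 ≤ c →
      size z w r → IsFormBound g z lam c →
        IsFormBound g z (K t (mkCot z ξ) w lam) (D * r * c) := by
  refine exists_uniform_bound (n := n) (fun z D => ∀ t ∈ Icc t₀ T, ∀ ξ, coNorm g (mkCot z ξ) = 1 →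
      ∀ w r lam c, 0 ≤ r → 0 ≤ c → size z w r → IsFormBound g z lam c →
        IsFormBound g z (K t (mkCot z ξ) w lam) (D * r * c))
    (fun z C C' hC h t ht ξ hξ w r lam c hr hc hw hlam =>
      (h t ht ξ hξ w r lam c hr hc hw hlam).mono (by gcongr)) fun x S hS hSt => ?_
  obtain ⟨D, hD, hcomp⟩ := exists_norm_compare g x hS hSt
  obtain ⟨D', hD', hpull⟩ := hsize x S hS hSt
  obtain ⟨B, hB0, hB⟩ := exists_bilinear_bound (isCompact_sphere_part g t₀ T x hS hSt)
    (f := fun r : ℝ × (Eu n × (Eu n →L[ℝ] ℝ)) =>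
      ((K r.1 (cotCoord x r.2)).compl₁₂ ((hlin x r.2.1).mk' _)
        (ContinuousAlternatingMap.compContinuousLinearMapₗ (coframe x r.2.1))).compr₂
        (ContinuousAlternatingMap.compContinuousLinearMapₗ (frame x r.2.1)))
    (fun w lam => (hK x w lam).mono fun r hr => ⟨hr.1, hSt hr.2.1, hr.2.2⟩)
  -- `B` bounds the coefficients in coordinates and `D'` the components of the tensor. One factor `D
  -- ^ k` is the cost of passing from comass to coordinate norm, the other that of passing back.
  refine ⟨B * D' * D ^ k * D ^ k, fun y hy t ht ξ hξ w r lam c hr hc hw hlam => ?_⟩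
  obtain ⟨w', rfl, hw'⟩ := hpull y hy w r hr hw
  rw [← mkCot_eq_cotCoord (hSt hy)] at hξ ⊢
  have h1 := hB (t, (y, ξ ∘L frame x y)) ⟨ht, hy, hξ⟩ w' (lam.compContinuousLinearMap (frame x y))
  have h2 : (lam.compContinuousLinearMap (frame x y)).compContinuousLinearMap (coframe x y) =
      lam := by
    ext v
    simp [Function.comp_def, frame_coframe_apply (hSt hy)]
  have h3 : ‖(K t (cotCoord x (y, ξ ∘L frame x y)) (push x y w')
      lam).compContinuousLinearMap (frame x y)‖ ≤
      B * ‖w'‖ * ‖lam.compContinuousLinearMap (frame x y)‖ := by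
    have h4 := h1
    simp only [LinearMap.compr₂_apply, LinearMap.compl₁₂_apply,
      ContinuousAlternatingMap.compContinuousLinearMapₗ_apply, IsLinearMap.mk'_apply, h2] at h4
    exact h4
  have h5 := norm_compContinuousLinearMap_frame_le hD.le (fun v => (hcomp y hy v).2) hc hlam
  refine isFormBound_of_norm_le (hSt hy) (fun v => (hcomp y hy v).1)
    (B := B * (D' * r) * (c * D ^ k)) (h3.trans (by gcongr)) |>.mono (le_of_eq ?_)
  ring

lemma isLinearMap_pushEndo (x : M) (y : Eu n) : IsLinearMap ℝ (pushEndo x y) where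
  map_add A B := by ext v; simp [pushEndo]
  map_smul c A := by ext v; simp [pushEndo]

lemma pushCurv_apply (x : M) (y : Eu n) (R : Curv n) (v w z : Eu n) : pushCurv x y R v w z =
    frame x y (R (coframe x y v) (coframe x y w) (coframe x y z)) := by
  simp [pushCurv]

lemma isLinearMap_pushCurv (x : M) (y : Eu n) : IsLinearMap ℝ (pushCurv x y) where
  map_add A B := by ext v w z : 3; simp [pushCurv_apply]
  map_smul c A := by ext v w z : 3; simp [pushCurv_apply]

/-- An operator linear in an endomorphism is bounded. -/
lemma exists_endo_operator_bound [CompactSpace M] (g : Metric n M) {t₀ T : ℝ}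
    {N : ℝ → Cotangent n M → Endo n →ₗ[ℝ] KForm n k →ₗ[ℝ] KForm n k}
    (hN : IsContinuousCoeff pushEndo g t₀ T N) :
    ∃ D, 0 ≤ D ∧ ∀ z, ∀ t ∈ Icc t₀ T, ∀ ξ, coNorm g (mkCot z ξ) = 1 → ∀ (A : Endo n) r lam c,
      0 ≤ r → 0 ≤ c → (∀ v, vecNorm (metricAt g z) (A v) ≤ r * vecNorm (metricAt g z) v) →
        IsFormBound g z lam c → IsFormBound g z (N t (mkCot z ξ) A lam) (D * r * c) := by
  refine exists_operator_bound isLinearMap_pushEndo g hN (size := fun z A r =>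
    ∀ v, vecNorm (metricAt g z) (A v) ≤ r * vecNorm (metricAt g z) v) fun x S hS hSt => ?_
  obtain ⟨D, hD, hcomp⟩ := exists_norm_compare g x hS hSt
  refine ⟨D * D, by positivity, fun y hy A r hr hA => ⟨coframe x y ∘L A ∘L frame x y, ?_, ?_⟩⟩
  · ext1 v
    simp [pushEndo, frame_coframe_apply (hSt hy)]
  · refine ContinuousLinearMap.opNorm_le_bound _ (by positivity) fun v => ?_
    have h1 := (hcomp y hy (coframe x y (A (frame x y v)))).1
    rw [frame_coframe_apply (hSt hy)] at h1
    calc _ ≤ _ := h1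
      _ ≤ D * (r * (D * ‖v‖)) := by
        gcongr
        exact (hA _).trans (by gcongr; exact (hcomp y hy v).2)
      _ = _ := by ring

/-- An operator linear in a curvature type tensor is bounded. -/
lemma exists_curv_operator_bound [CompactSpace M] (g : Metric n M) {t₀ T : ℝ}
    {K : ℝ → Cotangent n M → Curv n →ₗ[ℝ] KForm n k →ₗ[ℝ] KForm n k}
    (hK : IsContinuousCoeff pushCurv g t₀ T K) :
    ∃ D, 0 ≤ D ∧ ∀ z, ∀ t ∈ Icc t₀ T, ∀ ξ, coNorm g (mkCot z ξ) = 1 → ∀ (R : Curv n) r lam c,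
      0 ≤ r → 0 ≤ c → (∀ v w a, vecNorm (metricAt g z) (R v w a) ≤
        r * vecNorm (metricAt g z) v * vecNorm (metricAt g z) w * vecNorm (metricAt g z) a) →
        IsFormBound g z lam c → IsFormBound g z (K t (mkCot z ξ) R lam) (D * r * c) := by
  refine exists_operator_bound isLinearMap_pushCurv g hK (size := fun z R r =>
    ∀ v w a, vecNorm (metricAt g z) (R v w a) ≤
      r * vecNorm (metricAt g z) v * vecNorm (metricAt g z) w * vecNorm (metricAt g z) a)
    fun x S hS hSt => ?_
  obtain ⟨D, hD, hcomp⟩ := exists_norm_compare g x hS hSt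
  -- One factor for each of the three arguments and one for the value.
  refine ⟨D * D * D * D, by positivity, fun y hy R r hr hR => ?_⟩
  let conj : Endo n →L[ℝ] Endo n :=
    (ContinuousLinearMap.compL ℝ (Eu n) (Eu n) (Eu n) (coframe x y)) ∘L
      ((ContinuousLinearMap.compL ℝ (Eu n) (Eu n) (Eu n)).flip (frame x y))
  let R' : Curv n := (ContinuousLinearMap.compL ℝ (Eu n) (Endo n) (Endo n) conj) ∘L
    (R.bilinearComp (frame x y) (frame x y))
  have hR' : ∀ v w a, R' v w a = coframe x y (R (frame x y v) (frame x y w) (frame x y a)) :=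
    fun v w a => by simp [R', conj]
  refine ⟨R', ?_, ?_⟩
  · ext v w a : 3
    simp [pushCurv_apply, hR', frame_coframe_apply (hSt hy)]
  · refine ContinuousLinearMap.opNorm_le_bound _ (by positivity) fun v => ?_
    refine ContinuousLinearMap.opNorm_le_bound _ (by positivity) fun w => ?_
    refine ContinuousLinearMap.opNorm_le_bound _ (by positivity) fun a => ?_
    have h1 := (hcomp y hy (R' v w a)).1
    rw [hR', frame_coframe_apply (hSt hy), ← hR'] at h1
    have hn := vecNorm_nonneg (metricAt g ((extChartAt (𝓡 n) x).symm y))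
    have hf := fun v => (hcomp y hy v).2
    calc _ ≤ _ := h1
      _ ≤ D * (r * (D * ‖v‖) * (D * ‖w‖) * (D * ‖a‖)) := by
        gcongr
        refine (hR _ _ _).trans ?_
        have := hn (frame x y v)
        have := hn (frame x y w)
        gcongr
        · exact hn _
        · exact hf v
        · exact hf w
        · exact hf a
      _ = _ := by ring

end Charts

/-! ### Existence of maxima over time, covectors and vectors -/

section Charts

variable {n : ℕ} {M : Type*} [TopologicalSpace M] [ChartedSpace (Eu n) M]
  [IsManifold (𝓡 n) ∞ M]

variable {k : ℕ}

lemma continuous_uncurry_form :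
    Continuous (fun p : KForm n k × (Fin k → Eu n) => p.1 p.2) := by
  refine continuous_iff_continuousAt.2 fun p => ?_
  have h := HasFDerivAt.continuousAlternatingMap_apply (𝕜 := ℝ) (x := p)
    (f := fun p : KForm n k × (Fin k → Eu n) => p.1) hasFDerivAt_fst
    (g := fun i p => p.2 i) (fun i => ((ContinuousLinearMap.proj (R := ℝ) i).comp
      (ContinuousLinearMap.snd ℝ (KForm n k) (Fin k → Eu n))).hasFDerivAt)
  exact h.continuousAt

/-- A function on a space over a compact manifold attains its maximum if it does so locally. -/
lemma exists_max_of_charts [CompactSpace M] {X : Type*} {Dom : Set X} (hne : Dom.Nonempty)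
    (π : X → M) (ψ : X → ℝ)
    (h : ∀ x : M, ∃ U ∈ 𝓝 x, ∃ p ∈ Dom, ∀ q ∈ Dom, π q ∈ U → ψ q ≤ ψ p) :
    ∃ p ∈ Dom, ∀ q ∈ Dom, ψ q ≤ ψ p := by
  choose U hU p hp hmax using h
  obtain ⟨t, ht⟩ := CompactSpace.elim_nhds_subcover U hU
  have hmem : ∀ z, ∃ x ∈ t, z ∈ U x := fun z => by
    have hz : z ∈ ⋃ x ∈ t, U x := ht ▸ mem_univ z
    simpa using hz
  obtain ⟨q₀, hq₀⟩ := hne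
  have htne : t.Nonempty := let ⟨x, hx, _⟩ := hmem (π q₀); ⟨x, hx⟩
  obtain ⟨x, hx, hxm⟩ := t.exists_max_image (fun x => ψ (p x)) htne
  refine ⟨p x, hp x, fun q hq => ?_⟩
  obtain ⟨x', hx', hq'⟩ := hmem (π q)
  exact (hmax x' q hq hq').trans (hxm x' hx')

lemma ne_zero_of_coNorm_eq_one {g : Metric n M} {z : M} {ξ : Eu n →L[ℝ] ℝ}
    (h : coNorm g (mkCot z ξ) = 1) : ξ ≠ 0 := by
  rintro rfl
  have : coNorm g (mkCot z (0 : Eu n →L[ℝ] ℝ)) = 0 := by simp [coNorm, coSq, covec, mkCot]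
  rw [this] at h
  exact zero_ne_one h

lemma coNorm_pos (g : Metric n M) (z : M) {ξ : Eu n →L[ℝ] ℝ} (hξ : ξ ≠ 0) :
    0 < coNorm g (mkCot z ξ) := by
  refine lt_of_le_of_ne (Real.sqrt_nonneg _) fun h => hξ ?_
  ext v
  have h1 := abs_covec_le g z ξ v
  rw [← h, zero_mul] at h1
  simpa using abs_nonpos_iff.1 h1

lemma coNorm_smul (g : Metric n M) (z : M) (ξ : Eu n →L[ℝ] ℝ) {r : ℝ} (hr : 0 ≤ r) :
    coNorm g (mkCot z (r • ξ)) = r * coNorm g (mkCot z ξ) := by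
  have h : coSq (metricAt g z) (r • ξ) = r ^ 2 * coSq (metricAt g z) ξ := by
    simp only [coSq, Finset.mul_sum, _root_.smul_apply, smul_eq_mul]
    exact Finset.sum_congr rfl fun i _ => Finset.sum_congr rfl fun j _ => by ring
  change Real.sqrt (coSq (metricAt g z) (r • ξ)) = r * Real.sqrt (coSq (metricAt g z) ξ)
  rw [h, Real.sqrt_mul (sq_nonneg r), Real.sqrt_sq hr]

lemma cotCoord_ne_zero {x : M} {y : Eu n} (hy : y ∈ (extChartAt (𝓡 n) x).target)
    {η : Eu n →L[ℝ] ℝ} (hη : η ≠ 0) : η ∘L coframe x y ≠ 0 := fun h => hη <| by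
  rw [← ContinuousLinearMap.comp_id η, ← coframe_frame hy, ← ContinuousLinearMap.comp_assoc, h,
    ContinuousLinearMap.zero_comp]

/-- The points at which the maximum of a time dependent microlocal form is sought. -/
def testDomain (g : Metric n M) (k : ℕ) (t₀ t₁ : ℝ) :
    Set (ℝ × (Cotangent n M × (Fin k → Eu n))) :=
  {r | r.1 ∈ Icc t₀ t₁ ∧ coNorm g r.2.1 = 1 ∧
    ∀ i, vecNorm (metricAt g r.2.1.proj) (r.2.2 i) ≤ 1}

/-- Over a compact piece of a chart the admissible points form a compact set, on which the solution
is continuous because `t₁ < T`. The function `θ` leaves room for the exponential weight. -/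
lemma exists_max_form [CompactSpace M] (g : Metric n M) {t₀ T t₁ : ℝ} (ht₁ : t₁ < T)
    {Λ : ℝ → Cotangent n M → KForm n k} (hΛ : IsC1Lift t₀ T Λ)
    (hne : (testDomain g k t₀ t₁).Nonempty) {θ : ℝ → ℝ → ℝ}
    (hθ : Continuous (fun p : ℝ × ℝ => θ p.1 p.2)) :
    ∃ p ∈ testDomain g k t₀ t₁, ∀ q ∈ testDomain g k t₀ t₁,
      θ q.1 ‖Λ q.1 q.2.1 q.2.2‖ ≤ θ p.1 ‖Λ p.1 p.2.1 p.2.2‖ := by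
  refine exists_max_of_charts hne (fun q => q.2.1.proj)
    (fun q => θ q.1 ‖Λ q.1 q.2.1 q.2.2‖) fun x => ?_
  obtain ⟨K, hK, hKt, hKc⟩ := local_compact_nhds (extChartAt_target_mem_nhds (I := 𝓡 n) x)
  refine ⟨(extChartAt (𝓡 n) x).source ∩ extChartAt (𝓡 n) x ⁻¹' K,
    Filter.inter_mem (extChartAt_source_mem_nhds x) ((continuousAt_extChartAt (I := 𝓡 n) x) hK), ?_⟩
  obtain ⟨D, hD, hcomp⟩ := exists_norm_compare g x hKc hKt
  set S := {r : ℝ × (Eu n × (Eu n →L[ℝ] ℝ)) |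
    r.1 ∈ Icc t₀ t₁ ∧ r.2.1 ∈ K ∧ coNorm g (cotCoord x r.2) = 1} with hSdef
  have hS : IsCompact S := isCompact_sphere_part g t₀ t₁ x hKc hKt
  have hSB : IsCompact (S ×ˢ Metric.closedBall (0 : Fin k → Eu n) D) :=
    hS.prod (isCompact_closedBall _ _)
  have hcont : ContinuousOn (fun r : (ℝ × (Eu n × (Eu n →L[ℝ] ℝ))) × (Fin k → Eu n) =>
      fun i => vecNorm (bilCoord (metricAt g) x r.1.2.1) (r.2 i))
      (S ×ˢ Metric.closedBall (0 : Fin k → Eu n) D) := by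
    refine continuousOn_pi.2 fun i => Real.continuous_sqrt.comp_continuousOn ?_
    have h1 : ContinuousOn (fun r : (ℝ × (Eu n × (Eu n →L[ℝ] ℝ))) × (Fin k → Eu n) =>
        bilCoord (metricAt g) x r.1.2.1) (S ×ˢ Metric.closedBall (0 : Fin k → Eu n) D) :=
      (contDiffOn_bilCoord_metric g x).continuousOn.comp (by fun_prop)
        fun r hr => hKt hr.1.2.1
    have h2 : ContinuousOn (fun r : (ℝ × (Eu n × (Eu n →L[ℝ] ℝ))) × (Fin k → Eu n) => r.2 i)
        (S ×ˢ Metric.closedBall (0 : Fin k → Eu n) D) := by fun_prop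
    exact (h1.clm_apply h2).clm_apply h2
  have hC : IsCompact (S ×ˢ Metric.closedBall (0 : Fin k → Eu n) D ∩
      (fun r : (ℝ × (Eu n × (Eu n →L[ℝ] ℝ))) × (Fin k → Eu n) =>
        fun i => vecNorm (bilCoord (metricAt g) x r.1.2.1) (r.2 i)) ⁻¹' (Iic 1)) :=
    hSB.of_isClosed_subset (hcont.preimage_isClosed_of_isClosed hSB.isClosed isClosed_Iic)
      inter_subset_left
  set C := S ×ˢ Metric.closedBall (0 : Fin k → Eu n) D ∩
      (fun r : (ℝ × (Eu n × (Eu n →L[ℝ] ℝ))) × (Fin k → Eu n) =>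
        fun i => vecNorm (bilCoord (metricAt g) x r.1.2.1) (r.2 i)) ⁻¹' (Iic 1) with hCdef
  let Φ : (ℝ × (Eu n × (Eu n →L[ℝ] ℝ))) × (Fin k → Eu n) →
      ℝ × (Cotangent n M × (Fin k → Eu n)) := fun r =>
    (r.1.1, (cotCoord x r.1.2, fun i => frame x r.1.2.1 (r.2 i)))
  have hvec : ∀ y v, vecNorm (bilCoord (metricAt g) x y) v =
      vecNorm (metricAt g ((extChartAt (𝓡 n) x).symm y)) (frame x y v) := fun y v => by
    rw [vecNorm, vecNorm, bilCoord_apply]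
  have hΦ : ∀ r ∈ C, Φ r ∈ testDomain g k t₀ t₁ := by
    rintro r ⟨⟨⟨h1, h2, h3⟩, -⟩, h4⟩
    exact ⟨h1, h3, fun i => by
      have : vecNorm (bilCoord (metricAt g) x r.1.2.1) (r.2 i) ≤ 1 := h4 i
      rw [hvec] at this
      exact this⟩
  have hsurj : ∀ q ∈ testDomain g k t₀ t₁, q.2.1.proj ∈
      (extChartAt (𝓡 n) x).source ∩ extChartAt (𝓡 n) x ⁻¹' K → ∃ r ∈ C, Φ r = q := by
    rintro ⟨t, p, v⟩ ⟨h1, h2, h3⟩ ⟨h4, h5⟩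
    have hp := exists_cotCoord x p h4
    set y := extChartAt (𝓡 n) x p.proj with hy
    have hyt : y ∈ (extChartAt (𝓡 n) x).target := hKt h5
    have hz : (extChartAt (𝓡 n) x).symm y = p.proj := (extChartAt (𝓡 n) x).left_inv h4
    have hle : ∀ i, vecNorm (bilCoord (metricAt g) x y) (coframe x y (v i)) ≤ 1 := fun i => by
      rw [hvec, frame_coframe_apply hyt, hz]
      exact h3 i
    refine ⟨((t, (y, covec p ∘L frame x y)), fun i => coframe x y (v i)),
      ⟨⟨⟨h1, h5, (congrArg (coNorm g) hp).trans h2⟩, ?_⟩, fun i => hle i⟩, ?_⟩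
    · rw [mem_closedBall_zero_iff, pi_norm_le_iff_of_nonneg hD.le]
      intro i
      refine (hcomp y h5 _).1.trans ?_
      have := hle i
      rw [hvec] at this
      exact mul_le_of_le_one_right hD.le this
    · simp only [Φ, hp, frame_coframe_apply hyt]
  have hψ : ContinuousOn (fun r => θ (Φ r).1 ‖Λ (Φ r).1 (Φ r).2.1 (Φ r).2.2‖) C := by
    have h1 : ContinuousOn (fun r : (ℝ × (Eu n × (Eu n →L[ℝ] ℝ))) × (Fin k → Eu n) =>
        liftCoord (Λ r.1.1) x r.1.2) C := by
      refine (hΛ x).continuousOn.comp (f := fun r : (ℝ × (Eu n × (Eu n →L[ℝ] ℝ))) ×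
        (Fin k → Eu n) => r.1) (by fun_prop) ?_
      rintro r ⟨⟨⟨h1, h2, h3⟩, -⟩, -⟩
      refine ⟨⟨h1.1, h1.2.trans_lt ht₁⟩, hKt h2, fun h0 => ?_⟩
      refine ne_zero_of_coNorm_eq_one (g := g) (z := (extChartAt (𝓡 n) x).symm r.1.2.1)
        (ξ := r.1.2.2 ∘L coframe x r.1.2.1) h3 ?_
      rw [mem_singleton_iff.1 h0, ContinuousLinearMap.zero_comp]
    have h2 : ContinuousOn (fun r : (ℝ × (Eu n × (Eu n →L[ℝ] ℝ))) × (Fin k → Eu n) =>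
        ‖liftCoord (Λ r.1.1) x r.1.2 r.2‖) C :=
      (continuous_uncurry_form.comp_continuousOn (h1.prodMk continuousOn_snd)).norm
    exact hθ.comp_continuousOn ((continuousOn_fst.fst).prodMk h2)
  -- If no admissible point lies over this neighbourhood, any admissible point serves as the local
  -- maximum.
  rcases C.eq_empty_or_nonempty with he | hCne
  · obtain ⟨p, hp⟩ := hne
    refine ⟨p, hp, fun q hq hqU => ?_⟩
    obtain ⟨r, hr, -⟩ := hsurj q hq hqU
    simp [he] at hr
  · obtain ⟨r, hr, hmax⟩ := hC.exists_isMaxOn hCne hψ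
    refine ⟨Φ r, hΦ r hr, fun q hq hqU => ?_⟩
    obtain ⟨r', hr', rfl⟩ := hsurj q hq hqU
    exact hmax hr'

end Charts

/-! ### The Lie derivative at a maximum -/

section Charts

variable {n : ℕ} {M : Type*} [TopologicalSpace M] [ChartedSpace (Eu n) M]
  [IsManifold (𝓡 n) ∞ M]


variable {k : ℕ}

open scoped RealInnerProductSpace

lemma liftCoord_self (Λ : Cotangent n M → KForm n k) (z : M) (ξ : Eu n →L[ℝ] ℝ) :
    liftCoord Λ z (extChartAt (𝓡 n) z z, ξ) = Λ (mkCot z ξ) := by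
  have h1 : cotCoord z (extChartAt (𝓡 n) z z, ξ) = mkCot z ξ := cotCoord_self (mkCot z ξ)
  change (Λ (cotCoord z (_, ξ))).compContinuousLinearMap (frame z _) = _
  rw [h1, frame_self]
  rfl

/-- Infinitesimal parallel transport preserves lengths. -/
lemma IsMetricNear.hasDerivAt_transport {G : Eu n → Bil n} {y : Eu n} (h : IsMetricNear G y)
    (U v : Eu n) : HasDerivAt (fun ε : ℝ => G (y + ε • U) (v - ε • christoffel G y U v)
      (v - ε • christoffel G y U v)) 0 0 := by
  set a := christoffel G y U v with ha
  have hw : HasDerivAt (fun ε : ℝ => v - ε • a) (-a) 0 := by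
    simpa using ((hasDerivAt_id (0 : ℝ)).smul_const a).const_sub v
  have hp : HasDerivAt (fun ε : ℝ => y + ε • U) U 0 := by
    simpa using ((hasDerivAt_id (0 : ℝ)).smul_const U).const_add y
  have h1 : HasDerivAt (fun ε : ℝ => G (y + ε • U)) (fderiv ℝ G y U) 0 := by
    have hd : HasFDerivAt G (fderiv ℝ G y) (y + (0 : ℝ) • U) := by
      rw [zero_smul, add_zero]
      exact h.diff.hasFDerivAt
    exact hd.comp_hasDerivAt 0 hp
  have h2 := (h1.clm_apply hw).clm_apply hw
  convert! h2 using 1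
  simp [h.fderiv_apply U v v, ← ha]

/-- At a maximum over `S*M` and over unit vectors, the Lie derivative only sees `∇u`. -/
lemma inner_lieDeriv_eq (g : Metric n M) (u : M → Eu n) {Λ : Cotangent n M → KForm n k} {z : M}
    {ξ : Eu n →L[ℝ] ℝ} (hξ : ξ ≠ 0)
    (hd : DifferentiableAt ℝ (liftCoord Λ z) (extChartAt (𝓡 n) z z, ξ)) {v : Fin k → Eu n}
    (hv : ∀ i, vecNorm (metricAt g z) (v i) ≤ 1)
    (hmax : ∀ z' ξ', ξ' ≠ 0 → IsFormBound g z' (Λ (mkCot z' ξ')) ‖Λ (mkCot z ξ) v‖) :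
    ⟪Λ (mkCot z ξ) v, lieDeriv u Λ (mkCot z ξ) v⟫ =
      ∑ i, ⟪Λ (mkCot z ξ) v, Λ (mkCot z ξ) (Function.update v i (grad g u z (v i)))⟫ := by
  set m := ‖Λ (mkCot z ξ) v‖ with hm
  set y := extChartAt (𝓡 n) z z with hy
  have hyt : y ∈ (extChartAt (𝓡 n) z).target := mem_extChartAt_target z
  set U := vecCoord u z y with hU
  set Du : Endo n := fderiv ℝ (vecCoord u z) y with hDu
  set Γ := leviCivita g z y with hΓ
  -- The curve `c` has velocity `X_u` in canonical coordinates, while `w` moves the vectors by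
  -- infinitesimal parallel transport along `U`.
  set c : ℝ → Eu n × (Eu n →L[ℝ] ℝ) := fun ε => (y + ε • U, ξ - ε • (ξ ∘L Du)) with hc
  set w : Fin k → ℝ → Eu n := fun i ε => v i - ε • Γ U (v i) with hw
  set G := bilCoord (metricAt g) z with hG
  have hnear : IsMetricNear G y := isMetricNear g hyt
  have hc0 : c 0 = (y, ξ) := by simp [hc]
  have hw0 : ∀ i, w i 0 = v i := fun i => by simp [hw]
  have hp1 : HasDerivAt (fun ε : ℝ => y + ε • U) U 0 := by
    simpa using ((hasDerivAt_id (0 : ℝ)).smul_const U).const_add y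
  have hp2 : HasDerivAt (fun ε : ℝ => ξ - ε • (ξ ∘L Du)) (-(ξ ∘L Du)) 0 := by
    simpa using ((hasDerivAt_id (0 : ℝ)).smul_const (ξ ∘L Du)).const_sub ξ
  have hcd : HasDerivAt c (U, -(ξ ∘L Du)) 0 := hp1.prodMk hp2
  have hwd : ∀ i, HasDerivAt (w i) (-Γ U (v i)) 0 := fun i => by
    simpa using ((hasDerivAt_id (0 : ℝ)).smul_const (Γ U (v i))).const_sub (v i)
  have hself := liftCoord_self Λ z ξ
  rw [← hy] at hself
  set X : ℂ := (fderiv ℝ (liftCoord Λ z) (y, ξ) (U, -(ξ ∘L Du))) v with hX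
  have hfd : HasDerivAt (fun ε => liftCoord Λ z (c ε) (fun i => w i ε))
      (X - ∑ i, Λ (mkCot z ξ) (Function.update v i (Γ U (v i)))) 0 := by
    have h1 : HasDerivAt (fun ε => liftCoord Λ z (c ε))
        (fderiv ℝ (liftCoord Λ z) (y, ξ) (U, -(ξ ∘L Du))) 0 := by
      have hd' := hd.hasFDerivAt
      rw [← hc0] at hd'
      rw [← hc0]
      exact hd'.comp_hasDerivAt 0 hcd
    have h2 := (h1.hasFDerivAt.continuousAlternatingMap_apply
      fun i => (hwd i).hasFDerivAt).hasDerivAt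
    convert! h2 using 1
    simp only [hc0, hw0, hself]
    have h3 : ∀ i, Λ (mkCot z ξ) (Function.update v i (-Γ U (v i))) =
        -Λ (mkCot z ξ) (Function.update v i (Γ U (v i))) := fun i =>
      (Λ (mkCot z ξ)).toAlternatingMap.map_update_neg v i _
    simp [hX, sub_eq_add_neg, h3]
  have hGd : ∀ i, HasDerivAt (fun ε => G (y + ε • U) (w i ε) (w i ε)) 0 0 := fun i =>
    hnear.hasDerivAt_transport U (v i)
  -- Transport keeps each length to first order, so the product contributes nothing to the
  -- derivative.
  have hρd : HasDerivAt (fun ε => ‖liftCoord Λ z (c ε) (fun i => w i ε)‖ ^ 2 -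
      m ^ 2 * ∏ i, G (y + ε • U) (w i ε) (w i ε))
      (2 * ⟪Λ (mkCot z ξ) v, X - ∑ i, Λ (mkCot z ξ) (Function.update v i (Γ U (v i)))⟫) 0 := by
    have h1 := hfd.norm_sq
    have h2 := (HasDerivAt.fun_finsetProd (u := Finset.univ)
      (fun i _ => hGd i)).const_mul (m ^ 2)
    convert! h1.sub h2 using 1
    simp [hc0, hw0, hself]
  have hpos : ∀ i, 0 ≤ G y (v i) (v i) ∧ G y (v i) (v i) ≤ 1 := fun i => by
    rw [hG, hy, bilCoord_self, ← (isInner_metricAt g z).vecNorm_sq]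
    exact ⟨sq_nonneg _, pow_le_one₀ (vecNorm_nonneg _ _) (hv i)⟩
  -- By `hmax` the function is nonpositive near 0; at 0 it equals `m² (1 - ∏ |vᵢ|²)`, which is
  -- nonnegative. Homogeneity matters here, as the curve of covectors may leave `S*M`.
  have hloc : IsLocalMax (fun ε => ‖liftCoord Λ z (c ε) (fun i => w i ε)‖ ^ 2 -
      m ^ 2 * ∏ i, G (y + ε • U) (w i ε) (w i ε)) 0 := by
    have h0 : 0 ≤ ‖liftCoord Λ z (c 0) (fun i => w i 0)‖ ^ 2 -
        m ^ 2 * ∏ i, G (y + (0 : ℝ) • U) (w i 0) (w i 0) := by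
      simp only [hc0, hw0, hself, zero_smul, add_zero, ← hm]
      have : ∏ i, G y (v i) (v i) ≤ 1 :=
        Finset.prod_le_one (fun i _ => (hpos i).1) fun i _ => (hpos i).2
      nlinarith [sq_nonneg m]
    have e1 : ∀ᶠ ε in 𝓝 (0 : ℝ), y + ε • U ∈ (extChartAt (𝓡 n) z).target :=
      hp1.continuousAt.eventually_mem (by simpa using target_mem_nhds hyt)
    have e2 : ∀ᶠ ε in 𝓝 (0 : ℝ), ξ - ε • (ξ ∘L Du) ≠ 0 :=
      hp2.continuousAt.eventually_ne (by simpa using hξ)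
    filter_upwards [e1, e2] with ε h1 h2
    refine le_trans ?_ h0
    have h3 := hmax ((extChartAt (𝓡 n) z).symm (y + ε • U)) _ (cotCoord_ne_zero h1 h2) (fun i => frame z (y + ε • U) (w i ε))
    have h4 : ‖liftCoord Λ z (c ε) (fun i => w i ε)‖ ≤ m * ∏ i, vecNorm
        (metricAt g ((extChartAt (𝓡 n) z).symm (y + ε • U))) (frame z (y + ε • U) (w i ε)) := h3
    have h5 := pow_le_pow_left₀ (norm_nonneg _) h4 2
    rw [mul_pow, ← Finset.prod_pow] at h5
    simp only [(isInner_metricAt g _).vecNorm_sq] at h5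
    simp only [hG, bilCoord_apply]
    linarith
  have hzero := hloc.hasDerivAt_eq_zero hρd
  -- Since the connection is torsion-free, the `Du` of the Lie derivative and the `Γ` of the
  -- transport combine into `∇u`.
  have hgrad : ∀ a, grad g u z a = Du a + Γ U a := fun a => by
    have h1 : grad g u z a = Du a + Γ a U := by simp [grad, gradCoord, hDu, hΓ, hU, hy]
    rw [h1, hΓ]
    congr 1
    exact hnear.christoffel_symm _ _
  have hlie : lieDeriv u Λ (mkCot z ξ) v = (X - ∑ i, Λ (mkCot z ξ) (Function.update v i (Γ U (v i))))
      + ∑ i, Λ (mkCot z ξ) (Function.update v i (grad g u z (v i))) := by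
    have h1 : lieDeriv u Λ (mkCot z ξ) v =
      X + ∑ i, Λ (mkCot z ξ) (Function.update v i (Du (v i))) := rfl
    simp only [h1, hgrad, ContinuousAlternatingMap.map_update_add, Finset.sum_add_distrib]
    ring
  rw [hlie, inner_add_right, inner_sum]
  linarith

end Charts

/-! ### The maximum principle -/

section Charts

variable {n : ℕ} {M : Type*} [TopologicalSpace M] [ChartedSpace (Eu n) M]
  [IsManifold (𝓡 n) ∞ M]


variable {k : ℕ}

open scoped RealInnerProductSpace

/-- Homogeneity in `ξ` and multilinearity in `v` reduce to unit covectors and unit vectors; if some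
vector vanishes, both sides are zero. -/
lemma isFormBound_of_unit_bound (g : Metric n M) {Λ : Cotangent n M → KForm n k}
    (hΛ : HomogeneousZero Λ) {m : ℝ}
    (h : ∀ z ξ, coNorm g (mkCot z ξ) = 1 → ∀ v : Fin k → Eu n,
      (∀ i, vecNorm (metricAt g z) (v i) ≤ 1) → ‖Λ (mkCot z ξ) v‖ ≤ m)
    (z : M) {ξ : Eu n →L[ℝ] ℝ} (hξ : ξ ≠ 0) : IsFormBound g z (Λ (mkCot z ξ)) m := by
  have hr := inv_pos.2 (coNorm_pos g z hξ)
  rw [← hΛ z ξ _ hξ hr]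
  have h1 : coNorm g (mkCot z ((coNorm g (mkCot z ξ))⁻¹ • ξ)) = 1 := by
    rw [coNorm_smul g z ξ hr.le, inv_mul_cancel₀ (coNorm_pos g z hξ).ne']
  set lam := Λ (mkCot z ((coNorm g (mkCot z ξ))⁻¹ • ξ))
  intro v
  have hg := isInner_metricAt g z
  by_cases hv : ∃ i, v i = 0
  · obtain ⟨i, hi⟩ := hv
    rw [lam.map_coord_zero i hi, Finset.prod_eq_zero (Finset.mem_univ i) (by simp [vecNorm, hi])]
    simp
  push Not at hv
  have hn : ∀ i, 0 < vecNorm (metricAt g z) (v i) := fun i => hg.vecNorm_pos (hv i)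
  have h2 := h z _ h1 (fun i => (vecNorm (metricAt g z) (v i))⁻¹ • v i) fun i => by
    rw [vecNorm_smul, abs_of_pos (inv_pos.2 (hn i)), inv_mul_cancel₀ (hn i).ne']
  have h3 : lam v = (∏ i, vecNorm (metricAt g z) (v i)) •
      lam fun i => (vecNorm (metricAt g z) (v i))⁻¹ • v i := by
    rw [← lam.map_smul_univ]
    congr 1
    ext1 i
    rw [smul_smul, mul_inv_cancel₀ (hn i).ne', one_smul]
  have h4 : 0 ≤ ∏ i, vecNorm (metricAt g z) (v i) := Finset.prod_nonneg fun i _ => (hn i).le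
  rw [h3, norm_smul, Real.norm_of_nonneg h4, mul_comm]
  gcongr

lemma IsFormBound.norm_le_of_unit {g : Metric n M} {z : M} {lam : KForm n k} {c : ℝ} (hc : 0 ≤ c)
    (h : IsFormBound g z lam c) {v : Fin k → Eu n} (hv : ∀ i, vecNorm (metricAt g z) (v i) ≤ 1) :
    ‖lam v‖ ≤ c :=
  (h v).trans (mul_le_of_le_one_right hc
    (Finset.prod_le_one (fun _ _ => vecNorm_nonneg _ _) fun i _ => hv i))

lemma IsFormBound.norm_update_le {g : Metric n M} {z : M} {lam : KForm n k} {c : ℝ} (hc : 0 ≤ c)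
    (h : IsFormBound g z lam c) {v : Fin k → Eu n} (hv : ∀ i, vecNorm (metricAt g z) (v i) ≤ 1)
    (i : Fin k) (w : Eu n) :
    ‖lam (Function.update v i w)‖ ≤ c * vecNorm (metricAt g z) w := by
  refine (h _).trans (mul_le_mul_of_nonneg_left ?_ hc)
  rw [← Finset.mul_prod_erase _ _ (Finset.mem_univ i), Function.update_self]
  refine mul_le_of_le_one_right (vecNorm_nonneg _ _)
    (Finset.prod_le_one (fun _ _ => vecNorm_nonneg _ _) fun j hj => ?_)
  rw [Function.update_of_ne (Finset.ne_of_mem_erase hj)]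
  exact hv j

lemma IsC1Lift.differentiableAt {t₀ T : ℝ} {Λ : ℝ → Cotangent n M → KForm n k}
    (h : IsC1Lift t₀ T Λ) {t : ℝ} (ht : t ∈ Ico t₀ T) {x : M} {y : Eu n}
    (hy : y ∈ (extChartAt (𝓡 n) x).target) {η : Eu n →L[ℝ] ℝ} (hη : η ≠ 0) :
    DifferentiableAt ℝ (liftCoord (Λ t) x) (y, η) := by
  have h1 : ContDiffOn ℝ 1 (fun q : Eu n × (Eu n →L[ℝ] ℝ) => liftCoord (Λ t) x q)
      ((extChartAt (𝓡 n) x).target ×ˢ {0}ᶜ) :=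
    (h x).comp (f := fun q => (t, q)) (by fun_prop) fun q hq => ⟨ht, hq⟩
  exact (h1.contDiffAt (prod_mem_nhds (target_mem_nhds hy)
    (isOpen_compl_singleton.mem_nhds hη))).differentiableAt one_ne_zero

lemma IsC1Lift.hasDerivWithinAt {t₀ T : ℝ} {Λ : ℝ → Cotangent n M → KForm n k}
    (h : IsC1Lift t₀ T Λ) {t : ℝ} (ht : t ∈ Ico t₀ T) (z : M) {ξ : Eu n →L[ℝ] ℝ} (hξ : ξ ≠ 0) :
    HasDerivWithinAt (fun s => Λ s (mkCot z ξ))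
      (derivWithin (fun s => Λ s (mkCot z ξ)) (Ico t₀ T) t) (Ico t₀ T) t := by
  have h1 : ContDiffOn ℝ 1 (fun s : ℝ => liftCoord (Λ s) z (extChartAt (𝓡 n) z z, ξ)) (Ico t₀ T) :=
    (h z).comp (f := fun s : ℝ => (s, (extChartAt (𝓡 n) z z, ξ))) (by fun_prop)
      fun s hs => ⟨hs, mem_extChartAt_target z, hξ⟩
  simp only [liftCoord_self] at h1
  exact ((h1 t ht).differentiableWithinAt one_ne_zero).hasDerivWithinAt

/-- If at time `t > t₀` the form `f t` evaluated on `v` were to maximize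
`exp (-2C(s - t₀)) (‖f s v‖² + 1)`, it would have to grow at a rate at least `C`. -/
lemma le_inner_of_max {t₀ T t C : ℝ} (ht₀ : t₀ < t) (htT : t < T) {f : ℝ → KForm n k}
    {f' : KForm n k} (hf : HasDerivWithinAt f f' (Ico t₀ T) t) (v : Fin k → Eu n)
    (hmax : ∀ s ∈ Icc t₀ t, Real.exp (-2 * C * (s - t₀)) * (‖f s v‖ ^ 2 + 1) ≤
      Real.exp (-2 * C * (t - t₀)) * (‖f t v‖ ^ 2 + 1)) :
    C * (‖f t v‖ ^ 2 + 1) ≤ ⟪f t v, f' v⟫ := by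
  have h1 : HasDerivWithinAt (fun s => f s v) (f' v) (Icc t₀ t) t := by
    exact (ContinuousAlternatingMap.apply ℝ (Eu n) ℂ v).hasFDerivAt.comp_hasDerivWithinAt
      t (hf.mono (Icc_subset_Ico_right htT))
  have h2 : HasDerivWithinAt (fun s => Real.exp (-2 * C * (s - t₀)))
      (Real.exp (-2 * C * (t - t₀)) * (-2 * C)) (Icc t₀ t) t := by
    have := (((hasDerivAt_id t).sub_const t₀).const_mul (-2 * C)).exp
    simpa using this.hasDerivWithinAt
  have h3 := (h2.mul (h1.norm_sq.add_const 1)).hasFDerivWithinAt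
  have h4 : IsLocalMaxOn ((fun s => Real.exp (-2 * C * (s - t₀))) *
      fun s => ‖f s v‖ ^ 2 + 1) (Icc t₀ t) t := Filter.eventually_of_mem self_mem_nhdsWithin hmax
  -- The maximum is at the right end of `[t₀, t]`, so only the backward direction `t₀ - t` is
  -- admissible; the derivative in that direction is nonpositive.
  have h5 := h4.hasFDerivWithinAt_nonpos h3 (sub_mem_posTangentConeAt_of_segment_subset
    (y := t₀) (by rw [segment_symm, segment_eq_Icc ht₀.le]))
  rw [ContinuousLinearMap.toSpanSingleton_apply, smul_eq_mul] at h5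
  have h6 : 0 < Real.exp (-2 * C * (t - t₀)) := Real.exp_pos _
  by_contra! h7
  have h8 : 0 < (t - t₀) * Real.exp (-2 * C * (t - t₀)) *
      (2 * (C * (‖f t v‖ ^ 2 + 1) - ⟪f t v, f' v⟫)) :=
    mul_pos (mul_pos (sub_pos.2 ht₀) h6) (by linarith)
  linarith

lemma IsBoundedFlow.isInner_effMetric {g : Metric n M} {t₀ T : ℝ} {u : ℝ → M → Eu n} {C : ℝ}
    (h : IsBoundedFlow g t₀ T u C) {α : ℝ}
    (hg' : ∀ t ∈ Icc t₀ T, ∀ x : M, ∀ v : Eu n, v ≠ 0 → 0 < effMetric g α t₀ u t x v v)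
    {t : ℝ} (ht : t ∈ Icc t₀ T) (z : M) : IsInner (effMetric g α t₀ u t z) where
  symm v w := by
    have ht0 : t₀ ∈ Icc t₀ T := ⟨le_rfl, ht.1.trans ht.2⟩
    have h2 := h.intervalIntegrable_deformation (mem_extChartAt_target (I := 𝓡 n) z) ht0 ht
    simp only [bilCoord_self] at h2
    have h3 : ∀ a b : Eu n, (∫ s in t₀..t, deformation g (u s) z) a b =
        ∫ s in t₀..t, deformation g (u s) z a b := fun a b => by
      rw [ContinuousLinearMap.intervalIntegral_apply h2,
        ContinuousLinearMap.intervalIntegral_apply]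
      exact ⟨h2.1.apply_continuousLinearMap a, h2.2.apply_continuousLinearMap a⟩
    have h4 : ∀ s, deformation g (u s) z v w = deformation g (u s) z w v := fun s => by
      rw [deformation_apply, deformation_apply, add_comm]
    simp only [effMetric, _root_.add_apply, _root_.smul_apply, h3, h4, metricAt_symm g z v w]
  pos v hv := hg' t ht z v hv

/-- The growth rate of a solution at a maximum. -/
lemma IsLiftedSolution.exists_growth_le [CompactSpace M] {g : Metric n M} {α ν t₀ T C : ℝ}
    (hν : 0 ≤ ν) {u : ℝ → M → Eu n} (hu : IsBoundedFlow g t₀ T u C)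
    (hg' : ∀ t ∈ Icc t₀ T, ∀ x : M, ∀ v : Eu n, v ≠ 0 → 0 < effMetric g α t₀ u t x v v)
    {K : ℝ → Cotangent n M → Curv n →ₗ[ℝ] KForm n k →ₗ[ℝ] KForm n k}
    (hK : IsContinuousCoeff pushCurv g t₀ T K)
    {N : ℝ → Cotangent n M → Endo n →ₗ[ℝ] KForm n k →ₗ[ℝ] KForm n k}
    (hN : IsContinuousCoeff pushEndo g t₀ T N)
    {F Λ : ℝ → Cotangent n M → KForm n k} (hF : IsContinuousLift g t₀ T F)
    (hΛ : IsLiftedSolution g α ν t₀ T u K N F Λ) :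
    ∃ D, 0 ≤ D ∧ ∀ t ∈ Ico t₀ T, ∀ z ξ, coNorm g (mkCot z ξ) = 1 → ∀ v : Fin k → Eu n,
      (∀ i, vecNorm (metricAt g z) (v i) ≤ 1) →
      (∀ z' ξ', ξ' ≠ 0 → IsFormBound g z' (Λ t (mkCot z' ξ')) ‖Λ t (mkCot z ξ) v‖) →
      ⟪Λ t (mkCot z ξ) v, derivWithin (fun s => Λ s (mkCot z ξ)) (Ico t₀ T) t v⟫ ≤
        D * (‖Λ t (mkCot z ξ) v‖ ^ 2 + 1) := by
  obtain ⟨DK, hDK, hKb⟩ := exists_curv_operator_bound g hK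
  obtain ⟨DN, hDN, hNb⟩ := exists_endo_operator_bound g hN
  obtain ⟨DF, hDF, hFb⟩ := exists_isFormBound_forcing g hF
  obtain ⟨R, hR, hRb⟩ := hu.exists_effCurvature_le α
  have hC := hu.nonneg
  -- The summands come from the curvature operator, the commutator, the forcing and the `k`
  -- insertions of `∇u` in the Lie derivative.
  refine ⟨DK * R + DN * C + DF + k * C, by positivity, fun t ht z ξ hξ v hv hmax => ?_⟩
  have hξ0 := ne_zero_of_coNorm_eq_one hξ
  have htc : t ∈ Icc t₀ T := ⟨ht.1, ht.2.le⟩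
  have hlie := inner_lieDeriv_eq g (u t) hξ0
    (hΛ.c1.differentiableAt ht (mem_extChartAt_target z) hξ0) hv hmax
  have heq := hΛ.equation t ht (mkCot z ξ) hξ v
  set m := ‖Λ t (mkCot z ξ) v‖ with hm
  have hm0 : 0 ≤ m := norm_nonneg _
  have hself := hmax z ξ hξ0
  have k1 := (hKb z t htc ξ hξ (effCurvature g α t₀ u t z) R _ m hR hm0
    (hRb t ht z) hself).norm_le_of_unit (by positivity) hv
  have k2 := (hNb z t htc ξ hξ (grad g (u t) z) C _ m hC hm0
    ((hu.bounded t ht).grad_le z) hself).norm_le_of_unit (by positivity) hv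
  have k3 := (hFb z t htc ξ hξ).norm_le_of_unit hDF hv
  have k4 : ∀ i, ‖Λ t (mkCot z ξ) (Function.update v i (grad g (u t) z (v i)))‖ ≤ m * C :=
    fun i => (hself.norm_update_le hm0 hv i _).trans <| by
      gcongr
      exact ((hu.bounded t ht).grad_le z (v i)).trans (mul_le_of_le_one_right hC (hv i))
  set lam := Λ t (mkCot z ξ) v with hlam
  have i1 : ∀ {a : ℂ} {b : ℝ}, ‖a‖ ≤ b → ⟪lam, a⟫ ≤ m * b := fun {a b} h =>
    (real_inner_le_norm _ _).trans (by gcongr)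
  have i2 : -(k * (m * (m * C))) ≤ ⟪lam, lieDeriv (u t) (Λ t) (mkCot z ξ) v⟫ := by
    rw [hlie]
    have : ∀ i ∈ (Finset.univ : Finset (Fin k)), -(m * (m * C)) ≤
        ⟪lam, Λ t (mkCot z ξ) (Function.update v i (grad g (u t) z (v i)))⟫ := fun i _ => by
      have h1 := neg_le_of_abs_le (abs_real_inner_le_norm lam
        (Λ t (mkCot z ξ) (Function.update v i (grad g (u t) z (v i)))))
      have h2 : ‖lam‖ * ‖Λ t (mkCot z ξ) (Function.update v i (grad g (u t) z (v i)))‖ ≤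
          m * (m * C) := by
        gcongr
        exact k4 i
      linarith
    simpa using Finset.card_nsmul_le_sum _ _ _ this
  set c := ν * coSq (effMetric g α t₀ u t z) ξ with hc
  have hc0 : 0 ≤ c := mul_nonneg hν (coSq_nonneg (hu.isInner_effMetric hg' htc z) ξ)
  have i3 : ⟪lam, ((c : ℝ) : ℂ) * lam⟫ = c * m ^ 2 := by
    rw [← Complex.real_smul, inner_smul_right, real_inner_self_eq_norm_sq]
  have hder : derivWithin (fun s => Λ s (mkCot z ξ)) (Ico t₀ T) t v =
      K t (mkCot z ξ) (effCurvature g α t₀ u t z) (Λ t (mkCot z ξ)) v +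
        N t (mkCot z ξ) (grad g (u t) z) (Λ t (mkCot z ξ)) v + F t (mkCot z ξ) v -
        lieDeriv (u t) (Λ t) (mkCot z ξ) v - ((c : ℝ) : ℂ) * lam :=
    eq_sub_of_add_eq (eq_sub_of_add_eq ((add_right_comm _ _ _).trans heq))
  rw [hder, inner_sub_right, inner_sub_right, inner_add_right, inner_add_right, i3]
  have j1 := i1 k1
  have j2 := i1 k2
  have j3 := i1 k3
  have j4 : 0 ≤ c * m ^ 2 := by positivity
  -- The forcing is not linear in `m`; the `+ 1` in the tested quantity absorbs it.
  have j5 : m * DF ≤ DF * (m ^ 2 + 1) := by nlinarith [sq_nonneg (m - 1)]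
  have j6 : 0 ≤ DK * R + DN * C + k * C := by positivity
  nlinarith

/-- A solution stays bounded. -/
lemma IsLiftedSolution.exists_isFormBound [CompactSpace M] {g : Metric n M} {α ν t₀ T C : ℝ}
    (hν : 0 ≤ ν) {u : ℝ → M → Eu n} (hu : IsBoundedFlow g t₀ T u C)
    (hg' : ∀ t ∈ Icc t₀ T, ∀ x : M, ∀ v : Eu n, v ≠ 0 → 0 < effMetric g α t₀ u t x v v)
    {K : ℝ → Cotangent n M → Curv n →ₗ[ℝ] KForm n k →ₗ[ℝ] KForm n k}
    (hK : IsContinuousCoeff pushCurv g t₀ T K)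
    {N : ℝ → Cotangent n M → Endo n →ₗ[ℝ] KForm n k →ₗ[ℝ] KForm n k}
    (hN : IsContinuousCoeff pushEndo g t₀ T N)
    {F Λ : ℝ → Cotangent n M → KForm n k} (hF : IsContinuousLift g t₀ T F)
    (hΛ : IsLiftedSolution g α ν t₀ T u K N F Λ) :
    ∃ B, 0 ≤ B ∧ ∀ t ∈ Ico t₀ T, ∀ z ξ, coNorm g (mkCot z ξ) = 1 →
      IsFormBound g z (Λ t (mkCot z ξ)) B := by
  obtain ⟨D, hD, hgrowth⟩ := hΛ.exists_growth_le hν hu hg' hK hN hF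
  by_cases hT : t₀ < T
  swap
  · exact ⟨0, le_rfl, fun t ht => absurd (ht.1.trans_lt ht.2) hT⟩
  -- The cosphere bundle is empty when `M` is empty or `n = 0`; there is then nothing to bound.
  by_cases hne : (testDomain g k t₀ t₀).Nonempty
  swap
  · refine ⟨0, le_rfl, fun t ht z ξ hξ => absurd ⟨(t₀, (mkCot z ξ, 0)), ?_⟩ hne⟩
    exact ⟨⟨le_rfl, le_rfl⟩, hξ, fun i => by simp [vecNorm]⟩
  -- Strictly larger than the admissible growth rate, so that a maximum after `t₀` is contradictory.
  set E := D + 1 with hE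
  obtain ⟨p₀, -, hp₀⟩ := exists_max_form g hT hΛ.c1 hne (θ := fun _ a => a) (by fun_prop)
  set m₀ := ‖Λ p₀.1 p₀.2.1 p₀.2.2‖ with hm₀
  have hpt : ∀ t ∈ Ico t₀ T, ∀ q ∈ testDomain g k t₀ t,
      Real.exp (-2 * E * (q.1 - t₀)) * (‖Λ q.1 q.2.1 q.2.2‖ ^ 2 + 1) ≤ m₀ ^ 2 + 1 := by
    intro t ht
    have hne' : (testDomain g k t₀ t).Nonempty := by
      obtain ⟨q, hq, hq'⟩ := hne
      exact ⟨q, ⟨hq.1, hq.2.trans ht.1⟩, hq'⟩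
    obtain ⟨⟨s, p, v⟩, ⟨hs, hp, hv⟩, hmax⟩ := exists_max_form g ht.2 hΛ.c1 hne'
      (θ := fun s a => Real.exp (-2 * E * (s - t₀)) * (a ^ 2 + 1)) (by fun_prop)
    intro q hq
    refine (hmax q hq).trans ?_
    dsimp only at hs hp hv ⊢
    have hsT : s ∈ Ico t₀ T := ⟨hs.1, hs.2.trans_lt ht.2⟩
    obtain rfl | hlt := hs.1.eq_or_lt
    · have h1 := hp₀ (t₀, (p, v)) ⟨⟨le_rfl, le_rfl⟩, hp, hv⟩
      simp only [sub_self, mul_zero, Real.exp_zero, one_mul]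
      gcongr
    exfalso
    -- Comparison at the common time `s`, where the exponential weights agree: the maximum in
    -- space-time is also one over the slice.
    have hle : ∀ z ξ, coNorm g (mkCot z ξ) = 1 → ∀ w : Fin k → Eu n,
        (∀ i, vecNorm (metricAt g z) (w i) ≤ 1) → ‖Λ s (mkCot z ξ) w‖ ≤ ‖Λ s p v‖ := by
      intro z ξ hξ w hw
      have h1 := hmax (s, (mkCot z ξ, w)) ⟨hs, hξ, hw⟩
      have h2 := le_of_mul_le_mul_left h1 (Real.exp_pos _)
      exact (sq_le_sq₀ (norm_nonneg _) (norm_nonneg _)).1 (by linarith)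
    have h1 := hgrowth s hsT p.proj (covec p) hp v hv
      fun z ξ hξ => isFormBound_of_unit_bound g (hΛ.homogeneous s hsT) hle z hξ
    have h2 := le_inner_of_max (C := E) hlt hsT.2
      (hΛ.c1.hasDerivWithinAt hsT p.proj (ξ := covec p) (ne_zero_of_coNorm_eq_one hp)) v
      fun r hr => hmax (r, (p, v)) ⟨⟨hr.1, hr.2.trans hs.2⟩, hp, hv⟩
    have h3 := h2.trans h1
    rw [hE] at h3
    nlinarith [sq_nonneg ‖Λ s (mkCot p.proj (covec p)) v‖]
  -- The bound on the weighted quantity, freed of its weight at the worst time `T`.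
  set B := Real.sqrt (Real.exp (2 * E * (T - t₀)) * (m₀ ^ 2 + 1)) with hB
  refine ⟨B, Real.sqrt_nonneg _, fun t ht z ξ hξ => ?_⟩
  refine isFormBound_of_unit_bound g (hΛ.homogeneous t ht) (fun z ξ hξ v hv => ?_) z
    (ne_zero_of_coNorm_eq_one hξ)
  have h1 := hpt t ht (t, (mkCot z ξ, v)) ⟨⟨ht.1, le_rfl⟩, hξ, hv⟩
  refine Real.le_sqrt_of_sq_le ?_
  dsimp only at h1
  have h2 : Real.exp (-2 * E * (t - t₀)) = (Real.exp (2 * E * (t - t₀)))⁻¹ := by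
    rw [← Real.exp_neg]
    congr 1
    ring
  rw [h2, inv_mul_le_iff₀ (Real.exp_pos _)] at h1
  have h3 : Real.exp (2 * E * (t - t₀)) ≤ Real.exp (2 * E * (T - t₀)) := by
    have := ht.2.le
    gcongr
  have h4 : Real.exp (2 * E * (t - t₀)) * (m₀ ^ 2 + 1) ≤
      Real.exp (2 * E * (T - t₀)) * (m₀ ^ 2 + 1) := by gcongr
  linarith

end Charts

/-! ### Canonical volume of the cotangent bundle and finiteness of the Liouville measure -/

section Charts

variable {n : ℕ} {M : Type*} [TopologicalSpace M] [ChartedSpace (Eu n) M]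
  [IsManifold (𝓡 n) ∞ M]


/-- Identifies the bundle topology, and hence the Borel structure, with the one given by canonical
coordinates. -/
lemma trivializationAt_cotangent {x : M} {p : Cotangent n M}
    (hp : p.proj ∈ (extChartAt (𝓡 n) x).source) :
    trivializationAt (Eu n →L[ℝ] ℝ)
      (fun x : M => TangentSpace (𝓡 n) x →L[ℝ] Bundle.Trivial M ℝ x) x p =
      (p.proj, covec p ∘L frame x (extChartAt (𝓡 n) x p.proj)) := by
  rw [hom_trivializationAt_apply]
  refine Prod.ext rfl ?_
  have hp' : p.proj ∈ (chartAt (Eu n) x).source := by rwa [extChartAt_source] at hp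
  dsimp only
  have h1 : (trivializationAt ℝ (Bundle.Trivial M ℝ) x).continuousLinearMapAt ℝ p.proj =
      ContinuousLinearMap.id ℝ ℝ := Bundle.Trivial.continuousLinearMapAt_trivialization ℝ M ℝ _
  rw [ContinuousLinearMap.inCoordinates, h1, TangentBundle.symmL_trivializationAt_eq_core hp']
  have h2 : frame x (extChartAt (𝓡 n) x p.proj) = tangentCoordChange (𝓡 n) x p.proj p.proj := by
    simp only [frame, (extChartAt (𝓡 n) x).left_inv hp]
  rw [h2]
  rfl

lemma mem_trivializationAt_cotangent_source {x : M} {p : Cotangent n M} :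
    p ∈ (trivializationAt (Eu n →L[ℝ] ℝ)
      (fun x : M => TangentSpace (𝓡 n) x →L[ℝ] Bundle.Trivial M ℝ x) x).source ↔
      p.proj ∈ (extChartAt (𝓡 n) x).source := by
  rw [hom_trivializationAt_source, extChartAt_source]
  simp

lemma continuousOn_cotCoord (x : M) :
    ContinuousOn (cotCoord x) ((extChartAt (𝓡 n) x).target ×ˢ univ) := by
  set e := trivializationAt (Eu n →L[ℝ] ℝ)
      (fun x : M => TangentSpace (𝓡 n) x →L[ℝ] Bundle.Trivial M ℝ x) x
  have h1 : ContinuousOn (fun q : Eu n × (Eu n →L[ℝ] ℝ) =>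
      e.toOpenPartialHomeomorph.symm ((extChartAt (𝓡 n) x).symm q.1, q.2))
      ((extChartAt (𝓡 n) x).target ×ˢ univ) := by
    refine e.toOpenPartialHomeomorph.continuousOn_symm.comp
      (((continuousOn_extChartAt_symm x).comp continuousOn_fst fun q hq => hq.1).prodMk
        continuousOn_snd) fun q hq => ?_
    have := (extChartAt (𝓡 n) x).map_target hq.1
    rw [extChartAt_source] at this
    exact ⟨⟨this, mem_univ _⟩, mem_univ _⟩
  refine h1.congr fun q hq => ?_
  have hs : (cotCoord x q).proj ∈ (extChartAt (𝓡 n) x).source :=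
    (extChartAt (𝓡 n) x).map_target hq.1
  have h2 := e.toOpenPartialHomeomorph.left_inv (mem_trivializationAt_cotangent_source.2 hs)
  rw [← h2]
  congr 1
  refine (trivializationAt_cotangent hs).trans (Prod.ext rfl ?_)
  change (q.2 ∘L coframe x q.1) ∘L frame x (extChartAt (𝓡 n) x ((extChartAt (𝓡 n) x).symm q.1)) = q.2
  rw [(extChartAt (𝓡 n) x).right_inv hq.1, ContinuousLinearMap.comp_assoc, coframe_frame hq.1]
  rfl

/-- A function on `T*M` is continuous if it is in canonical coordinates. -/
lemma continuousOn_of_continuousOn_cotCoord {Y : Type*} [TopologicalSpace Y] {S : Set (Cotangent n M)}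
    {f : Cotangent n M → Y}
    (hf : ∀ x : M, ContinuousOn (fun q => f (cotCoord x q))
      (((extChartAt (𝓡 n) x).target ×ˢ univ) ∩ cotCoord x ⁻¹' S)) : ContinuousOn f S := by
  intro p hp
  set x := p.proj
  set e := trivializationAt (Eu n →L[ℝ] ℝ)
      (fun x : M => TangentSpace (𝓡 n) x →L[ℝ] Bundle.Trivial M ℝ x) x
  have hps : p ∈ e.source := mem_trivializationAt_cotangent_source.2 (mem_extChartAt_source x)
  have h1 : ContinuousOn (fun p : Cotangent n M => (extChartAt (𝓡 n) x (e p).1, (e p).2))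
      e.source := by
    refine ContinuousOn.prodMk ((continuousOn_extChartAt x).comp
      (continuous_fst.comp_continuousOn e.continuousOn) fun q hq => ?_)
      (continuous_snd.comp_continuousOn e.continuousOn)
    rw [trivializationAt_cotangent (mem_trivializationAt_cotangent_source.1 hq)]
    exact mem_trivializationAt_cotangent_source.1 hq
  have h2 : ∀ q ∈ e.source, cotCoord x (extChartAt (𝓡 n) x (e q).1, (e q).2) = q := fun q hq => by
    have hq' := mem_trivializationAt_cotangent_source.1 hq
    rw [trivializationAt_cotangent hq']
    exact exists_cotCoord x q hq'
  have h3 : ContinuousOn f (e.source ∩ S) := by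
    refine ((hf x).comp (h1.mono inter_subset_left) fun q hq => ⟨⟨?_, mem_univ _⟩, ?_⟩).congr
      fun q hq => ?_
    · have hq' := mem_trivializationAt_cotangent_source.1 hq.1
      rw [trivializationAt_cotangent hq']
      exact (extChartAt (𝓡 n) x).map_source hq'
    · rw [mem_preimage, h2 q hq.1]
      exact hq.2
    · exact congrArg f (h2 q hq.1).symm
  exact ((h3 p ⟨hps, hp⟩).mono_of_mem_nhdsWithin
    (Filter.inter_mem (mem_nhdsWithin_of_mem_nhds (e.open_source.mem_nhds hps)) self_mem_nhdsWithin))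

lemma continuous_coNorm (g : Metric n M) : Continuous (coNorm g) := by
  rw [← continuousOn_univ]
  refine continuousOn_of_continuousOn_cotCoord fun x => ?_
  simpa using continuousOn_coNorm_cotCoord g x

instance : BorelSpace (Cotangent n M) := ⟨rfl⟩

variable (n) in
/-- Lebesgue measure on the covectors. -/
def covolume : Measure (Eu n →L[ℝ] ℝ) :=
  (volume : Measure (Eu n)).map (InnerProductSpace.toDual ℝ (Eu n))

instance : (covolume n).IsAddHaarMeasure :=
  (InnerProductSpace.toDual ℝ (Eu n)).toContinuousLinearEquiv.isAddHaarMeasure_map volume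

/-- Pulling back covectors changes the volume by the determinant. -/
lemma covolume_preimage_comp (J Jinv : Endo n) (hJ : ∀ v, Jinv (J v) = v)
    (B : Set (Eu n →L[ℝ] ℝ)) :
    covolume n {η | η ∘L Jinv ∈ B} = ENNReal.ofReal |J.det| * covolume n B := by
  let f : (Eu n →L[ℝ] ℝ) →L[ℝ] (Eu n →L[ℝ] ℝ) := (ContinuousLinearMap.compL ℝ (Eu n) (Eu n) ℝ).flip Jinv
  let e : Module.Dual ℝ (Eu n) ≃ₗ[ℝ] (Eu n →L[ℝ] ℝ) := LinearMap.toContinuousLinearMap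
  -- Pulling back covectors is the dual map of `Jinv`, up to the identification of continuous with
  -- algebraic duals; hence its determinant is that of `Jinv`.
  have hf : (f : (Eu n →L[ℝ] ℝ) →ₗ[ℝ] (Eu n →L[ℝ] ℝ)) =
      (e : Module.Dual ℝ (Eu n) →ₗ[ℝ] (Eu n →L[ℝ] ℝ)) ∘ₗ
        (Jinv : Eu n →ₗ[ℝ] Eu n).dualMap ∘ₗ (e.symm : _ →ₗ[ℝ] _) := by
    ext η v
    rfl
  have hdet : LinearMap.det (f : (Eu n →L[ℝ] ℝ) →ₗ[ℝ] (Eu n →L[ℝ] ℝ)) = Jinv.det := by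
    rw [hf, LinearMap.det_conj, LinearMap.det_dualMap]
  have hmul : Jinv.det * J.det = 1 := by
    have h1 : (Jinv : Eu n →ₗ[ℝ] Eu n) ∘ₗ (J : Eu n →ₗ[ℝ] Eu n) = LinearMap.id :=
      LinearMap.ext hJ
    have h2 := congrArg LinearMap.det h1
    rwa [LinearMap.det_comp, LinearMap.det_id] at h2
  have h := Measure.addHaar_preimage_continuousLinearMap (covolume n) (f := f)
    (by rw [hdet]; exact left_ne_zero_of_mul_eq_one hmul) B
  rw [hdet, inv_eq_of_mul_eq_one_right hmul] at h
  exact h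

lemma measurableSet_inter_preimage {X Y : Type*} [TopologicalSpace X] [MeasurableSpace X]
    [OpensMeasurableSpace X] [TopologicalSpace Y] [MeasurableSpace Y] [BorelSpace Y] {f : X → Y}
    {s : Set X} (hf : ContinuousOn f s) (hs : MeasurableSet s) {t : Set Y} (ht : MeasurableSet t) :
    MeasurableSet (s ∩ f ⁻¹' t) := by
  convert! hs.subtype_image ((continuousOn_iff_continuous_domRestrict.1 hf).measurable ht) using 1
  ext a
  simp [and_comm]

/-- The volume of `T*M` in canonical coordinates does not depend on the chart. -/
lemma volume_cotCoord_overlap_le (x x' : M) {K : Set (Eu n)} (hK : MeasurableSet K)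
    (hKt : K ⊆ (extChartAt (𝓡 n) x').target) {A : Set (Cotangent n M)} (hA : MeasurableSet A) :
    (volume.prod (covolume n))
      (((overlap x x' ∩ transition x x' ⁻¹' K) ×ˢ univ) ∩ cotCoord x ⁻¹' A) ≤
    (volume.prod (covolume n)) ((K ×ˢ univ) ∩ cotCoord x' ⁻¹' A) := by
  have hO : MeasurableSet (overlap (n := n) x x' ∩ transition x x' ⁻¹' K) :=
    measurableSet_inter_preimage (contDiffOn_transition x x').continuousOn
      (isOpen_overlap x x').measurableSet hK
  set O := overlap (n := n) x x' ∩ transition x x' ⁻¹' K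
  have hm : ∀ (x : M) (S : Set (Eu n)), MeasurableSet S → S ⊆ (extChartAt (𝓡 n) x).target →
      MeasurableSet ((S ×ˢ univ) ∩ cotCoord x ⁻¹' A) := fun x S hS hSt =>
    measurableSet_inter_preimage ((continuousOn_cotCoord x).mono (prod_mono hSt subset_rfl))
      (hS.prod MeasurableSet.univ) hA
  rw [Measure.prod_apply (hm x O hO fun y hy => hy.1.1), Measure.prod_apply (hm x' K hK hKt)]
  set h : Eu n → ℝ≥0∞ := fun y => covolume n (Prod.mk y ⁻¹' ((K ×ˢ univ) ∩ cotCoord x' ⁻¹' A))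
  -- Fibrewise, the change of coordinates stretches the volume by `|det J|`. This is exactly the
  -- density in the change of variables on the base, and so the two combine into an equality over
  -- the image of `O`.
  have h1 : ∀ y, covolume n (Prod.mk y ⁻¹' ((O ×ˢ univ) ∩ cotCoord x ⁻¹' A)) =
      O.indicator (fun y => ENNReal.ofReal |(jac x x' y).det| * h (transition x x' y)) y := by
    intro y
    by_cases hy : y ∈ O
    · rw [indicator_of_mem hy, ← covolume_preimage_comp _ _ (jacInv_jac hy.1)]
      congr 1
      ext η
      have h2 := cotCoord_transition hy.1 η
      simp only [mem_preimage, mem_inter_iff, mem_prod, mem_univ, and_true, mem_ofPred_eq, hy, h2,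
        mem_preimage.1 hy.2]
    · rw [indicator_of_notMem hy]
      simp [hy]
  simp only [h1]
  rw [lintegral_indicator hO, ← lintegral_image_eq_lintegral_abs_det_fderiv_mul volume hO]
  · exact setLIntegral_le_lintegral _ _
  · intro y hy
    have h2 := hasFDerivAt_transition hy.1
    rw [jac, h2.fderiv]
    exact h2.hasFDerivWithinAt
  · intro y hy y' hy' h2
    have h3 := symm_transition hy.1
    have h4 := symm_transition hy'.1
    rw [h2, h4] at h3
    exact (extChartAt (𝓡 n) x).symm.injOn hy.1.1 hy'.1.1 h3.symm

lemma cotVolume_eq : cotVolume n M = ⨆ x : M, ((volume.prod (covolume n)).restrict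
    ((extChartAt (𝓡 n) x).target ×ˢ univ)).map (cotCoord x) := by
  unfold cotVolume
  congr 1
  ext1 x
  rw [← Measure.prod_restrict, Measure.restrict_univ]
  rfl

lemma aemeasurable_cotCoord (x : M) {K : Set (Eu n)} (hK : MeasurableSet K)
    (hKt : K ⊆ (extChartAt (𝓡 n) x).target) :
    AEMeasurable (cotCoord x) ((volume.prod (covolume n)).restrict (K ×ˢ univ)) :=
  ((continuousOn_cotCoord x).mono (prod_mono hKt subset_rfl)).aemeasurable
    (hK.prod MeasurableSet.univ)

/-- The volume of `T*M` is controlled by finitely many charts. -/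
lemma cotVolume_le_sum {s : Finset M} {K : M → Set (Eu n)} (hK : ∀ x, IsCompact (K x))
    (hKt : ∀ x, K x ⊆ (extChartAt (𝓡 n) x).target)
    (hcov : ∀ z, ∃ x ∈ s, z ∈ (extChartAt (𝓡 n) x).source ∧ extChartAt (𝓡 n) x z ∈ K x) :
    cotVolume n M ≤ ∑ x ∈ s,
      ((volume.prod (covolume n)).restrict (K x ×ˢ univ)).map (cotCoord x) := by
  rw [cotVolume_eq]
  refine iSup_le fun x => Measure.le_iff.2 fun A hA => ?_
  have hT := (isOpen_extChartAt_target (I := 𝓡 n) x).measurableSet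
  rw [Measure.map_apply_of_aemeasurable (aemeasurable_cotCoord x hT subset_rfl) hA,
    Measure.restrict_apply₀' (hT.prod MeasurableSet.univ).nullMeasurableSet, Measure.finsetSum_apply]
  have h1 : cotCoord x ⁻¹' A ∩ ((extChartAt (𝓡 n) x).target ×ˢ univ) ⊆
      ⋃ x' ∈ s, (((overlap x x' ∩ transition x x' ⁻¹' (K x')) ×ˢ univ) ∩ cotCoord x ⁻¹' A) := by
    rintro ⟨y, η⟩ ⟨h2, h3, -⟩
    obtain ⟨x', hx', h4, h5⟩ := hcov ((extChartAt (𝓡 n) x).symm y)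
    exact mem_biUnion hx' ⟨⟨⟨⟨h3, h4⟩, h5⟩, mem_univ _⟩, h2⟩
  refine (measure_mono h1).trans ((measure_biUnion_finset_le s _).trans
    (Finset.sum_le_sum fun x' _ => ?_))
  refine (volume_cotCoord_overlap_le x x' (hK x').measurableSet (hKt x') hA).trans_eq ?_
  rw [Measure.map_apply_of_aemeasurable (aemeasurable_cotCoord x' (hK x').measurableSet (hKt x'))
    hA, Measure.restrict_apply₀' ((hK x').measurableSet.prod MeasurableSet.univ).nullMeasurableSet,
    inter_comm]

/-- Finitely many compact pieces of charts cover `M`, and over each of them the unit coball lies in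
a bounded box. -/
lemma cotVolume_lt_top [CompactSpace M] (g : Metric n M) :
    cotVolume n M {p | 0 < coNorm g p ∧ coNorm g p < 1} < ⊤ := by
  have hex : ∀ x : M, ∃ K : Set (Eu n), IsCompact K ∧ K ⊆ (extChartAt (𝓡 n) x).target ∧
      K ∈ 𝓝 (extChartAt (𝓡 n) x x) := fun x => by
    obtain ⟨K, hK, hKt, hKc⟩ := local_compact_nhds (extChartAt_target_mem_nhds (I := 𝓡 n) x)
    exact ⟨K, hKc, hKt, hK⟩
  choose K hK hKt hKn using hex
  obtain ⟨s, hs⟩ := CompactSpace.elim_nhds_subcover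
    (fun x : M => (extChartAt (𝓡 n) x).source ∩ extChartAt (𝓡 n) x ⁻¹' K x) fun x =>
    Filter.inter_mem (extChartAt_source_mem_nhds x) ((continuousAt_extChartAt (I := 𝓡 n) x) (hKn x))
  have hle := cotVolume_le_sum hK hKt (s := s) fun z => by
    have hz : z ∈ ⋃ x ∈ s, ((extChartAt (𝓡 n) x).source ∩ extChartAt (𝓡 n) x ⁻¹' K x) :=
      hs ▸ mem_univ z
    simpa only [mem_iUnion, exists_prop, mem_inter_iff, mem_preimage] using hz
  have hW : MeasurableSet {p : Cotangent n M | 0 < coNorm g p ∧ coNorm g p < 1} :=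
    ((isOpen_lt continuous_const (continuous_coNorm g)).inter
      (isOpen_lt (continuous_coNorm g) continuous_const)).measurableSet
  refine (Measure.le_iff'.1 hle _).trans_lt ?_
  rw [Measure.finsetSum_apply]
  refine ENNReal.sum_lt_top.2 fun x _ => ?_
  rw [Measure.map_apply_of_aemeasurable (aemeasurable_cotCoord x (hK x).measurableSet (hKt x)) hW,
    Measure.restrict_apply₀' ((hK x).measurableSet.prod MeasurableSet.univ).nullMeasurableSet]
  obtain ⟨D, hD, hcomp⟩ := exists_norm_compare g x (hK x) (hKt x)
  refine (measure_mono (t := K x ×ˢ Metric.closedBall 0 D) ?_).trans_lt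
    ((hK x).prod (isCompact_closedBall _ _)).measure_lt_top
  rintro ⟨y, η⟩ ⟨h1, h2, -⟩
  exact ⟨h2, mem_closedBall_zero_iff.2 (norm_le_of_coNorm_le g (hKt x h2) hD.le
    (fun v => (hcomp y h2 v).2) (le_of_lt h1.2))⟩

instance [CompactSpace M] (g : Metric n M) : IsFiniteMeasure (liouville g) where
  measure_univ_lt_top := by
    rw [liouville, Measure.smul_apply, smul_eq_mul]
    refine ENNReal.mul_lt_top (ENNReal.natCast_lt_top _) ?_
    refine (Measure.comap_apply_le _ _ nullMeasurableSet_univ).trans_lt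
      ((measure_mono (subset_univ _)).trans_lt ?_)
    -- No measurability of the radial projection is required: otherwise the image measure is zero by
    -- convention, and finiteness is trivial.
    by_cases hr : AEMeasurable (radial g)
      ((cotVolume n M).restrict {p | 0 < coNorm g p ∧ coNorm g p < 1})
    · rw [Measure.map_apply_of_aemeasurable hr MeasurableSet.univ, preimage_univ,
        Measure.restrict_apply_univ]
      exact cotVolume_lt_top g
    · rw [Measure.map_of_not_aemeasurable hr]
      simp

end Charts

/-! ### Continuity of the energy density -/

section Charts

variable {n : ℕ} {M : Type*} [TopologicalSpace M] [ChartedSpace (Eu n) M]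
  [IsManifold (𝓡 n) ∞ M]


variable {k : ℕ} {g : Metric n M} {α t₀ T C : ℝ} {u : ℝ → M → Eu n}

lemma IsBoundedFlow.continuousOn_bilCoord_effMetric (hu : IsBoundedFlow g t₀ T u C) (α : ℝ) {t : ℝ}
    (ht : t ∈ Icc t₀ T) (x : M) :
    ContinuousOn (bilCoord (effMetric g α t₀ u t) x) (extChartAt (𝓡 n) x).target := by
  intro y hy
  obtain ⟨K, hK, hKt, hKc⟩ := local_compact_nhds (target_mem_nhds hy)
  have h1 : ContinuousOn (bilCoord (effMetric g α t₀ u t) x) K :=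
    (hu.continuousOn_effMetric α x hKc hKt).comp (f := fun y => (t, y)) (by fun_prop)
      fun y hy => ⟨ht, hy⟩
  exact (h1.continuousAt hK).continuousWithinAt

/-- Provides the measurability needed for integrability. In canonical coordinates the density is a
contraction of the continuous inverse Gram matrix with the `C¹` form, away from `ξ = 0`. -/
lemma continuous_energyDensity (hu : IsBoundedFlow g t₀ T u C)
    (hg' : ∀ t ∈ Icc t₀ T, ∀ x : M, ∀ v : Eu n, v ≠ 0 → 0 < effMetric g α t₀ u t x v v)
    {Λ : ℝ → Cotangent n M → KForm n k} (hΛ : IsC1Lift t₀ T Λ) {t : ℝ} (ht : t ∈ Ico t₀ T) :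
    Continuous (energyDensity g α t₀ u Λ t) := by
  have htc : t ∈ Icc t₀ T := ⟨ht.1, ht.2.le⟩
  have h : ContinuousOn (fun p : Cotangent n M => formSq (effMetric g α t₀ u t p.proj) (Λ t p))
      {p | coNorm g p = 1} := by
    refine continuousOn_of_continuousOn_cotCoord fun x => ?_
    have h1 : ContinuousOn (fun q : Eu n × (Eu n →L[ℝ] ℝ) =>
        formSq (bilCoord (effMetric g α t₀ u t) x q.1) (liftCoord (Λ t) x q))
        ((extChartAt (𝓡 n) x).target ×ˢ univ ∩ cotCoord x ⁻¹' {p | coNorm g p = 1}) := by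
      refine continuousOn_formSq ((hu.continuousOn_bilCoord_effMetric α htc x).comp continuousOn_fst
        fun q hq => hq.1.1) (fun q hq => isInner_bilCoord hq.1.1 (hu.isInner_effMetric hg' htc _))
        fun q hq => ?_
      have hq0 : q.2 ≠ 0 := fun h0 => by
        refine ne_zero_of_coNorm_eq_one (g := g) (z := (extChartAt (𝓡 n) x).symm q.1)
          (ξ := q.2 ∘L coframe x q.1) hq.2 ?_
        rw [h0, ContinuousLinearMap.zero_comp]
      exact (hΛ.differentiableAt ht hq.1.1 hq0).continuousAt.continuousWithinAt
    exact h1.congr fun q hq =>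
      (formSq_liftCoord hq.1.1 (hu.isInner_effMetric hg' htc _) (Λ t) q.2).symm
  exact continuousOn_iff_continuous_domRestrict.1 h

end Charts

end CosphereLift

end

/-! ### The regularity criterion -/

theorem mainTheorem12 {n : ℕ} {M : Type*} [TopologicalSpace M] [T2Space M] [CompactSpace M]
    [ChartedSpace (Eu n) M] [IsManifold (𝓡 n) ∞ M] (g : Metric n M)
    (k : ℕ) (α ν t₀ T : ℝ) (hν : 0 ≤ ν) (ht : t₀ < T)
    -- a smooth divergence-free velocity field on `[t₀, T)`, bounded in `W^{2,∞}(M)`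
    (u : ℝ → M → Eu n)
    (hu : ContMDiffOn (𝓘(ℝ, ℝ).prod (𝓡 n)) (𝓡 n).tangent ∞
      (fun q : ℝ × M => (⟨q.2, u q.1 q.2⟩ : TangentBundle (𝓡 n) M)) (Ico t₀ T ×ˢ univ))
    (hdiv : ∀ t ∈ Ico t₀ T, DivFree g (u t))
    (hbdd : ∃ C : ℝ≥0, ∀ t ∈ Ico t₀ T, w2infNorm g (u t) ≤ C)
    -- the effective metric is a Riemannian metric on `[t₀, T]`
    (hg' : ∀ t ∈ Icc t₀ T, ∀ x : M, ∀ v : Eu n, v ≠ 0 → 0 < effMetric g α t₀ u t x v v)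
    -- the coefficients of the zeroth order operators, the forcing, and a solution
    (K : ℝ → Cotangent n M → Curv n →ₗ[ℝ] KForm n k →ₗ[ℝ] KForm n k)
    (hK : IsContinuousCoeff pushCurv g t₀ T K)
    (N : ℝ → Cotangent n M → Endo n →ₗ[ℝ] KForm n k →ₗ[ℝ] KForm n k)
    (hN : IsContinuousCoeff pushEndo g t₀ T N)
    (F : ℝ → Cotangent n M → KForm n k) (hF : IsContinuousLift g t₀ T F)
    (Λ : ℝ → Cotangent n M → KForm n k)
    (hΛ : IsLiftedSolution g α ν t₀ T u K N F Λ) :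
    ∃ B : ℝ, ∀ t ∈ Ico t₀ T,
      Integrable (energyDensity g α t₀ u Λ t) (liouville g) ∧
        liftedEnergy g α t₀ u Λ t ≤ B := by
  obtain ⟨C, hC⟩ := hbdd
  have hflow : IsBoundedFlow g t₀ T u C :=
    ⟨hu, fun t ht => isBoundedField_of_w2infNorm_le g (hC t ht), C.coe_nonneg⟩
  obtain ⟨B, hB, hbound⟩ := hΛ.exists_isFormBound hν hflow hg' hK hN hF
  obtain ⟨D, hD, hle⟩ := hflow.exists_metric_le_effMetric α hg'
  -- The constant of `formSq_le`, with the comass bound `B` and the comparison `g ≤ D g'`.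
  set E := ((k.factorial : ℝ))⁻¹ * ((n : ℝ) ^ k * (B * Real.sqrt D ^ k) ^ 2)
  refine ⟨1 / 2 * (E * (liouville g).real univ), fun t ht => ?_⟩
  have hdens : ∀ p, ‖energyDensity g α t₀ u Λ t p‖ ≤ E := fun p => by
    have htc : t ∈ Icc t₀ T := ⟨ht.1, ht.2.le⟩
    have hin := hflow.isInner_effMetric hg' htc p.1.proj
    refine (Real.norm_of_nonneg (formSq_nonneg hin _)).trans_le ?_
    exact formSq_le hin hB (hle _ t htc) (hbound t ht p.1.proj (covec p.1) p.2)
  refine ⟨Integrable.of_bound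
    (continuous_energyDensity hflow hg' hΛ.c1 ht).aestronglyMeasurable E
    (Filter.Eventually.of_forall hdens), ?_⟩
  refine mul_le_mul_of_nonneg_left ?_ (by norm_num)
  exact (Real.le_norm_self _).trans (norm_integral_le_of_norm_le_const
    (Filter.Eventually.of_forall hdens))
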